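/- Indices run over $\{1,2,3\}=\{x,y,z\}$, repeated indices are summed, Greek indices run over $\{1,2\}$, $\epsilon_{ijk}$ is the permutation symbol and $\epsilon_{\alpha\beta}:=\epsilon_{z\alpha\beta}$. Let $\Omega\subset\mathbb R^3$ be open and $x_0\in\mathbb R^3$. For a tensor field $\mathcal E$ put $$\overline\partial_m\omega_k:=\epsilon_{kpq}\partial_p\mathcal E_{qm},\qquad \overline\partial_l b_k:=\mathcal E_{kl}+\epsilon_{kpq}(x_p-x_{0p})\overline\partial_l\omega_q$$ (the Frank and Burgers tensors). A *mesoscopic crystal* on $\Omega$ consists of the following. (a) Countably many distinct lines $L^{(n)}$, $n\in\mathcal I\subset\mathbb N$, parallel to the $z$-axis (each one a connected component of the intersection of $\Omega$ with a line of $\mathbb R^3$ parallel to the $z$-axis), whose union $\mathcal L$ is closed in $\Omega$. (b) A strain $\mathcal E^\star\in L^1_{loc}(\Omega)$, symmetric and smooth on $\Omega\setminus\mathcal L$, such that $\partial_z\mathcal E^\star=0$ in the sense of distributions on $\Omega$, and the distributional incompatibility $\eta^\star_{kl}:=\epsilon_{kpm}\epsilon_{lqn}\partial_p\partial_q\mathcal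 E^\star_{mn}$ vanishes on $\Omega\setminus\mathcal L$. (c) For each line a Frank vector $\Omega^{\star(n)}$ and a Burgers vector $B^{\star(n)}$, the jumps around $L^{(n)}$ of the multivalued rotation and Burgers fields: for every point of $L^{(n)}$, the counterclockwise line integrals $\oint\overline\partial_j\omega^\star_k\,d\xi_j$ and $\oint\overline\partial_j b^\star_k\,d\xi_j$ along horizontal circles contained in $\Omega\setminus\mathcal L$ and centred at that point tend to $\Omega_k^{\star(n)}$ and $B_k^{\star(n)}$ as the radius tends to $0$ (for an isolated line these integrals do not depend on the small radius). The disclination and dislocation densities $$\Theta^\star_{ij}:=\sum_{n}\Omega^{\star(n)}_j\tau_i\,\delta_{L^{(n)}},\qquad \Lambda^\star_{ij}:=\sum_{n}B^{\star(n)}_j\tau_i\,\delta_{L^{(n)}},\qquad \tau=e_z,$$ where $\delta_L$ is the one-dimensional Hausdorff measure on $L$, are Radon measures on $\Omega$, i.e. $\sum_n|\Omega_j^{\star(n)}|\,\mathcal H^1(L^{(n)}\cap K)<\infty$ and $\sum_n|B_j^{\star(n)}|\,\mathcal H^1(L^{(n)}\cap K)<\infty$ for every $j$ and every compact $K\subset\Omega$.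 **Theorem.** Let a family of mesoscopic crystals on $\Omega$ (indexed by a set with a proper filter, e.g. a sequence) be such that $\Theta^\star\to\Theta$, $\Lambda^\star\to\Lambda$, $\mathcal E^\star\to\mathcal E$ in the sense of measures on $\Omega$ (tested with continuous functions with compact support in $\Omega$), where $\Theta,\Lambda,\mathcal E$ are tensor fields with components in $\mathcal C^\infty(\Omega)$. Define the macroscopic contortion, the completed Frank tensor and the completed Burgers tensor by $$\kappa_{ij}:=\delta_{iz}\bigl(\Lambda_{zj}-\delta_{j\alpha}\epsilon_{\alpha\beta}\Theta_{zz}(x_\beta-x_{0\beta})\bigr)-\tfrac12\Lambda_{zz}\delta_{ij},$$ $$\eth_j\omega_k:=\overline\partial_j\omega_k-\kappa_{kj},\qquad \eth_j b_k:=\mathcal E_{kj}+\epsilon_{kpq}(x_p-x_{0p})\,\eth_j\omega_q,$$ with $\overline\partial_j\omega_k$ the Frank tensor of $\mathcal E$. Then, everywhere in $\Omega$ and for all $i,k$, $$\Theta_{ik}=\epsilon_{ilj}\partial_l\eth_j\omega_k,\qquad \Lambda_{ik}=\epsilon_{ilj}\partial_l\eth_j b_k .$$ -/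

import Mathlib

open MeasureTheory Filter Topology
open scoped ContDiff

noncomputable section

namespace Crystal

/-- Three-dimensional Euclidean space; the coordinates `x, y, z` have indices `0, 1, 2`. -/
abbrev Space := EuclideanSpace ℝ (Fin 3)

/-- A second-order tensor field, given by its Cartesian components. -/
abbrev TensorField := Fin 3 → Fin 3 → Space → ℝ

/-- The permutation symbol `ε_{ijk}` (indices in `{0, 1, 2}`). The planar symbol `ε_{αβ}` is
`eps 2 α β`. -/
def eps (i j k : Fin 3) : ℝ :=
  (((j : ℕ) : ℝ) - ((i : ℕ) : ℝ)) * (((k : ℕ) : ℝ) - ((i : ℕ) : ℝ)) *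
    (((k : ℕ) : ℝ) - ((j : ℕ) : ℝ)) / 2

/-- The Kronecker symbol `δ_{ij}`. -/
def kron (i j : Fin 3) : ℝ := if i = j then 1 else 0

/-- The partial derivative `∂_l f`. -/
def pd (l : Fin 3) (f : Space → ℝ) (x : Space) : ℝ :=
  fderiv ℝ f x (EuclideanSpace.single l (1 : ℝ))

/-- The curl `ε_{ilj} ∂_l T_{jk}` of a tensor field on its first index. -/
def curl (T : TensorField) : TensorField := fun i k x =>
  ∑ l, ∑ j, eps i l j * pd l (T j k) x

/-- The Frank tensor `∂̄_m ω_k = ε_{kpq} ∂_p E_{qm}` (first index `m`, second index `k`). -/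
def frankTensor (E : TensorField) : TensorField := fun m k x =>
  ∑ p, ∑ q, eps k p q * pd p (E q m) x

/-- The Burgers tensor `∂̄_l b_k = E_{kl} + ε_{kpq} (x_p - x_{0p}) ∂̄_l ω_q`
(first index `l`, second index `k`). -/
def burgersTensor (E : TensorField) (x₀ : Space) : TensorField := fun l k x =>
  E k l x + ∑ p, ∑ q, eps k p q * (x p - x₀ p) * frankTensor E l q x

/-! ### Mesoscopic scale -/

/-- Smooth test functions with compact support in `U`. -/
def IsTestFunction (U : Set Space) (φ : Space → ℝ) : Prop :=
  ContDiff ℝ ∞ φ ∧ HasCompactSupport φ ∧ tsupport φ ⊆ U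

/-- The value `⟨η_{kl}, φ⟩` of the distributional incompatibility
`η_{kl} = ε_{kpm} ε_{lqn} ∂_p ∂_q E_{mn}` of a locally integrable tensor. -/
def incompatibility (E : TensorField) (k l : Fin 3) (φ : Space → ℝ) : ℝ :=
  ∑ p, ∑ m, ∑ q, ∑ n, eps k p m * eps l q n * ∫ x, E m n x * pd p (pd q φ) x

/-- `L` is a line of the body `Ω` parallel to the `z`-axis: a connected component of the
intersection of `Ω` with a line of `ℝ³` parallel to that axis. -/
def IsVerticalLine (Ω L : Set Space) : Prop :=
  ∃ x ∈ Ω, L = connectedComponentIn {y | y ∈ Ω ∧ y 0 = x 0 ∧ y 1 = x 1} x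

/-- The unit tangent vector of the defect lines, `τ = e_z`. -/
def tangent (i : Fin 3) : ℝ := kron i 2

/-- The point of angle `θ` on the horizontal circle of centre `x` and radius `r`. -/
def circlePoint (x : Space) (r θ : ℝ) : Space :=
  x + !₂[r * Real.cos θ, r * Real.sin θ, 0]

/-- The line integral `∮ T_{jk} dξ_j` along the horizontal circle of centre `x` and radius `r`,
run counterclockwise. For `T` the Frank (Burgers) tensor it is the jump of the multivalued
rotation field `ω_k` (Burgers field `b_k`) along that loop. -/
def circulation (T : TensorField) (x : Space) (r : ℝ) (k : Fin 3) : ℝ :=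
  ∫ θ in (0 : ℝ)..(2 * Real.pi),
    (T 0 k (circlePoint x r θ) * (-(r * Real.sin θ)) +
      T 1 k (circlePoint x r θ) * (r * Real.cos θ))

/-- `V` is the jump around the line `L` of the multivalued field with gradient `T`, where `T` is
defined on `U` (the body without all its defect lines): at every point of `L`, the circulation of
`T` along a horizontal circle in `U` centred at that point tends to `V` as the radius tends to `0`.
For a curl-free `T` and an isolated line the circulation does not depend on the (small) radius, so
that this is the value on any small loop around `L`; the limit gives the jump a meaning for a line
at which other lines accumulate. -/
def IsJump (U L : Set Space) (T : TensorField) (V : Fin 3 → ℝ) : Prop :=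
  ∀ x ∈ L, ∀ k,
    Tendsto (fun r => circulation T x r k) (𝓝[{r | 0 < r ∧ ∀ θ, circlePoint x r θ ∈ U}] 0) (𝓝 (V k))

/-- A two-dimensional mesoscopic distribution of dislocations and disclinations in the body `Ω`,
together with its elastic strain, Frank vectors and Burgers vectors; `x₀` is the point where
displacement and rotation are given. -/
structure Mesoscopic (Ω : Set Space) (x₀ : Space) where
  /-- the index set of the defect lines -/
  I : Set ℕ
  /-- the defect lines -/
  line : I → Set Space
  isVerticalLine : ∀ n, IsVerticalLine Ω (line n)
  line_injective : Function.Injective line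
  /-- the defect set is closed in `Ω` -/
  closed : ∃ F : Set Space, IsClosed F ∧ (⋃ n, line n) = F ∩ Ω
  /-- the linear elastic strain -/
  strain : TensorField
  strain_locallyIntegrable : ∀ i j, LocallyIntegrableOn (strain i j) Ω
  strain_symm : ∀ i j, ∀ x ∈ Ω \ ⋃ n, line n, strain i j x = strain j i x
  strain_smooth : ∀ i j, ContDiffOn ℝ ∞ (strain i j) (Ω \ ⋃ n, line n)
  /-- `∂_z E = 0` as a distribution on `Ω` -/
  strain_z : ∀ i j φ, IsTestFunction Ω φ → ∫ x, strain i j x * pd 2 φ x = 0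
  /-- the strain is compatible outside the defect set -/
  compatible : ∀ k l φ, IsTestFunction (Ω \ ⋃ n, line n) φ → incompatibility strain k l φ = 0
  /-- the Frank vectors of the lines -/
  frank : I → Fin 3 → ℝ
  frank_isJump : ∀ n, IsJump (Ω \ ⋃ m, line m) (line n) (frankTensor strain) (frank n)
  /-- the Burgers vectors of the lines -/
  burgers : I → Fin 3 → ℝ
  burgers_isJump : ∀ n, IsJump (Ω \ ⋃ m, line m) (line n) (burgersTensor strain x₀) (burgers n)
  /-- the disclination density is a Radon measure on `Ω` -/
  frank_radon : ∀ K ⊆ Ω, IsCompact K → ∀ j,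
    Summable fun n => |frank n j| * (μH[1] (line n ∩ K)).toReal
  /-- the dislocation density is a Radon measure on `Ω` -/
  burgers_radon : ∀ K ⊆ Ω, IsCompact K → ∀ j,
    Summable fun n => |burgers n j| * (μH[1] (line n ∩ K)).toReal

/-- The disclination density `Θ*_{ij} = ∑_n Ω_j^{(n)} τ_i δ_{L^{(n)}}` as a Radon measure, acting
on a continuous function `φ` with compact support in `Ω`; `δ_L` is the one-dimensional Hausdorff
measure on `L`. -/
def Mesoscopic.disclination {Ω : Set Space} {x₀ : Space} (M : Mesoscopic Ω x₀) (i j : Fin 3)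
    (φ : Space → ℝ) : ℝ :=
  ∑' n, M.frank n j * tangent i * ∫ x in M.line n, φ x ∂μH[1]

/-- The dislocation density `Λ*_{ij} = ∑_n B_j^{(n)} τ_i δ_{L^{(n)}}` as a Radon measure. -/
def Mesoscopic.dislocation {Ω : Set Space} {x₀ : Space} (M : Mesoscopic Ω x₀) (i j : Fin 3)
    (φ : Space → ℝ) : ℝ :=
  ∑' n, M.burgers n j * tangent i * ∫ x in M.line n, φ x ∂μH[1]

/-- The strain as the Radon measure `E*_{ij} dx`. -/
def Mesoscopic.strainMeasure {Ω : Set Space} {x₀ : Space} (M : Mesoscopic Ω x₀) (i j : Fin 3)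
    (φ : Space → ℝ) : ℝ :=
  ∫ x, M.strain i j x * φ x

/-! ### Macroscopic scale -/

/-- Convergence, in the sense of measures on `Ω` and along the filter `l`, of tensor-valued Radon
measures `μ` to the measure with density `T`. -/
def HomogenizesTo {ι : Type*} (Ω : Set Space) (l : Filter ι)
    (μ : ι → Fin 3 → Fin 3 → (Space → ℝ) → ℝ) (T : TensorField) : Prop :=
  ∀ i j φ, Continuous φ → HasCompactSupport φ → tsupport φ ⊆ Ω →
    Tendsto (fun n => μ n i j φ) l (𝓝 (∫ x, T i j x * φ x))

/-- The macroscopic contortion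
`κ_{ij} = δ_{iz} (Λ_{zj} - δ_{jα} ε_{αβ} Θ_{zz} (x_β - x_{0β})) - (1/2) Λ_{zz} δ_{ij}`. -/
def contortion (Θ Λ : TensorField) (x₀ : Space) : TensorField := fun i j x =>
  kron i 2 * (Λ 2 j x - ∑ b, eps 2 j b * Θ 2 2 x * (x b - x₀ b)) - 1 / 2 * Λ 2 2 x * kron i j

/-- The completed Frank tensor `ð_j ω_k = ∂̄_j ω_k - κ_{kj}`. -/
def completedFrank (E Θ Λ : TensorField) (x₀ : Space) : TensorField := fun j k x =>
  frankTensor E j k x - contortion Θ Λ x₀ k j x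

/-- The completed Burgers tensor `ð_j b_k = E_{kj} + ε_{kpq} (x_p - x_{0p}) ð_j ω_q`. -/
def completedBurgers (E Θ Λ : TensorField) (x₀ : Space) : TensorField := fun j k x =>
  E k j x + ∑ p, ∑ q, eps k p q * (x p - x₀ p) * completedFrank E Θ Λ x₀ j q x

end Crystal

end

/-! The problem is local and planar. In a box `U × J` inside `Ω` every defect line that meets the
box fills a vertical segment, and off the defects the strain depends only on the horizontal
position. Tested on products `u(x, y) χ(z)`, a crystal becomes a `PlanarCrystal`: a strain on `U`,
smooth off a countable relatively closed set of points that carry Frank and Burgers vectors.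

The core is to identify the planar incompatibility, a distribution supported on these points,
although they may accumulate. Subtract from it the expected point sources. If the remainder had
nonempty support, that support would be countable and locally closed, hence by Baire would have an
isolated point `p` (`vanishes_of_removable`). Second derivatives of a locally integrable function,
locally summable point masses and first derivatives of such masses cannot produce second derivatives
of a mass at `p`. So the remainder vanishes near `p` as soon as its moments against `1`, `x`, `y` do
(`IsTame.vanishes_of_affine`).

These moments come from the jumps. Only countably many radii are hit by defects, so there are radial
cutoffs shrinking to `p` whose gradient avoids the defects. Pairing the Frank or Burgers tensor with
the rotated gradient of such a cutoff gives minus an average of circulations, which tends to minus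
the jump (`exists_cutoffs`). Integration by parts turns the same pairing into a moment of the
incompatibility. Since the remainder sees only germs at `p`, its moments do not depend on the
cutoff, and the limit shows that they vanish. For the components of the strain with an index `z`,
the jumps do not give all moments; the others follow from equality of mixed derivatives
(`moments_of_curl_free`).

Three laws result: the second derivatives of `E_zz` vanish; `∂_w (∂_x E_zy - ∂_y E_zx) = ½ ∂_w Λ_zz`
for horizontal `w`, which also forces the Frank vectors to be vertical; and the incompatibility
`η_zz` equals `Θ_zz + ∂_x κ_zy - ∂_y κ_zx`. They are linear in strain, disclination and dislocation
measures, so they pass to the limit and hold pointwise for the smooth limits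
(`macroscopic_of_homogenizesTo`). The two curl formulas are then index algebra. -/

noncomputable section

namespace Crystal

/-! ### Directional derivatives and test functions -/

section Calculus

variable {E : Type*} [NormedAddCommGroup E] [NormedSpace ℝ E]

/-- The derivative of `u` in the direction `v`. -/
def dd (v : E) (u : E → ℝ) : E → ℝ := fun x => fderiv ℝ u x v

/-- Smooth functions with compact support in `U`. -/
structure IsTest (U : Set E) (u : E → ℝ) : Prop where
  smooth : ContDiff ℝ ∞ u
  compact : HasCompactSupport u
  subset : tsupport u ⊆ U

theorem dd_add {u w : E → ℝ} (hu : ContDiff ℝ ∞ u) (hw : ContDiff ℝ ∞ w) (v : E) :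
    dd v (u + w) = dd v u + dd v w := by
  ext x
  simp [dd, fderiv_add (hu.differentiable (by simp) x) (hw.differentiable (by simp) x)]

theorem dd_const_mul (c : ℝ) {u : E → ℝ} (hu : ContDiff ℝ ∞ u) (v : E) :
    dd v (fun x => c * u x) = fun x => c * dd v u x := by
  ext x
  simp [dd, fderiv_const_mul (hu.differentiable (by simp) x)]

theorem dd_mul_at {u w : E → ℝ} {x : E} (hu : DifferentiableAt ℝ u x)
    (hw : DifferentiableAt ℝ w x) (v : E) :
    dd v (fun x => u x * w x) x = u x * dd v w x + dd v u x * w x := by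
  simp [dd, fderiv_fun_mul hu hw, mul_comm]

theorem dd_mul {u w : E → ℝ} (hu : ContDiff ℝ ∞ u) (hw : ContDiff ℝ ∞ w) (v : E) :
    dd v (fun x => u x * w x) = fun x => u x * dd v w x + dd v u x * w x :=
  funext fun x => dd_mul_at (hu.differentiable (by simp) x) (hw.differentiable (by simp) x) v

theorem dd_smooth {u : E → ℝ} (hu : ContDiff ℝ ∞ u) (v : E) : ContDiff ℝ ∞ (dd v u) :=
  (hu.fderiv_right (m := ∞) (by simp)).clm_apply contDiff_const

theorem dd_smoothOn {u : E → ℝ} {U : Set E} (hU : IsOpen U) (hu : ContDiffOn ℝ ∞ u U) (v : E) :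
    ContDiffOn ℝ ∞ (dd v u) U :=
  (hu.fderiv_of_isOpen hU (m := ∞) (by simp)).clm_apply contDiffOn_const

theorem dd_comm_at {u : E → ℝ} {x : E} (hu : ContDiffAt ℝ ∞ u x) (v w : E) :
    dd v (dd w u) x = dd w (dd v u) x := by
  have h : IsSymmSndFDerivAt ℝ u x := hu.isSymmSndFDerivAt
    (by simpa using (mod_cast le_top : ((2 : ℕ∞) : WithTop ℕ∞) ≤ ∞))
  have hd : DifferentiableAt ℝ (fderiv ℝ u) x :=
    (hu.fderiv_right (m := ∞) (by simp)).differentiableAt (by simp)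
  have key : ∀ a b : E, dd a (dd b u) x = fderiv ℝ (fderiv ℝ u) x a b := by
    intro a b
    change fderiv ℝ (fun y => fderiv ℝ u y b) x a = _
    rw [fderiv_clm_apply hd (differentiableAt_const b)]
    simp
  rw [key, key]
  exact h.eq v w

theorem dd_comm {u : E → ℝ} (hu : ContDiff ℝ ∞ u) (v w : E) :
    dd v (dd w u) = dd w (dd v u) :=
  funext fun _ => dd_comm_at hu.contDiffAt v w

theorem dd_congr {u w : E → ℝ} {x : E} (h : u =ᶠ[𝓝 x] w) (v : E) : dd v u x = dd v w x := by
  simp [dd, h.fderiv_eq]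

theorem dd_eventuallyEq {u w : E → ℝ} {x : E} (h : u =ᶠ[𝓝 x] w) (v : E) :
    dd v u =ᶠ[𝓝 x] dd v w :=
  h.eventuallyEq_nhds.mono fun _ hy => dd_congr hy v

theorem tsupport_dd_subset (v : E) (u : E → ℝ) : tsupport (dd v u) ⊆ tsupport u :=
  tsupport_fderiv_apply_subset ℝ v

namespace IsTest

variable {U V : Set E} {u w : E → ℝ}

theorem mono (hu : IsTest U u) (h : U ⊆ V) : IsTest V u := ⟨hu.1, hu.2, hu.3.trans h⟩

theorem add (hu : IsTest U u) (hw : IsTest U w) : IsTest U (u + w) :=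
  ⟨hu.1.add hw.1, hu.2.add hw.2, (tsupport_add u w).trans (Set.union_subset hu.3 hw.3)⟩

theorem mul_right (hu : IsTest U u) (hw : ContDiff ℝ ∞ w) : IsTest U (fun x => u x * w x) :=
  ⟨hu.1.mul hw, hu.2.mul_right, (tsupport_mul_subset_left).trans hu.3⟩

theorem mul_left (hu : IsTest U u) (hw : ContDiff ℝ ∞ w) : IsTest U (fun x => w x * u x) :=
  ⟨hw.mul hu.1, hu.2.mul_left, (tsupport_mul_subset_right).trans hu.3⟩

theorem const_mul (hu : IsTest U u) (c : ℝ) : IsTest U (fun x => c * u x) :=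
  hu.mul_left contDiff_const

theorem dd (hu : IsTest U u) (v : E) : IsTest U (dd v u) :=
  ⟨dd_smooth hu.1 v, hu.2.fderiv_apply ℝ v, (tsupport_dd_subset v u).trans hu.3⟩

theorem restrict (hu : IsTest U u) (h : ∀ x, x ∉ V → u =ᶠ[𝓝 x] 0) : IsTest V u :=
  ⟨hu.1, hu.2, fun x hx => by
    by_contra hxV
    exact (notMem_tsupport_iff_eventuallyEq.2 (h x hxV)) hx⟩

theorem diff_singleton {p : E} (hu : IsTest U u) (h : u =ᶠ[𝓝 p] 0) : IsTest (U \ {p}) u :=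
  hu.restrict fun x hx => by
    by_cases hxp : x = p
    · exact hxp ▸ h
    · exact notMem_tsupport_iff_eventuallyEq.1 fun hx' => hx ⟨hu.3 hx', hxp⟩

theorem continuous (hu : IsTest U u) : Continuous u := hu.1.continuous

end IsTest

theorem integrable_mul_of_tsupport_subset {X : Type*} [TopologicalSpace X] [T2Space X]
    [MeasurableSpace X] [BorelSpace X] {μ : Measure X} {U : Set X} {f u : X → ℝ}
    (hf : LocallyIntegrableOn f U μ) (hu : Continuous u) (hc : HasCompactSupport u)
    (hs : tsupport u ⊆ U) : Integrable (fun x => f x * u x) μ := by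
  have h1 : IntegrableOn f (tsupport u) μ := hf.integrableOn_compact_subset hs hc
  have h2 : IntegrableOn (fun x => f x * u x) (tsupport u) μ :=
    h1.mul_continuousOn hu.continuousOn hc
  refine (integrableOn_iff_integrable_of_support_subset ?_).1 h2
  exact (Function.support_mul_subset_right f u).trans (subset_tsupport u)

variable [MeasurableSpace E] [BorelSpace E] {μ : Measure E}

theorem IsTest.integrable_mul {U : Set E} {f u : E → ℝ}
    (hf : LocallyIntegrableOn f U μ) (hu : IsTest U u) : Integrable (fun x => f x * u x) μ :=
  integrable_mul_of_tsupport_subset hf hu.continuous hu.2 hu.3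

/-- Integration by parts against a test function. -/
theorem IsTest.integral_mul_dd [FiniteDimensional ℝ E] [μ.IsAddHaarMeasure] {U : Set E}
    (hU : IsOpen U) {f u : E → ℝ}
    (hf : ContDiffOn ℝ ∞ f U) (hu : IsTest U u) (v : E) :
    ∫ x, f x * Crystal.dd v u x ∂μ = -∫ x, Crystal.dd v f x * u x ∂μ := by
  have hl : ∀ {g : E → ℝ}, ContDiffOn ℝ ∞ g U → LocallyIntegrableOn g U μ := fun hg =>
    hg.continuousOn.locallyIntegrableOn hU.measurableSet
  exact integral_mul_fderiv_eq_neg_fderiv_mul_of_integrable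
    (hu.integrable_mul (hl (dd_smoothOn hU hf v))) ((hu.dd v).integrable_mul (hl hf))
    (hu.integrable_mul (hl hf))
    (fun x hx => (hf.contDiffAt (hU.mem_nhds (hu.3 hx))).differentiableAt (by simp))
    (fun x _ => hu.1.differentiable (by simp) x)

end Calculus

/-! ### Functionals supported on a countable set -/

section Removability

variable {E : Type*} [NormedAddCommGroup E] [NormedSpace ℝ E]

/-- `T` vanishes on all test functions with support in `V`. -/
def Vanishes (T : (E → ℝ) → ℝ) (V : Set E) : Prop := ∀ u, IsTest V u → T u = 0

/-- `T` is linear on test functions with support in `U`. -/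
structure IsLin (U : Set E) (T : (E → ℝ) → ℝ) : Prop where
  add : ∀ {u w}, IsTest U u → IsTest U w → T (u + w) = T u + T w
  smul : ∀ (c : ℝ) {u}, IsTest U u → T (fun x => c * u x) = c * T u

theorem IsLin.sub {U : Set E} {T : (E → ℝ) → ℝ} (hT : IsLin U T) {u w : E → ℝ}
    (hu : IsTest U u) (hw : IsTest U w) : T (fun x => u x - w x) = T u - T w := by
  have h := hT.add hu (hw.const_mul (-1))
  rw [hT.smul (-1) hw] at h
  rw [show (fun x => u x - w x) = u + fun x => -1 * w x by ext x; simp [sub_eq_add_neg], h]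
  ring

theorem IsTest.sub {U : Set E} {u w : E → ℝ} (hu : IsTest U u) (hw : IsTest U w) :
    IsTest U (fun x => u x - w x) := by
  rw [show (fun x => u x - w x) = u + fun x => -1 * w x by ext x; simp [sub_eq_add_neg]]
  exact hu.add (hw.const_mul (-1))

theorem IsLin.mono {U V : Set E} {T : (E → ℝ) → ℝ} (hT : IsLin U T) (h : V ⊆ U) : IsLin V T :=
  ⟨fun hu hw => hT.add (hu.mono h) (hw.mono h), fun c _ hu => hT.smul c (hu.mono h)⟩

variable [FiniteDimensional ℝ E]

/-- A linear functional that vanishes locally vanishes. -/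
theorem IsLin.vanishes_of_locally {V : Set E} {T : (E → ℝ) → ℝ} (hT : IsLin V T)
    (h : ∀ x ∈ V, ∃ W, IsOpen W ∧ x ∈ W ∧ Vanishes T W) : Vanishes T V := by
  intro u hu
  have key : ∃ W, IsOpen W ∧ tsupport u ⊆ W ∧ Vanishes T (W ∩ V) := by
    refine hu.2.isCompact.induction_on
      (p := fun s => ∃ W, IsOpen W ∧ s ⊆ W ∧ Vanishes T (W ∩ V)) ?_ ?_ ?_ ?_
    · refine ⟨∅, isOpen_empty, subset_rfl, fun w hw => ?_⟩
      have h0 : w = 0 := by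
        have : tsupport w ⊆ ∅ := hw.3.trans (by simp)
        exact tsupport_eq_empty_iff.1 (Set.subset_empty_iff.1 this)
      have h1 := hT.smul 0 (hw.mono Set.inter_subset_right)
      subst h0
      rw [zero_mul] at h1
      rw [← h1]
      congr 1
      ext x
      simp
    · rintro s t hst ⟨W, hW, htW, hv⟩
      exact ⟨W, hW, hst.trans htW, hv⟩
    · rintro s t ⟨W₁, hW₁, hs, hv₁⟩ ⟨W₂, hW₂, ht, hv₂⟩
      refine ⟨W₁ ∪ W₂, hW₁.union hW₂, Set.union_subset_union hs ht, fun w hw => ?_⟩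
      have hd : Disjoint W₁ᶜ (tsupport w \ W₂) := by
        rw [Set.disjoint_left]
        rintro x hx ⟨hx1, hx2⟩
        rcases (hw.3 hx1).1 with h' | h'
        · exact hx h'
        · exact hx2 h'
      -- `ζ` vanishes near the complement of `W₁` and is `1` near the part of the support of `w`
      -- outside `W₂`. Hence `w ζ` is supported in `W₁` and `w (1 - ζ)` in `W₂`.
      obtain ⟨ζ, h0, h1, -⟩ := exists_contMDiffMap_zero_one_nhds_of_isClosed (n := ⊤)
        (modelWithCornersSelf ℝ E) hW₁.isClosed_compl
        ((isClosed_tsupport w).sdiff hW₂) hd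
      have hζ : ContDiff ℝ ∞ ζ := ζ.contMDiff.contDiff
      have hζ' : ContDiff ℝ ∞ (fun x => 1 - ζ x) := contDiff_const.sub hζ
      rw [eventually_nhdsSet_iff_forall] at h0 h1
      have hw1 : IsTest (W₁ ∩ V) (fun x => w x * ζ x) := by
        refine (hw.mul_right hζ).restrict fun x hx => ?_
        by_cases hx1 : x ∈ W₁
        · have hxw : x ∉ tsupport w := fun h' => hx ⟨hx1, (hw.3 h').2⟩
          filter_upwards [notMem_tsupport_iff_eventuallyEq.1 hxw] with y hy
          simp [hy]
        · filter_upwards [h0 x hx1] with y hy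
          simp [hy]
      have hw2 : IsTest (W₂ ∩ V) (fun x => w x * (1 - ζ x)) := by
        refine (hw.mul_right hζ').restrict fun x hx => ?_
        by_cases hxw : x ∈ tsupport w
        · have hx2 : x ∉ W₂ := fun h' => hx ⟨h', (hw.3 hxw).2⟩
          filter_upwards [h1 x ⟨hxw, hx2⟩] with y hy
          simp [hy]
        · filter_upwards [notMem_tsupport_iff_eventuallyEq.1 hxw] with y hy
          simp [hy]
      have := hT.add (hw1.mono Set.inter_subset_right) (hw2.mono Set.inter_subset_right)
      rw [hv₁ _ hw1, hv₂ _ hw2] at this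
      rw [show w = (fun x => w x * ζ x) + fun x => w x * (1 - ζ x) by ext x; simp; ring, this]
      simp
    · intro x hx
      obtain ⟨W, hW, hxW, hv⟩ := h x (hu.3 hx)
      exact ⟨W, mem_nhdsWithin_of_mem_nhds (hW.mem_nhds hxW), W, hW, subset_rfl,
        fun w hw => hv w (hw.mono Set.inter_subset_left)⟩
  obtain ⟨W, -, hW, hv⟩ := key
  exact hv u ⟨hu.1, hu.2, Set.subset_inter hW hu.3⟩

/-- A nonempty countable locally closed set has an isolated point. -/
theorem exists_isolated_of_countable {C : Set E} (hC : IsLocallyClosed C) (hc : C.Countable)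
    (hne : C.Nonempty) : ∃ p ∈ C, ∃ R > 0, ∀ x ∈ C, dist x p < R → x = p := by
  have := hC.locallyCompactSpace
  have := hc.to_subtype
  have := hne.to_subtype
  -- Baire: `C` is locally compact and a countable union of closed singletons, so one singleton is
  -- open in `C`.
  obtain ⟨p, hp⟩ := nonempty_interior_of_iUnion_of_closed (X := C) (f := fun p : C => {p})
    (fun p => isClosed_singleton) (by ext; simp)
  obtain ⟨q, hq⟩ := hp
  have hqp : q = p := by simpa using interior_subset hq
  subst hqp
  obtain ⟨R, hR, hball⟩ := Metric.isOpen_iff.1 isOpen_interior q hq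
  refine ⟨q, q.2, R, hR, fun x hx hd => ?_⟩
  have : (⟨x, hx⟩ : C) ∈ ({q} : Set C) := interior_subset (hball hd)
  exact congrArg Subtype.val this

/-- A family of linear functionals that vanishes off a countable relatively closed set `S`, and
for which isolated points of the support can be removed, vanishes. -/
theorem vanishes_of_removable {κ : Type*} {U S : Set E} (hU : IsOpen U) (hS : S.Countable)
    (hUS : IsOpen (U \ S)) {T : κ → (E → ℝ) → ℝ} (hT : ∀ i, IsLin U (T i))
    (h0 : ∀ i, Vanishes (T i) (U \ S))
    (hrem : ∀ p ∈ S, ∀ R > 0, Metric.ball p R ⊆ U →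
      (∀ i, Vanishes (T i) (Metric.ball p R \ {p})) → ∀ i, Vanishes (T i) (Metric.ball p R)) :
    ∀ i, Vanishes (T i) U := by
  -- The complement of the common support of the family. The support is taken in common because
  -- removing a point may combine information on several members.
  set G : Set E := {x | ∃ W, IsOpen W ∧ x ∈ W ∧ ∀ i, Vanishes (T i) W} with hG
  have hGo : IsOpen G := by
    rw [isOpen_iff_forall_mem_open]
    rintro x ⟨W, hW, hx, hv⟩
    exact ⟨W, fun y hy => ⟨W, hW, hy, hv⟩, hW, hx⟩
  suffices hC : U ⊆ G by
    intro i
    refine (hT i).vanishes_of_locally fun x hx => ?_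
    obtain ⟨W, hW, hxW, hv⟩ := hC hx
    exact ⟨W, hW, hxW, hv i⟩
  by_contra hne
  rw [Set.not_subset_iff_exists_mem_notMem] at hne
  obtain ⟨x, hxU, hxG⟩ := hne
  have hCS : U \ G ⊆ S := by
    rintro y ⟨hyU, hyG⟩
    by_contra hyS
    exact hyG ⟨U \ S, hUS, ⟨hyU, hyS⟩, h0⟩
  -- `p` is isolated in the common support, not in `S`: other points of `S` may still accumulate at
  -- it.
  obtain ⟨p, hp, R, hR, hiso⟩ := exists_isolated_of_countable
    (hU.isLocallyClosed.inter hGo.isClosed_compl.isLocallyClosed) (hS.mono hCS) ⟨x, hxU, hxG⟩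
  obtain ⟨R', hR', hball⟩ := Metric.isOpen_iff.1 hU p hp.1
  have hsub : Metric.ball p (min R R') ⊆ U :=
    (Metric.ball_subset_ball (min_le_right _ _)).trans hball
  refine hp.2 ⟨Metric.ball p (min R R'), Metric.isOpen_ball,
    Metric.mem_ball_self (lt_min hR hR'),
    hrem p (hCS hp) _ (lt_min hR hR') hsub fun i => ?_⟩
  refine ((hT i).mono (Set.sdiff_subset.trans hsub)).vanishes_of_locally fun y hy => ?_
  have hyG : y ∈ G := by
    by_contra hyG
    exact hy.2 (hiso y ⟨hsub hy.1, hyG⟩ (lt_of_lt_of_le hy.1 (min_le_left _ _)))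
  obtain ⟨W, hW, hyW, hv⟩ := hyG
  exact ⟨W, hW, hyW, hv i⟩

end Removability

/-! ### Functionals without second-order part at a point -/

section Tame

set_option linter.unusedSectionVars false

variable {E : Type*} [NormedAddCommGroup E] [NormedSpace ℝ E]

/-- A sequence of test functions that is bounded in `C²`, vanishes to first order at `p`, and
vanishes eventually near every other point. -/
structure Concentrates (U K : Set E) (p : E) (v : ℕ → E → ℝ) : Prop where
  test : ∀ n, IsTest U (v n)
  support : ∀ n, tsupport (v n) ⊆ K
  bound : ∃ C, ∀ n x, |v n x| ≤ C
  bound_dd : ∀ a, ∃ C, ∀ n x, |dd a (v n) x| ≤ C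
  bound_dd_dd : ∀ a b, ∃ C, ∀ n x, |dd a (dd b (v n)) x| ≤ C
  value : ∀ n, v n p = 0
  value_dd : ∀ n a, dd a (v n) p = 0
  eventually : ∀ x, x ≠ p → ∀ᶠ n in atTop, v n =ᶠ[𝓝 x] 0

/-- A linear functional on test functions that is small on concentrating sequences. Distributions
of order less than two, and second derivatives of locally integrable functions, are of this
kind. -/
structure IsTame (U : Set E) (T : (E → ℝ) → ℝ) : Prop extends IsLin U T where
  small : ∀ {p : E} {K : Set E} {v : ℕ → E → ℝ}, IsCompact K → K ⊆ U → Concentrates U K p v →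
    Tendsto (fun n => T (v n)) atTop (𝓝 0)

theorem IsTame.fun_add {U : Set E} {T T' : (E → ℝ) → ℝ} (hT : IsTame U T) (hT' : IsTame U T') :
    IsTame U (fun u => T u + T' u) where
  add hu hw := by rw [hT.add hu hw, hT'.add hu hw]; ring
  smul c _ hu := by rw [hT.smul c hu, hT'.smul c hu]; ring
  small hK hKU hv := by simpa using (hT.small hK hKU hv).add (hT'.small hK hKU hv)

theorem IsTame.const_mul {U : Set E} {T : (E → ℝ) → ℝ} (hT : IsTame U T) (c : ℝ) :
    IsTame U (fun u => c * T u) where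
  add hu hw := by rw [hT.add hu hw]; ring
  smul d _ hu := by rw [hT.smul d hu]; ring
  small hK hKU hv := by simpa using (hT.small hK hKU hv).const_mul c

theorem IsTame.fun_sub {U : Set E} {T T' : (E → ℝ) → ℝ} (hT : IsTame U T) (hT' : IsTame U T') :
    IsTame U (fun u => T u - T' u) := by
  simpa [sub_eq_add_neg] using hT.fun_add (hT'.const_mul (-1))

theorem Concentrates.tendsto_dd_dd {U K : Set E} {p : E} {v : ℕ → E → ℝ}
    (h : Concentrates U K p v) (a b : E) {x : E} (hx : x ≠ p) :
    Tendsto (fun n => dd a (dd b (v n)) x) atTop (𝓝 0) := by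
  refine tendsto_const_nhds.congr' ?_
  filter_upwards [h.eventually x hx] with n hn
  rw [dd_congr (dd_eventuallyEq hn b), show dd b (0 : E → ℝ) = 0 by ext; simp [dd]]
  simp [dd]

theorem Concentrates.tendsto_dd {U K : Set E} {p : E} {v : ℕ → E → ℝ}
    (h : Concentrates U K p v) (a : E) (x : E) :
    Tendsto (fun n => dd a (v n) x) atTop (𝓝 0) := by
  by_cases hx : x = p
  · simp [hx, h.value_dd]
  refine tendsto_const_nhds.congr' ?_
  filter_upwards [h.eventually x hx] with n hn
  rw [dd_congr hn]
  simp [dd]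

theorem Concentrates.tendsto {U K : Set E} {p : E} {v : ℕ → E → ℝ}
    (h : Concentrates U K p v) (x : E) :
    Tendsto (fun n => v n x) atTop (𝓝 0) := by
  by_cases hx : x = p
  · simp [hx, h.value]
  refine tendsto_const_nhds.congr' ?_
  filter_upwards [h.eventually x hx] with n hn
  rw [hn.eq_of_nhds]
  rfl

/-- Second derivatives of locally integrable functions are tame. -/
theorem isTame_integral [MeasurableSpace E] [BorelSpace E] [FiniteDimensional ℝ E] {μ : Measure E}
    [NullSingletonClass μ] {U : Set E} {f : E → ℝ} (hf : LocallyIntegrableOn f U μ) (a b : E) :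
    IsTame U (fun u => ∫ x, f x * dd a (dd b u) x ∂μ) where
  add {u w} hu hw := by
    rw [← integral_add (((hu.dd b).dd a).integrable_mul hf) (((hw.dd b).dd a).integrable_mul hf)]
    congr 1
    ext x
    rw [dd_add hu.1 hw.1, dd_add (dd_smooth hu.1 b) (dd_smooth hw.1 b)]
    simp [mul_add]
  smul c u hu := by
    rw [← integral_const_mul]
    congr 1
    ext x
    rw [dd_const_mul c hu.1, dd_const_mul c (dd_smooth hu.1 b)]
    ring
  small {p K v} hK hKU hv := by
    obtain ⟨C, hC⟩ := hv.bound_dd_dd a b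
    have hfK : IntegrableOn f K μ := hf.integrableOn_compact_subset hKU hK
    have hrest : ∀ n, ∫ x, f x * dd a (dd b (v n)) x ∂μ =
        ∫ x in K, f x * dd a (dd b (v n)) x ∂μ := by
      intro n
      symm
      apply setIntegral_eq_integral_of_forall_compl_eq_zero
      intro x hx
      have : x ∉ tsupport (dd a (dd b (v n))) := fun h' =>
        hx (hv.support n (tsupport_dd_subset b _ (tsupport_dd_subset a _ h')))
      rw [image_eq_zero_of_notMem_tsupport this, mul_zero]
    simp_rw [hrest]
    rw [show (0 : ℝ) = ∫ x in K, (0 : ℝ) ∂μ by simp]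
    -- The second derivatives are bounded uniformly in `n` and tend to zero except possibly at `p`,
    -- which is a null set. This is where it matters that the distribution is a second derivative of
    -- a function and not of a measure.
    refine tendsto_integral_of_dominated_convergence (fun x => |f x| * C) ?_
      (hfK.abs.mul_const C) ?_ ?_
    · intro n
      exact hfK.aestronglyMeasurable.mul
        (((hv.test n).dd b).dd a).continuous.aestronglyMeasurable
    · intro n
      refine Eventually.of_forall fun x => ?_
      rw [Real.norm_eq_abs, abs_mul]
      exact mul_le_mul_of_nonneg_left (hC n x) (abs_nonneg _)
    · have : ∀ᵐ x ∂(μ.restrict K), x ≠ p := by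
        refine ae_restrict_of_ae ?_
        rw [ae_iff]
        simp
      filter_upwards [this] with x hx
      simpa using (hv.tendsto_dd_dd a b hx).const_mul (f x)

/-- The family of point masses `m` at `pos` is locally summable in `U`. -/
def LocSummable {N : Type*} (U : Set E) (pos : N → E) (m : N → ℝ) : Prop :=
  ∀ K ⊆ U, IsCompact K → Summable fun n => K.indicator (fun _ => |m n|) (pos n)

/-- The functional `v ↦ ∑ m v(pos)`. -/
def pointSum {N : Type*} (pos : N → E) (m : N → ℝ) (v : E → ℝ) : ℝ := ∑' n, m n * v (pos n)

/-! ### Sums of point masses -/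

section PointSum

variable {N : Type*} {U : Set E} {pos : N → E} {m : N → ℝ}

theorem norm_mul_le_indicator {K : Set E} {v : E → ℝ} {C : ℝ} (hv : ∀ x, |v x| ≤ C)
    (hK : tsupport v ⊆ K) (n : N) :
    ‖m n * v (pos n)‖ ≤ K.indicator (fun _ => |m n|) (pos n) * C := by
  rw [Real.norm_eq_abs, abs_mul]
  by_cases h : pos n ∈ K
  · rw [Set.indicator_of_mem h]
    exact mul_le_mul_of_nonneg_left (hv _) (abs_nonneg _)
  · rw [Set.indicator_of_notMem h, image_eq_zero_of_notMem_tsupport fun h' => h (hK h')]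
    simp

theorem LocSummable.summable (hm : LocSummable U pos m) {v : E → ℝ} (hv : Continuous v)
    (hc : HasCompactSupport v) (hs : tsupport v ⊆ U) : Summable fun n => m n * v (pos n) := by
  obtain ⟨C, hC⟩ := hv.bounded_above_of_compact_support hc
  exact Summable.of_norm_bounded ((hm _ hs hc).mul_right C)
    (norm_mul_le_indicator (by simpa using hC) subset_rfl)

theorem LocSummable.summable_test (hm : LocSummable U pos m) {v : E → ℝ} (hv : IsTest U v) :
    Summable fun n => m n * v (pos n) :=
  hm.summable hv.continuous hv.2 hv.3

/-- Dominated convergence for series: the masses in `K` are summable and `C` bounds the functions.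
Convergence is needed only at the positions. -/
theorem LocSummable.tendsto_pointSum (hm : LocSummable U pos m) {K : Set E} (hK : IsCompact K)
    (hKU : K ⊆ U) {v : ℕ → E → ℝ} (hs : ∀ n, tsupport (v n) ⊆ K) {C : ℝ}
    (hC : ∀ n x, |v n x| ≤ C) {w : E → ℝ}
    (ht : ∀ x ∈ Set.range pos, Tendsto (fun n => v n x) atTop (𝓝 (w x))) :
    Tendsto (fun n => pointSum pos m (v n)) atTop (𝓝 (pointSum pos m w)) :=
  tendsto_tsum_of_dominated_convergence ((hm K hKU hK).mul_right C)
    (fun k => (ht (pos k) ⟨k, rfl⟩).const_mul (m k))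
    (Eventually.of_forall fun n k => norm_mul_le_indicator (hC n) (hs n) k)

theorem pointSum_add (hm : LocSummable U pos m) {v w : E → ℝ} (hv : IsTest U v)
    (hw : IsTest U w) : pointSum pos m (v + w) = pointSum pos m v + pointSum pos m w := by
  unfold pointSum
  rw [← (hm.summable_test hv).tsum_add (hm.summable_test hw)]
  simp [mul_add]

theorem pointSum_const_mul (c : ℝ) (v : E → ℝ) :
    pointSum pos m (fun x => c * v x) = c * pointSum pos m v := by
  unfold pointSum
  rw [← tsum_mul_left]
  congr 1
  ext n
  ring

@[simp]
theorem pointSum_zero : pointSum pos m (0 : E → ℝ) = 0 := by simp [pointSum]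

theorem isTame_pointSum (hm : LocSummable U pos m) : IsTame U (pointSum pos m) where
  add hu hw := pointSum_add hm hu hw
  smul c _ _ := pointSum_const_mul c _
  small hK hKU hv := by
    obtain ⟨C, hC⟩ := hv.bound
    simpa using hm.tendsto_pointSum hK hKU hv.support hC (w := 0) (fun x _ => hv.tendsto x)

/-- A mass may sit at `p` itself; this is why concentrating sequences are required to have zero
gradient at `p`. -/
theorem isTame_pointSum_dd (hm : LocSummable U pos m) {g : E → ℝ} (hg : ContDiff ℝ ∞ g) (a : E) :
    IsTame U (fun u => pointSum pos m (fun x => g x * dd a u x)) where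
  add {u w} hu hw := by
    rw [← pointSum_add hm ((hu.dd a).mul_left hg) ((hw.dd a).mul_left hg), dd_add hu.1 hw.1]
    congr 1
    ext x
    simp [mul_add]
  smul c u hu := by
    rw [← pointSum_const_mul, dd_const_mul c hu.1]
    congr 1
    ext x
    ring
  small {p K v} hK hKU hv := by
    obtain ⟨C, hC⟩ := hv.bound_dd a
    obtain ⟨D, hD⟩ := hK.exists_bound_of_continuousOn hg.continuous.continuousOn
    have hsupp : ∀ n, tsupport (fun x => g x * dd a (v n) x) ⊆ K := fun n =>
      tsupport_mul_subset_right.trans ((tsupport_dd_subset a _).trans (hv.support n))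
    have hC0 : 0 ≤ C := (abs_nonneg _).trans (hC 0 p)
    have hb : ∀ n x, |g x * dd a (v n) x| ≤ |D| * C := by
      intro n x
      by_cases hx : x ∈ K
      · rw [abs_mul]
        exact mul_le_mul (((hD x hx)).trans (le_abs_self D)) (hC n x) (abs_nonneg _) (abs_nonneg _)
      · have : (fun x => g x * dd a (v n) x) x = 0 :=
          image_eq_zero_of_notMem_tsupport (f := fun x => g x * dd a (v n) x)
            fun h' => hx (hsupp n h')
        simp only at this
        rw [this, abs_zero]
        positivity
    have h := hm.tendsto_pointSum hK hKU hsupp hb (w := 0)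
      (fun x _ => by simpa using (hv.tendsto_dd a x).const_mul (g x))
    simpa using h

end PointSum

theorem dd_comp_smul_sub {f : E → ℝ} (hf : ContDiff ℝ ∞ f) (c : ℝ) (p a : E) :
    dd a (fun x => f (c • (x - p))) = fun x => c * dd a f (c • (x - p)) := by
  ext x
  have h1 : HasFDerivAt (fun x : E => c • (x - p)) (c • ContinuousLinearMap.id ℝ E) x :=
    ((hasFDerivAt_id x).sub_const p).const_smul c
  have h2 := ((hf.differentiable (by simp) (c • (x - p))).hasFDerivAt).comp x h1
  have h3 : fderiv ℝ (fun x => f (c • (x - p))) x = _ := h2.fderiv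
  simp only [dd]
  rw [h3]
  simp

/-- Differentiating a cutoff at scale `1 / c` a number `k` of times costs `c ^ k`. On its support `c
‖x - p‖ ≤ r`, so a factor vanishing to order `k` at `p` absorbs this cost and the bound is
independent of `c`. -/
theorem abs_mul_rescaled_le {f g : E → ℝ} {p : E} {k : ℕ} {A B r c : ℝ} (hr : 0 ≤ r) (hc : 0 ≤ c)
    (hf : ∀ x, |f x| ≤ A * ‖x - p‖ ^ k) (hA : 0 ≤ A) (hg : ∀ x, |g x| ≤ B)
    (hs : tsupport g ⊆ Metric.closedBall 0 r) (x : E) :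
    |f x * (c ^ k * g (c • (x - p)))| ≤ A * r ^ k * B := by
  have hB : 0 ≤ B := (abs_nonneg _).trans (hg 0)
  by_cases hx : c • (x - p) ∈ tsupport g
  · have h1 : c * ‖x - p‖ ≤ r := by
      have := hs hx
      rwa [mem_closedBall_zero_iff, norm_smul, Real.norm_eq_abs, abs_of_nonneg hc] at this
    calc |f x * (c ^ k * g (c • (x - p)))| = |f x| * c ^ k * |g (c • (x - p))| := by
          rw [abs_mul, abs_mul, abs_of_nonneg (pow_nonneg hc k)]; ring
      _ ≤ (A * ‖x - p‖ ^ k) * c ^ k * B := by gcongr <;> [exact hf x; exact hg _]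
      _ = A * (c * ‖x - p‖) ^ k * B := by ring
      _ ≤ _ := by gcongr
  · rw [image_eq_zero_of_notMem_tsupport hx]
    simp
    positivity

/-- Test functions with vanishing 1-jet at `p` grow quadratically at `p`. -/
theorem IsTest.exists_taylor_bound {U : Set E} {u : E → ℝ} (hu : IsTest U u) {p : E}
    (h0 : u p = 0) (h1 : fderiv ℝ u p = 0) :
    ∃ A : ℝ, 0 ≤ A ∧ (∀ x, |u x| ≤ A * ‖x - p‖ ^ 2) ∧
      ∀ a x, |Crystal.dd a u x| ≤ A * ‖a‖ * ‖x - p‖ ^ 1 := by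
  obtain ⟨A, hA⟩ := ((hu.1.fderiv_right (m := 1) (by norm_cast))).lipschitzWith_of_hasCompactSupport
    (hu.2.fderiv ℝ) (by simp)
  have hA' : ∀ x, ‖fderiv ℝ u x‖ ≤ A * ‖x - p‖ := by
    intro x
    have := hA.dist_le_mul x p
    rwa [h1, dist_zero_right, dist_eq_norm] at this
  refine ⟨A, A.2, fun x => ?_, fun a x => ?_⟩
  -- Mean value inequality on the ball of radius `‖x - p‖`, where the gradient is at most `A ‖x -
  -- p‖`.
  · have hcv : Convex ℝ (Metric.closedBall p ‖x - p‖) := convex_closedBall _ _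
    have := hcv.norm_image_sub_le_of_norm_fderiv_le (𝕜 := ℝ) (f := u) (C := A * ‖x - p‖)
      (x := p) (y := x)
      (fun y _ => hu.1.differentiable (by simp) y)
      (fun y hy => (hA' y).trans (by
        have : ‖y - p‖ ≤ ‖x - p‖ := by simpa [dist_eq_norm] using hy
        gcongr)) (by simp) (by simp [dist_eq_norm])
    rw [h0, sub_zero, Real.norm_eq_abs] at this
    linarith [this, sq ‖x - p‖, mul_assoc (A : ℝ) ‖x - p‖ ‖x - p‖]
  · calc |Crystal.dd a u x| ≤ ‖fderiv ℝ u x‖ * ‖a‖ := (fderiv ℝ u x).le_opNorm a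
      _ ≤ (A * ‖x - p‖) * ‖a‖ := by gcongr; exact hA' x
      _ = _ := by ring

theorem IsTest.exists_bound {U : Set E} {u : E → ℝ} (hu : IsTest U u) : ∃ C, ∀ x, |u x| ≤ C := by
  obtain ⟨C, hC⟩ := hu.continuous.bounded_above_of_compact_support hu.2
  exact ⟨C, by simpa using hC⟩

theorem IsTame.mono {U V : Set E} {T : (E → ℝ) → ℝ} (hT : IsTame U T) (h : V ⊆ U) : IsTame V T where
  toIsLin := hT.toIsLin.mono h
  small hK hKV hv := hT.small hK (hKV.trans h)
    ⟨fun n => (hv.test n).mono h, hv.2, hv.3, hv.4, hv.5, hv.6, hv.7, hv.8⟩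

/-- A functional supported at `p` depends only on the germ at `p`. -/
theorem IsLin.congr_germ {B : Set E} {T : (E → ℝ) → ℝ} (hT : IsLin B T) {p : E}
    (hv : Vanishes T (B \ {p})) {u w : E → ℝ} (hu : IsTest B u) (hw : IsTest B w)
    (h : u =ᶠ[𝓝 p] w) : T u = T w := by
  have h' := hv _ ((hu.sub hw).diff_singleton (p := p) (by
    filter_upwards [h] with x hx
    simp [hx]))
  rw [hT.sub hu hw] at h'
  linarith

variable [FiniteDimensional ℝ E]

/-- Cutting off a test function with vanishing 1-jet at `p` near `p` gives a concentrating
sequence. -/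
theorem exists_concentrates {U : Set E} {u : E → ℝ} (hu : IsTest U u) {p : E}
    (h0 : u p = 0) (h1 : fderiv ℝ u p = 0) :
    ∃ v, Concentrates U (tsupport u) p v ∧ ∀ n, v n =ᶠ[𝓝 p] u := by
  obtain ⟨A, hA0, hA, hA1⟩ := hu.exists_taylor_bound h0 h1
  let β : ContDiffBump (0 : E) := ⟨1, 2, one_pos, one_lt_two⟩
  have hβ : IsTest Set.univ (β : E → ℝ) := ⟨β.contDiff, β.hasCompactSupport, Set.subset_univ _⟩
  have hβs : tsupport (β : E → ℝ) ⊆ Metric.closedBall 0 2 := by rw [β.tsupport_eq]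
  let c : ℕ → ℝ := fun n => n + 1
  have hc : ∀ n, 0 < c n := fun n => by positivity
  -- The concentrating sequence is `u * w n`, with `w n` equal to `1` near `p` and supported within
  -- distance `2 / c n` of `p`.
  let w : ℕ → E → ℝ := fun n x => β (c n • (x - p))
  have hw : ∀ n, ContDiff ℝ ∞ (w n) := fun n =>
    β.contDiff.comp ((contDiff_id.sub contDiff_const).const_smul (c n))
  have hwd : ∀ n a, dd a (w n) = fun x => c n * dd a β (c n • (x - p)) := fun n a =>
    dd_comp_smul_sub β.contDiff (c n) p a
  have hwdd : ∀ n a b, dd a (dd b (w n)) = fun x => c n ^ 2 * dd a (dd b β) (c n • (x - p)) := by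
    intro n a b
    have hs : ContDiff ℝ ∞ (fun x => dd b (β : E → ℝ) (c n • (x - p))) :=
      (dd_smooth β.contDiff b).comp ((contDiff_id.sub contDiff_const).const_smul (c n))
    rw [hwd, dd_const_mul _ hs, dd_comp_smul_sub (dd_smooth β.contDiff b)]
    ext x
    ring
  have hd : ∀ n b, dd b (fun x => u x * w n x) = fun x => u x * dd b (w n) x + dd b u x * w n x :=
    fun n b => dd_mul hu.1 (hw n) b
  have hd2 : ∀ n a b, dd a (dd b (fun x => u x * w n x)) = fun x =>
      (u x * dd a (dd b (w n)) x + dd a u x * dd b (w n) x) +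
        (dd b u x * dd a (w n) x + dd a (dd b u) x * w n x) := by
    intro n a b
    rw [hd, show (fun x => u x * dd b (w n) x + dd b u x * w n x) =
      (fun x => u x * dd b (w n) x) + (fun x => dd b u x * w n x) from rfl,
      dd_add (hu.1.mul (dd_smooth (hw n) b)) ((dd_smooth hu.1 b).mul (hw n)),
      dd_mul hu.1 (dd_smooth (hw n) b), dd_mul (dd_smooth hu.1 b) (hw n)]
    rfl
  have hβ1 : ∀ x, |(β : E → ℝ) x| ≤ 1 := fun x => by
    rw [abs_of_nonneg β.nonneg]; exact β.le_one
  have hβds : ∀ a, tsupport (dd a β) ⊆ Metric.closedBall (0 : E) 2 := fun a =>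
    (tsupport_dd_subset a _).trans hβs
  have hone : ∀ f : E → ℝ, ∀ C, (∀ x, |f x| ≤ C) → ∀ n x, |f x * w n x| ≤ C := by
    intro f C hf n x
    rw [abs_mul]
    calc |f x| * |w n x| ≤ C * 1 :=
          mul_le_mul (hf x) (hβ1 _) (abs_nonneg _) ((abs_nonneg _).trans (hf x))
      _ = C := mul_one C
  have hnear : ∀ n, w n =ᶠ[𝓝 p] 1 := by
    intro n
    have : Tendsto (fun x : E => c n • (x - p)) (𝓝 p) (𝓝 0) := by
      have h : Continuous fun x : E => c n • (x - p) := by fun_prop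
      simpa using h.tendsto p
    exact this.eventually β.eventuallyEq_one
  have hprod : ∀ n, (fun x => u x * w n x) =ᶠ[𝓝 p] u := fun n => by
    filter_upwards [hnear n] with x hx
    simp [hx]
  have hdp : ∀ a, dd a u p = 0 := fun a => by simp [dd, h1]
  refine ⟨fun n x => u x * w n x, ⟨fun n => hu.mul_right (hw n),
    fun n => tsupport_mul_subset_left, ?_, ?_, ?_, ?_, ?_, ?_⟩, hprod⟩
  · obtain ⟨C, hC⟩ := hu.exists_bound
    exact ⟨C, hone u C hC⟩
  · intro a
    obtain ⟨B, hB⟩ := (hβ.dd a).exists_bound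
    obtain ⟨C, hC⟩ := (hu.dd a).exists_bound
    obtain ⟨D, hD⟩ := hu.exists_bound
    obtain ⟨L, hL⟩ := hu.2.isCompact.isBounded.subset_closedBall p
    -- One derivative on `w n` costs a single factor `c n`, so a linear bound on `u` is wanted. It
    -- follows from the quadratic one because the support of `u` is bounded.
    have hu1 : ∀ x, |u x| ≤ A * |L| * ‖x - p‖ ^ 1 := by
      intro x
      by_cases hx : x ∈ tsupport u
      · have h2 : ‖x - p‖ ≤ |L| := by
          have := hL hx
          rw [Metric.mem_closedBall, dist_eq_norm] at this
          exact this.trans (le_abs_self L)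
        calc |u x| ≤ A * ‖x - p‖ ^ 2 := hA x
          _ = A * ‖x - p‖ * ‖x - p‖ := by ring
          _ ≤ A * |L| * ‖x - p‖ := by gcongr
          _ = _ := by ring
      · rw [image_eq_zero_of_notMem_tsupport hx, abs_zero]
        positivity
    refine ⟨A * |L| * 2 ^ 1 * B + C, fun n x => ?_⟩
    rw [hd]
    refine (abs_add_le _ _).trans (add_le_add ?_ (hone _ C hC n x))
    rw [hwd]
    simpa using abs_mul_rescaled_le zero_le_two (hc n).le hu1 (by positivity) hB (hβds a) x
  · intro a b
    obtain ⟨B, hB⟩ := ((hβ.dd b).dd a).exists_bound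
    obtain ⟨Ba, hBa⟩ := (hβ.dd a).exists_bound
    obtain ⟨Bb, hBb⟩ := (hβ.dd b).exists_bound
    obtain ⟨C, hC⟩ := ((hu.dd b).dd a).exists_bound
    -- One constant for each of the four Leibniz terms; `2` is the outer radius of the bump, and its
    -- exponent counts the derivatives falling on `w n`.
    refine ⟨(A * 2 ^ 2 * B + A * ‖a‖ * 2 ^ 1 * Bb) + (A * ‖b‖ * 2 ^ 1 * Ba + C), fun n x => ?_⟩
    rw [hd2]
    refine (abs_add_le _ _).trans (add_le_add ((abs_add_le _ _).trans (add_le_add ?_ ?_))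
      ((abs_add_le _ _).trans (add_le_add ?_ (hone _ C hC n x))))
    · rw [hwdd]
      exact abs_mul_rescaled_le zero_le_two (hc n).le hA hA0 hB
        ((tsupport_dd_subset a _).trans (hβds b)) x
    · rw [hwd]
      simpa using abs_mul_rescaled_le zero_le_two (hc n).le (hA1 a) (by positivity) hBb (hβds b) x
    · rw [hwd]
      simpa using abs_mul_rescaled_le zero_le_two (hc n).le (hA1 b) (by positivity) hBa (hβds a) x
  · intro n
    simp [h0]
  · intro n a
    rw [dd_congr (hprod n), hdp]
  · intro x hx
    have hpos : 0 < ‖x - p‖ := norm_pos_iff.2 (sub_ne_zero.2 hx)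
    have hcn : Tendsto c atTop atTop := tendsto_atTop_add_const_right _ _ tendsto_natCast_atTop_atTop
    filter_upwards [(hcn.atTop_mul_const hpos).eventually (eventually_gt_atTop 2)] with n hn
    have hx' : c n • (x - p) ∉ tsupport (β : E → ℝ) := fun h' => by
      have := hβs h'
      rw [mem_closedBall_zero_iff, norm_smul, Real.norm_eq_abs, abs_of_pos (hc n)] at this
      linarith
    have hcont : Tendsto (fun y : E => c n • (y - p)) (𝓝 x) (𝓝 (c n • (x - p))) := by
      have h : Continuous fun x : E => c n • (x - p) := by fun_prop
      exact h.tendsto x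
    filter_upwards [hcont.eventually (notMem_tsupport_iff_eventuallyEq.1 hx')] with y hy
    simp only [w]
    rw [hy]
    simp

/-- A tame functional supported at `p` vanishes on test functions with vanishing 1-jet at `p`. -/
theorem IsTame.eq_zero_of_jet {B : Set E} {T : (E → ℝ) → ℝ} (hT : IsTame B T) {p : E}
    (hv : Vanishes T (B \ {p})) {u : E → ℝ} (hu : IsTest B u) (h0 : u p = 0)
    (h1 : fderiv ℝ u p = 0) : T u = 0 := by
  obtain ⟨v, hc, he⟩ := exists_concentrates hu h0 h1
  -- `v n` and `u` have the same germ at `p`, off which `T` vanishes.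
  have hconst : ∀ n, T (v n) = T u := by
    intro n
    have h := hv _ (((hc.test n).sub hu).diff_singleton (p := p) (by
      filter_upwards [he n] with x hx
      simp [hx]))
    rw [hT.toIsLin.sub (hc.test n) hu] at h
    linarith
  have := hT.small hu.2 hu.3 hc
  simp_rw [hconst] at this
  exact tendsto_nhds_unique tendsto_const_nhds this

end Tame

/-! ### Planar functionals supported at a point and their moments -/

section PlaneJets

/-- The horizontal plane. -/
abbrev Plane := ℝ × ℝ

/-- The partial derivative `∂_x` in the plane. -/
abbrev dx : (Plane → ℝ) → Plane → ℝ := dd ((1, 0) : Plane)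

/-- The partial derivative `∂_y` in the plane. -/
abbrev dy : (Plane → ℝ) → Plane → ℝ := dd ((0, 1) : Plane)

theorem dd_fst_sub (v : Plane) (c : ℝ) : dd v (fun x : Plane => x.1 - c) = fun _ => v.1 := by
  ext x
  have h : HasFDerivAt (fun x : Plane => x.1 - c) (ContinuousLinearMap.fst ℝ ℝ ℝ) x :=
    hasFDerivAt_fst.sub_const c
  simp [dd, h.fderiv]

theorem dd_snd_sub (v : Plane) (c : ℝ) : dd v (fun x : Plane => x.2 - c) = fun _ => v.2 := by
  ext x
  have h : HasFDerivAt (fun x : Plane => x.2 - c) (ContinuousLinearMap.snd ℝ ℝ ℝ) x :=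
    hasFDerivAt_snd.sub_const c
  simp [dd, h.fderiv]

theorem contDiff_fst_sub (c : ℝ) : ContDiff ℝ ∞ (fun x : Plane => x.1 - c) :=
  contDiff_fst.sub contDiff_const

theorem contDiff_snd_sub (c : ℝ) : ContDiff ℝ ∞ (fun x : Plane => x.2 - c) :=
  contDiff_snd.sub contDiff_const

/-- A tame functional supported at `p` vanishes if it vanishes on affine functions. -/
theorem IsTame.vanishes_of_affine {B : Set Plane} {T : (Plane → ℝ) → ℝ} (hT : IsTame B T)
    {p : Plane} (hv : Vanishes T (B \ {p})) {ψ : Plane → ℝ} (hψ : IsTest B ψ)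
    (h1 : ψ =ᶠ[𝓝 p] 1) (hc : T ψ = 0) (hx : T (fun x => (x.1 - p.1) * ψ x) = 0)
    (hy : T (fun x => (x.2 - p.2) * ψ x) = 0) : Vanishes T B := by
  intro u hu
  set a := dx u p
  set b := dy u p
  have tc := hψ.const_mul (u p)
  have tx := (hψ.mul_left (contDiff_fst_sub p.1)).const_mul a
  have ty := (hψ.mul_left (contDiff_snd_sub p.2)).const_mul b
  have hq := (tc.add tx).add ty
  -- The first Taylor polynomial of `u` at `p`, cut off by `ψ`. `T` kills it by assumption on the
  -- moments, and `u - q` has zero 1-jet at `p`.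
  set q : Plane → ℝ := (((fun x => u p * ψ x) + fun x => a * ((x.1 - p.1) * ψ x)) +
    fun x => b * ((x.2 - p.2) * ψ x)) with hqdef
  have hTq : T q = 0 := by
    rw [hT.add (tc.add tx) ty, hT.add tc tx, hT.smul _ hψ,
      hT.smul _ (hψ.mul_left (contDiff_fst_sub p.1)),
      hT.smul _ (hψ.mul_left (contDiff_snd_sub p.2)), hc, hx, hy]
    ring
  have hqe : q =ᶠ[𝓝 p] fun x => u p + a * (x.1 - p.1) + b * (x.2 - p.2) := by
    filter_upwards [h1] with x hx
    simp [hqdef, hx]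
  have hqd : HasFDerivAt q (a • ContinuousLinearMap.fst ℝ ℝ ℝ + b • ContinuousLinearMap.snd ℝ ℝ ℝ)
      p := by
    refine HasFDerivAt.congr_of_eventuallyEq ?_ hqe
    exact (((hasFDerivAt_fst (p := p)).sub_const p.1).const_mul a |>.const_add (u p)).add
      (((hasFDerivAt_snd (p := p)).sub_const p.2).const_mul b)
  have hz := hT.eq_zero_of_jet hv (hu.sub hq) (p := p)
    (by rw [hqe.eq_of_nhds]; simp)
    (by
      have hud := (hu.1.differentiable (by simp) p).hasFDerivAt
      rw [(hud.fun_sub hqd).fderiv]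
      have ha : fderiv ℝ u p (1, 0) = a := rfl
      have hb : fderiv ℝ u p (0, 1) = b := rfl
      ext <;> simp [ha, hb])
  rw [hT.toIsLin.sub hu hq, hTq] at hz
  linarith

theorem dd_mul_cutoff_eventuallyEq {p : Plane} {ψ q : Plane → ℝ} (h1 : ψ =ᶠ[𝓝 p] 1) (v : Plane) :
    dd v (fun x => q x * ψ x) =ᶠ[𝓝 p] dd v q := by
  refine dd_eventuallyEq ?_ v
  filter_upwards [h1] with x hx
  simp [hx]

/-- The moments of two functionals supported at `p` that are the partial derivatives of one and
the same functional. -/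
theorem moments_of_curl_free {B : Set Plane} {T₁ T₂ : (Plane → ℝ) → ℝ} (hT₁ : IsLin B T₁)
    (hT₂ : IsLin B T₂) {p : Plane} (hv₁ : Vanishes T₁ (B \ {p})) (hv₂ : Vanishes T₂ (B \ {p}))
    (hcomm : ∀ u, IsTest B u → T₁ (dy u) = T₂ (dx u)) {ψ : Plane → ℝ} (hψ : IsTest B ψ)
    (h1 : ψ =ᶠ[𝓝 p] 1) :
    T₁ ψ = 0 ∧ T₂ ψ = 0 ∧ T₁ (fun x => (x.2 - p.2) * ψ x) = 0 ∧
      T₂ (fun x => (x.1 - p.1) * ψ x) = 0 ∧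
      T₁ (fun x => (x.1 - p.1) * ψ x) = T₂ (fun x => (x.2 - p.2) * ψ x) := by
  have hX := contDiff_fst_sub p.1
  have hY := contDiff_snd_sub p.2
  -- The commutation is applied to `q ψ`, whose partial derivatives have at `p` the germs of `r ψ`
  -- and `s ψ`. The monomials `y`, `x`, `y² / 2`, `x² / 2`, `x y`, centred at `p`, then give the
  -- five relations.
  have key : ∀ q r s : Plane → ℝ, ContDiff ℝ ∞ q → ContDiff ℝ ∞ r → ContDiff ℝ ∞ s →
      dy q = r → dx q = s → T₁ (fun x => r x * ψ x) = T₂ (fun x => s x * ψ x) := by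
    intro q r s hq hr hs hqr hqs
    have e : ∀ (v : Plane) (r : Plane → ℝ), dd v q = r →
        dd v (fun x => q x * ψ x) =ᶠ[𝓝 p] fun x => r x * ψ x := by
      intro v r hvr
      filter_upwards [dd_mul_cutoff_eventuallyEq (q := q) h1 v, h1] with x hx hx1
      rw [hx, hvr, hx1]
      simp
    rw [← hT₁.congr_germ hv₁ ((hψ.mul_left hq).dd _) (hψ.mul_left hr) (e _ r hqr),
      ← hT₂.congr_germ hv₂ ((hψ.mul_left hq).dd _) (hψ.mul_left hs) (e _ s hqs)]
    exact hcomm _ (hψ.mul_left hq)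
  have z₁ : T₁ (fun x => 0 * ψ x) = 0 := by rw [hT₁.smul 0 hψ, zero_mul]
  have z₂ : T₂ (fun x => 0 * ψ x) = 0 := by rw [hT₂.smul 0 hψ, zero_mul]
  have k1 := key _ (fun _ => 1) (fun _ => 0) hY contDiff_const contDiff_const
    (dd_snd_sub _ _) (dd_snd_sub _ _)
  have k2 := key _ (fun _ => 0) (fun _ => 1) hX contDiff_const contDiff_const
    (dd_fst_sub _ _) (dd_fst_sub _ _)
  have k3 := key (fun x => (x.2 - p.2) * (1 / 2 * (x.2 - p.2))) (fun x => x.2 - p.2) (fun _ => 0)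
    (hY.mul (contDiff_const.mul hY)) hY contDiff_const
    (by rw [dy, dd_mul hY (contDiff_const.mul hY), dd_const_mul _ hY, dd_snd_sub]; ext x; simp; ring)
    (by rw [dx, dd_mul hY (contDiff_const.mul hY), dd_const_mul _ hY, dd_snd_sub]; ext x; simp)
  have k4 := key (fun x => (x.1 - p.1) * (1 / 2 * (x.1 - p.1))) (fun _ => 0) (fun x => x.1 - p.1)
    (hX.mul (contDiff_const.mul hX)) contDiff_const hX
    (by rw [dy, dd_mul hX (contDiff_const.mul hX), dd_const_mul _ hX, dd_fst_sub]; ext x; simp)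
    (by rw [dx, dd_mul hX (contDiff_const.mul hX), dd_const_mul _ hX, dd_fst_sub]; ext x; simp; ring)
  have k5 := key (fun x => (x.1 - p.1) * (x.2 - p.2)) (fun x => x.1 - p.1) (fun x => x.2 - p.2)
    (hX.mul hY) hX hY
    (by rw [dy, dd_mul hX hY, dd_fst_sub, dd_snd_sub]; ext x; simp)
    (by rw [dx, dd_mul hX hY, dd_fst_sub, dd_snd_sub]; ext x; simp)
  simp only [one_mul] at k1 k2
  rw [z₂] at k1 k3
  rw [z₁] at k2 k4
  exact ⟨k1, k2.symm, k3, k4.symm, k5⟩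

end PlaneJets

/-! ### Circulations, radial cutoffs and jumps -/

section Circulation

/-- The point of angle `θ` on the circle of centre `p` and radius `r`. -/
def circlePt (p : Plane) (r θ : ℝ) : Plane := (p.1 + r * Real.cos θ, p.2 + r * Real.sin θ)

/-- The counterclockwise circulation of the planar field `(X, Y)`. -/
def circ (X Y : Plane → ℝ) (p : Plane) (r : ℝ) : ℝ :=
  ∫ θ in (0 : ℝ)..(2 * Real.pi),
    (X (circlePt p r θ) * (-(r * Real.sin θ)) + Y (circlePt p r θ) * (r * Real.cos θ))

/-- The radii of the circles centred at `p` and contained in `W`. -/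
def goodRadii (W : Set Plane) (p : Plane) : Set ℝ := {r | 0 < r ∧ ∀ θ, circlePt p r θ ∈ W}

/-- The field `(X, Y)` on `W` has jump `V` around `p`. -/
def HasJump (W : Set Plane) (X Y : Plane → ℝ) (p : Plane) (V : ℝ) : Prop :=
  Tendsto (circ X Y p) (𝓝[goodRadii W p] 0) (𝓝 V)

theorem HasJump.congr {W : Set Plane} {X Y X' Y' : Plane → ℝ} {p : Plane} {V : ℝ}
    (h : HasJump W X Y p V) (hX : Set.EqOn X X' W) (hY : Set.EqOn Y Y' W) :
    HasJump W X' Y' p V := by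
  refine Tendsto.congr' ?_ h
  filter_upwards [self_mem_nhdsWithin] with r hr
  simp only [circ]
  congr 1
  ext θ
  rw [hX (hr.2 θ), hY (hr.2 θ)]

theorem continuous_circlePt (p : Plane) : Continuous fun q : ℝ × ℝ => circlePt p q.1 q.2 := by
  unfold circlePt
  fun_prop

theorem circlePt_eq (p : Plane) (q : ℝ × ℝ) : circlePt p q.1 q.2 = p + polarCoord.symm q := by
  ext <;> simp [circlePt, polarCoord]

theorem exists_eq_circlePt (p x : Plane) :
    ∃ θ, x = circlePt p (√((x.1 - p.1) ^ 2 + (x.2 - p.2) ^ 2)) θ := by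
  let z : ℂ := ⟨x.1 - p.1, x.2 - p.2⟩
  have hz : ‖z‖ = √((x.1 - p.1) ^ 2 + (x.2 - p.2) ^ 2) := by
    rw [Complex.norm_def, Complex.normSq_apply]
    simp only [z]
    ring_nf
  refine ⟨z.arg, ?_⟩
  rw [← hz]
  ext
  · simp [circlePt, z]
  · simp [circlePt, z]

theorem circlePt_sq (p : Plane) (r θ : ℝ) :
    ((circlePt p r θ).1 - p.1) ^ 2 + ((circlePt p r θ).2 - p.2) ^ 2 = r ^ 2 := by
  simp only [circlePt]
  linear_combination r ^ 2 * Real.sin_sq_add_cos_sq θ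

/-- The circle is compact, so an open set containing it contains all circles of nearby radius. Thus
a good circle thickens to a good annulus. -/
theorem goodRadii_mem_nhds {W : Set Plane} (hW : IsOpen W) {p : Plane} {r : ℝ}
    (hr : r ∈ goodRadii W p) : goodRadii W p ∈ 𝓝 r := by
  have h1 : ∀ᶠ s in 𝓝 r, ∀ θ ∈ Set.Icc (0 : ℝ) (2 * Real.pi), circlePt p s θ ∈ W := by
    refine isCompact_Icc.eventually_forall_of_forall_eventually fun θ _ => ?_
    exact (continuous_circlePt p).continuousAt.eventually (hW.mem_nhds (hr.2 θ))
  filter_upwards [h1, lt_mem_nhds hr.1] with s hs h0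
  refine ⟨h0, fun θ => ?_⟩
  obtain ⟨θ', hθ', h⟩ := Real.two_pi_pos |> fun hp =>
    (show Function.Periodic (fun θ => circlePt p s θ) (2 * Real.pi) by
      intro θ; simp [circlePt]).exists_mem_Ico₀ hp θ
  rw [h]
  exact hs θ' ⟨hθ'.1, hθ'.2.le⟩

/-- Each point of `S` excludes one radius, so a countable `S` cannot block an interval of radii,
even when it accumulates at `p`. -/
theorem exists_goodRadius {U S : Set Plane} (hU : IsOpen U) (hS : S.Countable) {p : Plane}
    (hp : p ∈ U) {ε : ℝ} (hε : 0 < ε) : ∃ r ∈ goodRadii (U \ S) p, r < ε := by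
  obtain ⟨δ, hδ, hball⟩ := Metric.isOpen_iff.1 hU p hp
  have hbad : ((fun x : Plane => √((x.1 - p.1) ^ 2 + (x.2 - p.2) ^ 2)) '' S).Countable :=
    hS.image _
  have hm : 0 < min ε δ := lt_min hε hδ
  obtain ⟨r, hr, hrb⟩ : ∃ r ∈ Set.Ioo 0 (min ε δ),
      r ∉ (fun x : Plane => √((x.1 - p.1) ^ 2 + (x.2 - p.2) ^ 2)) '' S := by
    by_contra! h
    exact (Cardinal.mk_Ioo_real hm ▸ Cardinal.aleph0_lt_continuum).not_ge
      ((hbad.mono h).le_aleph0)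
  refine ⟨r, ⟨hr.1, fun θ => ⟨hball ?_, fun hS' => hrb ⟨_, hS', ?_⟩⟩⟩, hr.2.trans_le (min_le_left _ _)⟩
  · have hrδ := hr.2.trans_le (min_le_right _ _)
    have hc := Real.abs_cos_le_one θ
    have hs := Real.abs_sin_le_one θ
    rw [Metric.mem_ball, Prod.dist_eq, Real.dist_eq, Real.dist_eq]
    simp only [circlePt, add_sub_cancel_left, abs_mul, abs_of_pos hr.1]
    refine max_lt ?_ ?_ <;> nlinarith [hr.1]
  · simp only
    rw [circlePt_sq, Real.sqrt_sq hr.1.le]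

/-- A smooth cutoff at `p`, with support in the ball of radius `R` and gradient supported in
`W`. -/
structure IsCutoff (W : Set Plane) (p : Plane) (R : ℝ) (ψ : Plane → ℝ) : Prop where
  test : IsTest (Metric.ball p R) ψ
  one : ψ =ᶠ[𝓝 p] 1
  le : ∀ x, |ψ x| ≤ 1
  grad : ∀ v, IsTest W (dd v ψ)

/-- The radial function with profile `h`. -/
def radial (h : ℝ → ℝ) (p x : Plane) : ℝ := h ((x.1 - p.1) ^ 2 + (x.2 - p.2) ^ 2)

theorem dd_radial {h : ℝ → ℝ} (hh : ContDiff ℝ ∞ h) (p v x : Plane) :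
    dd v (radial h p) x = deriv h ((x.1 - p.1) ^ 2 + (x.2 - p.2) ^ 2) *
      (2 * (x.1 - p.1) * v.1 + 2 * (x.2 - p.2) * v.2) := by
  have h1 : HasFDerivAt (fun x : Plane => x.1 - p.1) (ContinuousLinearMap.fst ℝ ℝ ℝ) x :=
    hasFDerivAt_fst.sub_const p.1
  have h2 : HasFDerivAt (fun x : Plane => x.2 - p.2) (ContinuousLinearMap.snd ℝ ℝ ℝ) x :=
    hasFDerivAt_snd.sub_const p.2
  have hq := (h1.pow 2).add (h2.pow 2)
  have hd := ((hh.differentiable (by simp)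
    ((x.1 - p.1) ^ 2 + (x.2 - p.2) ^ 2)).hasDerivAt).comp_hasFDerivAt x hq
  have : fderiv ℝ (radial h p) x = _ := hd.fderiv
  rw [dd, this]
  simp [mul_add]

theorem contDiff_radial {h : ℝ → ℝ} (hh : ContDiff ℝ ∞ h) (p : Plane) :
    ContDiff ℝ ∞ (radial h p) :=
  hh.comp (((contDiff_fst_sub p.1).pow 2).add ((contDiff_snd_sub p.2).pow 2))

/-- Pairing a field with the rotated gradient of a radial function, in polar coordinates. -/
theorem integral_rot_radial {h : ℝ → ℝ} (hh : ContDiff ℝ ∞ h) {a b : ℝ} (ha : 0 < a) (hab : a < b)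
    (h0 : ∀ t, t ∉ Set.Icc (a ^ 2) (b ^ 2) → deriv h t = 0) {p : Plane} {X Y : Plane → ℝ}
    (hF : Continuous fun x => Y x * dx (radial h p) x - X x * dy (radial h p) x) :
    IntervalIntegrable (fun r => 2 * r * deriv h (r ^ 2) * circ X Y p r) volume a b ∧
    ∫ x, (Y x * dx (radial h p) x - X x * dy (radial h p) x) =
      ∫ r in a..b, 2 * r * deriv h (r ^ 2) * circ X Y p r := by
  set F : Plane → ℝ := fun x => Y x * dx (radial h p) x - X x * dy (radial h p) x with hFdef
  let G : ℝ × ℝ → ℝ := fun q => q.1 * F (circlePt p q.1 q.2)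
  have hG : Continuous G := continuous_fst.mul (hF.comp (continuous_circlePt p))
  -- The rotated gradient of a radial function is tangential, so the pairing sees only the
  -- tangential component of the field; the factor `r` is the polar Jacobian.
  have hGval : ∀ r θ, G (r, θ) = 2 * r * deriv h (r ^ 2) *
      (X (circlePt p r θ) * (-(r * Real.sin θ)) + Y (circlePt p r θ) * (r * Real.cos θ)) := by
    intro r θ
    simp only [G, hFdef, dx, dy]
    rw [dd_radial hh, dd_radial hh, circlePt_sq]
    simp only [circlePt]
    ring
  have hinner : ∀ r, ∫ θ in (-Real.pi)..Real.pi, G (r, θ) =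
      2 * r * deriv h (r ^ 2) * circ X Y p r := by
    intro r
    -- Polar coordinates use angles in `(-π, π)`, `circ` uses `[0, 2π]`; periodicity reconciles
    -- them.
    have hper : Function.Periodic (fun θ => G (r, θ)) (2 * Real.pi) := by
      intro θ
      simp [G, circlePt]
    have := hper.intervalIntegral_add_eq (-Real.pi) 0
    rw [show -Real.pi + 2 * Real.pi = Real.pi by ring, zero_add] at this
    rw [this, circ, ← intervalIntegral.integral_const_mul]
    simp_rw [hGval]
  have hcont : Continuous fun r => 2 * r * deriv h (r ^ 2) * circ X Y p r := by
    simp_rw [← hinner]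
    exact intervalIntegral.continuous_parametric_intervalIntegral_of_continuous'
      (f := fun r θ => G (r, θ)) hG _ _
  refine ⟨hcont.intervalIntegrable _ _, ?_⟩
  have hzero : ∀ r, 0 < r → r ∉ Set.Icc a b → ∀ θ, G (r, θ) = 0 := by
    intro r hr hrab θ
    rw [hGval, h0 (r ^ 2), mul_zero, zero_mul]
    rintro ⟨h1, h2⟩
    exact hrab ⟨le_of_sq_le_sq h1 hr.le, le_of_sq_le_sq h2 (ha.trans hab).le⟩
  calc ∫ x, F x = ∫ x, F (p + x) := (integral_add_left_eq_self F p).symm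
    _ = ∫ q in polarCoord.target, q.1 • F (p + polarCoord.symm q) :=
        (integral_comp_polarCoord_symm fun x => F (p + x)).symm
    _ = ∫ q in polarCoord.target, G q := by
        simp_rw [← circlePt_eq]
        rfl
    _ = ∫ q in (Set.Icc a b) ×ˢ (Set.Ioo (-Real.pi) Real.pi), G q := by
        rw [polarCoord_target]
        refine setIntegral_eq_of_subset_of_forall_sdiff_eq_zero
          (measurableSet_Ioi.prod measurableSet_Ioo) ?_ ?_
        · exact Set.prod_mono (fun r hr => ha.trans_le hr.1) subset_rfl
        · rintro ⟨r, θ⟩ ⟨⟨hr, hθ⟩, hn⟩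
          exact hzero r hr (fun h' => hn ⟨h', hθ⟩) θ
    _ = ∫ r in Set.Icc a b, ∫ θ in Set.Ioo (-Real.pi) Real.pi, G (r, θ) := by
        refine setIntegral_prod _ ?_
        refine (hG.continuousOn.integrableOn_compact
          ((isCompact_Icc (a := a) (b := b)).prod
            (isCompact_Icc (a := -Real.pi) (b := Real.pi)))).mono_set ?_
        exact Set.prod_mono subset_rfl Set.Ioo_subset_Icc_self
    _ = ∫ r in a..b, ∫ θ in (-Real.pi)..Real.pi, G (r, θ) := by
        rw [intervalIntegral.integral_of_le hab.le, integral_Icc_eq_integral_Ioc]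
        simp_rw [intervalIntegral.integral_of_le (show -Real.pi ≤ Real.pi by linarith [Real.pi_pos]),
          integral_Ioc_eq_integral_Ioo]
    _ = _ := by simp_rw [hinner]

/-- Radial cutoffs with gradient supported in a thin annulus in `W`. -/
theorem exists_isCutoff {W : Set Plane} (hW : IsOpen W) {p : Plane} {r₀ R : ℝ}
    (hr₀ : r₀ ∈ goodRadii W p) (hR : r₀ < R) :
    ∃ (ψ : Plane → ℝ) (a b : ℝ) (k : ℝ → ℝ), IsCutoff W p R ψ ∧ a < b ∧
      Set.Icc a b ⊆ goodRadii W p ∩ Set.Iio R ∧ (∀ r ∈ Set.Icc a b, 0 ≤ k r) ∧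
      IntervalIntegrable k volume a b ∧ ∫ r in a..b, k r = 1 ∧
      ∀ X Y, ContinuousOn X W → ContinuousOn Y W →
        IntervalIntegrable (fun r => k r * circ X Y p r) volume a b ∧
        ∫ x, (Y x * dx ψ x - X x * dy ψ x) = -∫ r in a..b, k r * circ X Y p r := by
  obtain ⟨δ, hδ, hball⟩ := Metric.mem_nhds_iff.1
    (Filter.inter_mem (goodRadii_mem_nhds hW hr₀) (Iio_mem_nhds hR))
  set a := r₀ - δ / 2 with ha
  set b := r₀ + δ / 2 with hb
  have hab : a < b := by linarith
  have hIcc : Set.Icc a b ⊆ goodRadii W p ∩ Set.Iio R := fun r hr => hball (by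
    rw [Metric.mem_ball, Real.dist_eq, abs_lt]
    constructor <;> linarith [hr.1, hr.2])
  have ha0 : 0 < a := (hIcc ⟨le_rfl, hab.le⟩).1.1
  have hbR : b < R := (hIcc ⟨hab.le, le_rfl⟩).2
  have hsq : a ^ 2 < b ^ 2 := by nlinarith
  have hden : 0 < b ^ 2 - a ^ 2 := by linarith
  -- As a function of the squared radius, `h` decreases from `1` at `a²` to `0` at `b²`, so the
  -- gradient of the cutoff lives in the annulus of good radii.
  let h : ℝ → ℝ := fun t => Real.smoothTransition ((b ^ 2 - t) / (b ^ 2 - a ^ 2))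
  have hh : ContDiff ℝ ∞ h :=
    Real.smoothTransition.contDiff.comp ((contDiff_const.sub contDiff_id).div_const _)
  have h1 : ∀ t ≤ a ^ 2, h t = 1 := fun t ht =>
    Real.smoothTransition.one_of_one_le (by rw [le_div_iff₀ hden]; linarith)
  have h0 : ∀ t, b ^ 2 ≤ t → h t = 0 := fun t ht =>
    Real.smoothTransition.zero_of_nonpos (div_nonpos_of_nonpos_of_nonneg (by linarith) hden.le)
  have hanti : Antitone h := fun s t hst => Real.smoothTransition.monotone (by gcongr)
  have hd0 : ∀ t, t ∉ Set.Icc (a ^ 2) (b ^ 2) → deriv h t = 0 := by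
    intro t ht
    rw [Set.mem_Icc, not_and_or, not_le, not_le] at ht
    rcases ht with ht | ht
    · have : h =ᶠ[𝓝 t] fun _ => 1 := by
        filter_upwards [Iio_mem_nhds ht] with s hs using h1 s (le_of_lt hs)
      rw [this.deriv_eq, deriv_const]
    · have : h =ᶠ[𝓝 t] fun _ => 0 := by
        filter_upwards [Ioi_mem_nhds ht] with s hs using h0 s (le_of_lt hs)
      rw [this.deriv_eq, deriv_const]
  set q : Plane → ℝ := fun x => (x.1 - p.1) ^ 2 + (x.2 - p.2) ^ 2 with hq
  have hqc : Continuous q := by fun_prop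
  have hψ := contDiff_radial hh p
  -- `Plane` carries the max norm: the balls are squares, and the Euclidean disc of radius `b` lies
  -- in the square.
  have hqball : ∀ x, q x ≤ b ^ 2 → x ∈ Metric.closedBall p b := by
    intro x hx
    have hb0 : 0 ≤ b := (ha0.trans hab).le
    rw [Metric.mem_closedBall, Prod.dist_eq, Real.dist_eq, Real.dist_eq]
    simp only [hq] at hx
    refine max_le ?_ ?_ <;> refine abs_le_of_sq_le_sq ?_ hb0 <;> nlinarith [sq_nonneg (x.1 - p.1),
      sq_nonneg (x.2 - p.2)]
  have hts : tsupport (radial h p) ⊆ {x | q x ≤ b ^ 2} := by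
    refine closure_minimal ?_ (isClosed_le hqc continuous_const)
    intro x hx
    by_contra hx'
    exact hx (h0 _ (not_le.1 hx').le)
  have hcs : HasCompactSupport (radial h p) :=
    HasCompactSupport.of_support_subset_isCompact (isCompact_closedBall p b)
      ((subset_tsupport _).trans fun x hx => hqball x (hts hx))
  have hgrad : ∀ v, IsTest W (dd v (radial h p)) := by
    intro v
    refine ⟨dd_smooth hψ v, hcs.fderiv_apply ℝ v, ?_⟩
    have hcl : IsClosed {x | q x ∈ Set.Icc (a ^ 2) (b ^ 2)} := isClosed_Icc.preimage hqc
    refine (closure_minimal (t := {x | q x ∈ Set.Icc (a ^ 2) (b ^ 2)}) ?_ hcl).trans ?_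
    · intro x hx
      by_contra hx'
      exact hx (by rw [dd_radial hh, hd0 _ hx', zero_mul])
    · intro x hx
      obtain ⟨θ, hθ⟩ := exists_eq_circlePt p x
      rw [hθ]
      refine (hIcc ⟨?_, ?_⟩).1.2 θ
      · exact Real.le_sqrt_of_sq_le hx.1
      · exact Real.sqrt_le_iff.2 ⟨(ha0.trans hab).le, hx.2⟩
  have hk : Continuous fun r => -(2 * r * deriv h (r ^ 2)) := by
    have : Continuous (deriv h) := hh.continuous_deriv (by simp)
    fun_prop
  refine ⟨radial h p, a, b, fun r => -(2 * r * deriv h (r ^ 2)), ⟨⟨hψ, hcs, fun x hx => ?_⟩, ?_,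
    ?_, hgrad⟩, hab, hIcc, ?_, hk.intervalIntegrable _ _, ?_, ?_⟩
  · exact Metric.closedBall_subset_ball hbR (hqball x (hts hx))
  · have : ∀ᶠ x in 𝓝 p, q x < a ^ 2 := by
      refine hqc.continuousAt.eventually (gt_mem_nhds ?_)
      have : 0 < a ^ 2 := by positivity
      simpa [hq] using this
    filter_upwards [this] with x hx using h1 _ hx.le
  · intro x
    rw [radial, abs_of_nonneg (Real.smoothTransition.nonneg _)]
    exact Real.smoothTransition.le_one _
  · intro r hr
    have : deriv h (r ^ 2) ≤ 0 := hanti.deriv_nonpos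
    have hr0 : 0 < r := (hIcc hr).1.1
    nlinarith
  -- The weight is the derivative of `-h(r²)`, so its total mass is `h(a²) - h(b²) = 1`.
  · have : ∀ r ∈ Set.uIcc a b, HasDerivAt (fun r => -h (r ^ 2)) (-(2 * r * deriv h (r ^ 2))) r := by
      intro r _
      have h2 := ((hh.differentiable (by simp) (r ^ 2)).hasDerivAt).comp r (hasDerivAt_pow 2 r)
      have e : -(2 * r * deriv h (r ^ 2)) = -(deriv h (r ^ 2) * ((2 : ℕ) * r ^ (2 - 1))) := by
        push_cast
        ring
      rw [e]
      exact h2.neg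
    rw [intervalIntegral.integral_eq_sub_of_hasDerivAt this (hk.intervalIntegrable _ _),
      h1 _ le_rfl, h0 _ le_rfl]
    ring
  · intro X Y hX hY
    have hF : ∀ (Z : Plane → ℝ) (v : Plane), ContinuousOn Z W →
        Continuous fun x => Z x * dd v (radial h p) x := by
      intro Z v hZ
      have := (hgrad v)
      rw [continuous_iff_continuousAt]
      intro x
      by_cases hx : x ∈ tsupport (dd v (radial h p))
      · exact (hZ.continuousAt (hW.mem_nhds (this.3 hx))).mul this.continuous.continuousAt
      · have h' : (fun x => Z x * dd v (radial h p) x) =ᶠ[𝓝 x] fun _ => 0 := by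
          filter_upwards [notMem_tsupport_iff_eventuallyEq.1 hx] with y hy
          simp [hy]
        exact continuousAt_const.congr h'.symm
    obtain ⟨i1, i2⟩ := integral_rot_radial hh ha0 hab hd0 (p := p) (X := X) (Y := Y)
      ((hF Y _ hY).sub (hF X _ hX))
    simp only [neg_mul]
    refine ⟨i1.neg, ?_⟩
    rw [i2, intervalIntegral.integral_neg, neg_neg]

/-- Cutoffs shrinking to `p` that compute the jumps around `p` of all fields. -/
theorem exists_cutoffs {U S : Set Plane} (hU : IsOpen U) (hS : S.Countable)
    (hUS : IsOpen (U \ S)) {p : Plane} (hp : p ∈ U) {R : ℝ} (hR : 0 < R) :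
    ∃ ψ : ℕ → Plane → ℝ, (∀ n : ℕ, IsCutoff (U \ S) p (R / (n + 1)) (ψ n)) ∧
      ∀ X Y V, ContinuousOn X (U \ S) → ContinuousOn Y (U \ S) → HasJump (U \ S) X Y p V →
        Tendsto (fun n => ∫ x, (Y x * dx (ψ n) x - X x * dy (ψ n) x)) atTop (𝓝 (-V)) := by
  have hRn : ∀ n : ℕ, 0 < R / (n + 1) := fun n => by positivity
  choose r hr hrR using fun n : ℕ => exists_goodRadius hU hS hp (hRn n)
  choose ψ a b k hψ hab hIcc hk hki hk1 hcirc using fun n => exists_isCutoff hUS (hr n) (hrR n)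
  refine ⟨ψ, hψ, fun X Y V hX hY hV => ?_⟩
  rw [Metric.tendsto_atTop]
  intro ε hε
  have hev := (Metric.tendsto_nhds.1 hV) (ε / 2) (half_pos hε)
  rw [eventually_nhdsWithin_iff, Metric.eventually_nhds_iff] at hev
  obtain ⟨δ, hδ, hd⟩ := hev
  have hlim : Tendsto (fun n : ℕ => R / (n + 1)) atTop (𝓝 0) :=
    Tendsto.div_atTop tendsto_const_nhds
      (tendsto_atTop_add_const_right _ _ tendsto_natCast_atTop_atTop)
  obtain ⟨n₀, hn₀⟩ := eventually_atTop.1 (hlim.eventually (gt_mem_nhds hδ))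
  refine ⟨n₀, fun n hn => ?_⟩
  obtain ⟨i1, i2⟩ := hcirc n X Y hX hY
  -- The weight has mass one, so the error is an average of `circ - V` over good radii below `R / (n
  -- + 1)`.
  have e : (∫ x, (Y x * dx (ψ n) x - X x * dy (ψ n) x)) - -V =
      -∫ s in a n..b n, k n s * (circ X Y p s - V) := by
    have : ∫ s in a n..b n, k n s * (circ X Y p s - V) =
        (∫ s in a n..b n, k n s * circ X Y p s) - ∫ s in a n..b n, k n s * V := by
      rw [← intervalIntegral.integral_sub i1 ((hki n).mul_const V)]
      simp_rw [mul_sub]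
    rw [this, i2, intervalIntegral.integral_mul_const, hk1]
    ring
  rw [Real.dist_eq, e, abs_neg]
  have hle : |∫ s in a n..b n, k n s * (circ X Y p s - V)| ≤ ∫ s in a n..b n, k n s * (ε / 2) := by
    rw [← Real.norm_eq_abs]
    refine intervalIntegral.norm_integral_le_of_norm_le (hab n).le ?_ ((hki n).mul_const _)
    refine Eventually.of_forall fun s hs => ?_
    have hs' : s ∈ Set.Icc (a n) (b n) := ⟨hs.1.le, hs.2⟩
    have hg := hIcc n hs'
    rw [norm_mul, Real.norm_eq_abs, abs_of_nonneg (hk n s hs')]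
    refine mul_le_mul_of_nonneg_left ?_ (hk n s hs')
    have hs0 : 0 < s := hg.1.1
    have hsR : s < R / (n + 1) := hg.2
    have := hd (y := s) (by
      rw [Real.dist_eq, sub_zero, abs_of_pos hs0]
      exact hsR.trans (hn₀ n hn)) hg.1
    rw [Real.dist_eq] at this
    exact this.le
  rw [intervalIntegral.integral_mul_const, hk1] at hle
  linarith

end Circulation

/-! ### Planar crystals; the vertical strain -/

section Planar

/-- `f` is integrable with integral `a`. -/
structure HasInt (f : Plane → ℝ) (a : ℝ) : Prop where
  integrable : Integrable f
  eq : ∫ x, f x = a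

namespace HasInt

variable {f g : Plane → ℝ} {a b : ℝ}

theorem add (hf : HasInt f a) (hg : HasInt g b) : HasInt (fun x => f x + g x) (a + b) :=
  ⟨hf.1.add hg.1, by rw [integral_add hf.1 hg.1, hf.2, hg.2]⟩

theorem sub (hf : HasInt f a) (hg : HasInt g b) : HasInt (fun x => f x - g x) (a - b) :=
  ⟨hf.1.sub hg.1, by rw [integral_sub hf.1 hg.1, hf.2, hg.2]⟩

theorem const_mul (hf : HasInt f a) (c : ℝ) : HasInt (fun x => c * f x) (c * a) :=
  ⟨hf.1.const_mul c, by rw [integral_const_mul, hf.2]⟩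

theorem integral_eq (hf : HasInt f a) (h : ∀ x, g x = f x) : ∫ x, g x = a := by
  rw [funext h, hf.2]

end HasInt

theorem hasInt_mul {W : Set Plane} (hW : IsOpen W) {f φ : Plane → ℝ} (hf : ContDiffOn ℝ ∞ f W)
    (hφ : IsTest W φ) : HasInt (fun x => f x * φ x) (∫ x, f x * φ x) :=
  ⟨hφ.integrable_mul (hf.continuousOn.locallyIntegrableOn hW.measurableSet), rfl⟩

/-- Integration by parts in a form that carries integrability along, so that the combinations making
up the Frank and Burgers tensors can be assembled term by term. -/
theorem hasInt_dd_mul {W : Set Plane} (hW : IsOpen W) {f φ : Plane → ℝ} (hf : ContDiffOn ℝ ∞ f W)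
    (hφ : IsTest W φ) (v : Plane) :
    HasInt (fun x => dd v f x * φ x) (-∫ x, f x * dd v φ x) :=
  ⟨(hasInt_mul hW (dd_smoothOn hW hf v) hφ).1, by rw [hφ.integral_mul_dd hW hf v, neg_neg]⟩

/-- The Frank tensor of a strain that does not depend on `z`. -/
def planarFrank (e : Fin 3 → Fin 3 → Plane → ℝ) (m k : Fin 3) : Plane → ℝ :=
  ![dy (e 2 m), fun x => -dx (e 2 m) x, fun x => dx (e 1 m) x - dy (e 0 m) x] k

/-- The Burgers tensor, with respect to a point at horizontal position `c` and depth `h`, of a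
strain that does not depend on `z`. -/
def planarBurgers (e : Fin 3 → Fin 3 → Plane → ℝ) (c : Plane) (h : ℝ) (l k : Fin 3) :
    Plane → ℝ :=
  ![fun x => e 0 l x + ((x.2 - c.2) * planarFrank e l 2 x - h * planarFrank e l 1 x),
    fun x => e 1 l x + (h * planarFrank e l 0 x - (x.1 - c.1) * planarFrank e l 2 x),
    fun x => e 2 l x + ((x.1 - c.1) * planarFrank e l 1 x - (x.2 - c.2) * planarFrank e l 0 x)] k

/-- The value on `u` of the second derivative `∂_w (∂_x e_{21} - ∂_y e_{20})`. -/
def shearIncompatibility (e : Fin 3 → Fin 3 → Plane → ℝ) (w : Plane) (u : Plane → ℝ) : ℝ :=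
  (∫ x, e 2 1 x * dx (dd w u) x) - ∫ x, e 2 0 x * dy (dd w u) x

/-- The value on `u` of the planar incompatibility. -/
def planeIncompatibility (e : Fin 3 → Fin 3 → Plane → ℝ) (u : Plane → ℝ) : ℝ :=
  ((∫ x, e 1 1 x * dx (dx u) x) - ∫ x, e 1 0 x * dx (dy u) x) -
    ((∫ x, e 0 1 x * dy (dx u) x) - ∫ x, e 0 0 x * dy (dy u) x)

/-- The horizontal cross-section of a mesoscopic crystal. -/
structure PlanarCrystal (U : Set Plane) (c : Plane) (h : ℝ) where
  /-- the index set of the defects -/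
  N : Type
  countable : Countable N
  /-- the positions of the defects -/
  pos : N → Plane
  pos_injective : Function.Injective pos
  pos_mem : ∀ n, pos n ∈ U
  isOpen : IsOpen U
  isOpen_compl : IsOpen (U \ Set.range pos)
  /-- the strain -/
  e : Fin 3 → Fin 3 → Plane → ℝ
  locallyIntegrable : ∀ i j, LocallyIntegrableOn (e i j) U
  smooth : ∀ i j, ContDiffOn ℝ ∞ (e i j) (U \ Set.range pos)
  symm : ∀ i j, Set.EqOn (e i j) (e j i) (U \ Set.range pos)
  compatible_xx : Vanishes (fun u => ∫ x, e 2 2 x * dx (dx u) x) (U \ Set.range pos)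
  compatible_xy : Vanishes (fun u => ∫ x, e 2 2 x * dx (dy u) x) (U \ Set.range pos)
  compatible_yy : Vanishes (fun u => ∫ x, e 2 2 x * dy (dy u) x) (U \ Set.range pos)
  compatible_xz : Vanishes (shearIncompatibility e (1, 0)) (U \ Set.range pos)
  compatible_yz : Vanishes (shearIncompatibility e (0, 1)) (U \ Set.range pos)
  compatible_zz : Vanishes (planeIncompatibility e) (U \ Set.range pos)
  /-- the Frank vectors -/
  frank : N → Fin 3 → ℝ
  /-- the Burgers vectors -/
  burgers : N → Fin 3 → ℝ
  frank_summable : ∀ j, LocSummable U pos fun n => frank n j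
  burgers_summable : ∀ j, LocSummable U pos fun n => burgers n j
  frank_jump : ∀ n k, HasJump (U \ Set.range pos) (planarFrank e 0 k) (planarFrank e 1 k) (pos n)
    (frank n k)
  burgers_jump : ∀ n k, HasJump (U \ Set.range pos) (planarBurgers e c h 0 k)
    (planarBurgers e c h 1 k) (pos n) (burgers n k)

namespace PlanarCrystal

variable {U : Set Plane} {c : Plane} {h : ℝ} (P : PlanarCrystal U c h)

/-- The plane domain without the defects. -/
abbrev W : Set Plane := U \ Set.range P.pos

theorem countable_range : (Set.range P.pos).Countable :=
  have := P.countable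
  Set.countable_range P.pos

theorem smooth_frank (m k : Fin 3) : ContDiffOn ℝ ∞ (planarFrank P.e m k) P.W := by
  have hd : ∀ i v, ContDiffOn ℝ ∞ (dd v (P.e i m)) P.W := fun i v =>
    dd_smoothOn P.isOpen_compl (P.smooth i m) v
  fin_cases k
  · exact hd 2 _
  · exact (hd 2 _).neg
  · exact (hd 1 _).sub (hd 0 _)

theorem smooth_burgers (l k : Fin 3) : ContDiffOn ℝ ∞ (planarBurgers P.e c h l k) P.W := by
  have hX := (contDiff_fst_sub c.1).contDiffOn (s := P.W)
  have hY := (contDiff_snd_sub c.2).contDiffOn (s := P.W)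
  have hh : ContDiffOn ℝ ∞ (fun _ : Plane => h) P.W := contDiffOn_const
  fin_cases k
  · exact (P.smooth 0 l).add ((hY.mul (P.smooth_frank l 2)).sub (hh.mul (P.smooth_frank l 1)))
  · exact (P.smooth 1 l).add ((hh.mul (P.smooth_frank l 0)).sub (hX.mul (P.smooth_frank l 2)))
  · exact (P.smooth 2 l).add ((hX.mul (P.smooth_frank l 1)).sub (hY.mul (P.smooth_frank l 0)))

/-- Cutoffs shrinking to a defect that compute its Frank and Burgers vectors. -/
theorem exists_cutoffs (n : P.N) {R : ℝ} (hR : 0 < R) :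
    ∃ ψ : ℕ → Plane → ℝ, (∀ i : ℕ, IsCutoff P.W (P.pos n) (R / (i + 1)) (ψ i)) ∧
      (∀ k, Tendsto (fun i => ∫ x, (planarFrank P.e 1 k x * dx (ψ i) x -
        planarFrank P.e 0 k x * dy (ψ i) x)) atTop (𝓝 (-P.frank n k))) ∧
      ∀ k, Tendsto (fun i => ∫ x, (planarBurgers P.e c h 1 k x * dx (ψ i) x -
        planarBurgers P.e c h 0 k x * dy (ψ i) x)) atTop (𝓝 (-P.burgers n k)) := by
  obtain ⟨ψ, h1, h2⟩ := Crystal.exists_cutoffs P.isOpen P.countable_range P.isOpen_compl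
    (P.pos_mem n) hR
  exact ⟨ψ, h1, fun k => h2 _ _ _ (P.smooth_frank 0 k).continuousOn
    (P.smooth_frank 1 k).continuousOn (P.frank_jump n k), fun k => h2 _ _ _
    (P.smooth_burgers 0 k).continuousOn (P.smooth_burgers 1 k).continuousOn (P.burgers_jump n k)⟩

theorem pointSum_congr {m : P.N → ℝ} {f g : Plane → ℝ} (hfg : ∀ n, f (P.pos n) = g (P.pos n)) :
    pointSum P.pos m f = pointSum P.pos m g := by
  simp [pointSum, hfg]

variable {P}

/-- A cutoff is constant near every defect. Hence derivatives of `q ψ` evaluated at defects fall on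
`q` alone. -/
theorem cutoff_dd_pos {p : Plane} {R : ℝ} {ψ : Plane → ℝ} (hψ : IsCutoff P.W p R ψ) (v : Plane)
    (n : P.N) : dd v ψ (P.pos n) = 0 :=
  image_eq_zero_of_notMem_tsupport fun h' => ((hψ.grad v).3 h').2 ⟨n, rfl⟩

theorem dd_mul_cutoff_pos {p : Plane} {R : ℝ} {ψ q : Plane → ℝ} (hψ : IsCutoff P.W p R ψ)
    (hq : ContDiff ℝ ∞ q) (v : Plane) (n : P.N) :
    dd v (fun x => q x * ψ x) (P.pos n) = dd v q (P.pos n) * ψ (P.pos n) := by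
  rw [dd_mul hq hψ.test.1]
  simp [cutoff_dd_pos hψ]

/-- The supports shrink to `pos n`, where the cutoffs equal one, so dominated convergence leaves
only the mass at `n`; the masses accumulating there contribute nothing in the limit. -/
theorem tendsto_pointSum_cutoff {m : P.N → ℝ} (hm : LocSummable U P.pos m) {n : P.N} {R : ℝ}
    (hR : 0 < R) (hRU : Metric.ball (P.pos n) R ⊆ U) {ψ : ℕ → Plane → ℝ}
    (hψ : ∀ i : ℕ, IsCutoff P.W (P.pos n) (R / (i + 1)) (ψ i)) :
    Tendsto (fun i => pointSum P.pos m (ψ i)) atTop (𝓝 (m n)) := by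
  have hw : pointSum P.pos m (fun x => if x = P.pos n then 1 else 0) = m n := by
    rw [pointSum, tsum_eq_single n]
    · simp
    · intro k hk
      simp [P.pos_injective.ne hk]
  -- Dropping the first cutoff puts all supports in the closed ball of radius `R / 2`, a compact
  -- subset of `U`.
  rw [← hw, ← tendsto_add_atTop_iff_nat 1]
  have hlim : Tendsto (fun n : ℕ => R / (n + 1)) atTop (𝓝 0) :=
    Tendsto.div_atTop tendsto_const_nhds
      (tendsto_atTop_add_const_right _ _ tendsto_natCast_atTop_atTop)
  have hle : ∀ i : ℕ, R / ((i + 1 : ℕ) + 1) ≤ R / 2 := fun i => by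
    apply div_le_div_of_nonneg_left hR.le two_pos
    push_cast
    linarith [(Nat.cast_nonneg i : (0 : ℝ) ≤ i)]
  refine hm.tendsto_pointSum (isCompact_closedBall (P.pos n) (R / 2))
    ((Metric.closedBall_subset_ball (half_lt_self hR)).trans hRU) (C := 1) (fun i => ?_)
    (fun i => (hψ _).le) (fun x _ => ?_)
  · exact (hψ _).test.3.trans (Metric.ball_subset_closedBall.trans
      (Metric.closedBall_subset_closedBall (hle i)))
  · by_cases hx : x = P.pos n
    · simp only [hx, if_true]
      refine tendsto_const_nhds.congr fun i => ?_
      exact (hψ _).one.eq_of_nhds.symm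
    · simp only [hx, if_false]
      have hd : 0 < dist x (P.pos n) := dist_pos.2 hx
      refine tendsto_const_nhds.congr' ?_
      filter_upwards [((tendsto_add_atTop_iff_nat 1).2 hlim).eventually (gt_mem_nhds hd)] with i hi
      refine (image_eq_zero_of_notMem_tsupport fun h' => ?_).symm
      exact absurd ((hψ _).test.3 h') (not_lt.2 hi.le)

variable (P)

/-- The vertical strain is affine. -/
theorem vertical_strain {u : Plane → ℝ} (hu : IsTest U u) :
    ∫ x, P.e 2 2 x * dx (dx u) x = 0 ∧ ∫ x, P.e 2 2 x * dx (dy u) x = 0 ∧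
      ∫ x, P.e 2 2 x * dy (dy u) x = 0 := by
  let T : Fin 3 → (Plane → ℝ) → ℝ := ![fun u => ∫ x, P.e 2 2 x * dx (dx u) x,
    fun u => ∫ x, P.e 2 2 x * dx (dy u) x, fun u => ∫ x, P.e 2 2 x * dy (dy u) x]
  have hT : ∀ i, IsTame U (T i) := by
    intro i
    fin_cases i <;> exact isTame_integral (P.locallyIntegrable 2 2) _ _
  have key := vanishes_of_removable P.isOpen P.countable_range P.isOpen_compl
    (fun i => (hT i).toIsLin) (T := T)
    (by
      intro i
      fin_cases i
      exacts [P.compatible_xx, P.compatible_xy, P.compatible_yy])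
    (by
      rintro - ⟨n, rfl⟩ R hR hRU hv
      obtain ⟨ψ', hψ', -⟩ := P.exists_cutoffs n hR
      obtain ⟨ψ, hψ⟩ : ∃ ψ, IsCutoff P.W (P.pos n) R ψ := ⟨ψ' 0, by simpa using hψ' 0⟩
      have hB := fun i => (hT i).mono hRU
      -- Equality of mixed third derivatives links `xx` with `xy`, and `xy` with `yy`. The two sets
      -- of relations together kill all nine moments, without any use of the jumps.
      obtain ⟨a1, a2, a3, a4, a5⟩ := moments_of_curl_free (hB 0).toIsLin (hB 1).toIsLin (hv 0) (hv 1)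
        (fun u hu => by
          change ∫ x, P.e 2 2 x * dx (dx (dy u)) x = ∫ x, P.e 2 2 x * dx (dy (dx u)) x
          rw [dx, dy, dd_comm hu.1]) hψ.test hψ.one
      obtain ⟨b1, b2, b3, b4, b5⟩ := moments_of_curl_free (hB 1).toIsLin (hB 2).toIsLin (hv 1) (hv 2)
        (fun u hu => by
          change ∫ x, P.e 2 2 x * dx (dy (dy u)) x = ∫ x, P.e 2 2 x * dy (dy (dx u)) x
          rw [dx, dy, dd_comm (dd_smooth hu.1 _), dd_comm hu.1]) hψ.test hψ.one
      intro i
      fin_cases i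
      · exact (hB 0).vanishes_of_affine (hv 0) hψ.test hψ.one a1 (a5.trans b3) a3
      · exact (hB 1).vanishes_of_affine (hv 1) hψ.test hψ.one a2 a4 b3
      · exact (hB 2).vanishes_of_affine (hv 2) hψ.test hψ.one b2 b4 (b5.symm.trans a4))
  exact ⟨key 0 u hu, key 1 u hu, key 2 u hu⟩

end PlanarCrystal

end Planar

/-! ### Jump pairings as moments of the incompatibility -/

section PlanarDefects

namespace PlanarCrystal

variable {U : Set Plane} {c : Plane} {h : ℝ} (P : PlanarCrystal U c h)

theorem isTame_shearIncompatibility (w : Plane) : IsTame U (shearIncompatibility P.e w) :=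
  (isTame_integral (P.locallyIntegrable 2 1) _ _).fun_sub
    (isTame_integral (P.locallyIntegrable 2 0) _ _)

theorem isTame_planeIncompatibility : IsTame U (planeIncompatibility P.e) :=
  ((isTame_integral (P.locallyIntegrable 1 1) _ _).fun_sub
    (isTame_integral (P.locallyIntegrable 1 0) _ _)).fun_sub
    ((isTame_integral (P.locallyIntegrable 0 1) _ _).fun_sub
    (isTame_integral (P.locallyIntegrable 0 0) _ _))

variable {P}

/-- The gradient of `ψ` is a test function off the defects, where the strain is smooth, so the
derivatives in the Frank tensor can be moved onto it. The result involves only the strain and makes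
sense across the defects. -/
theorem integral_frank_x {p : Plane} {R : ℝ} {ψ : Plane → ℝ} (hψ : IsCutoff P.W p R ψ) :
    ∫ x, (planarFrank P.e 1 0 x * dx ψ x - planarFrank P.e 0 0 x * dy ψ x) =
      -shearIncompatibility P.e (0, 1) ψ := by
  have hW := P.isOpen_compl
  have h1 := hasInt_dd_mul hW (P.smooth 2 1) (hψ.grad (1, 0)) (0, 1)
  have h2 := hasInt_dd_mul hW (P.smooth 2 0) (hψ.grad (0, 1)) (0, 1)
  refine ((h1.sub h2).integral_eq fun x => rfl).trans ?_
  rw [shearIncompatibility, dd_comm hψ.test.1 (0, 1) (1, 0)]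
  ring

theorem integral_frank_y {p : Plane} {R : ℝ} {ψ : Plane → ℝ} (hψ : IsCutoff P.W p R ψ) :
    ∫ x, (planarFrank P.e 1 1 x * dx ψ x - planarFrank P.e 0 1 x * dy ψ x) =
      shearIncompatibility P.e (1, 0) ψ := by
  have hW := P.isOpen_compl
  have h1 := hasInt_dd_mul hW (P.smooth 2 1) (hψ.grad (1, 0)) (1, 0)
  have h2 := hasInt_dd_mul hW (P.smooth 2 0) (hψ.grad (0, 1)) (1, 0)
  refine ((h2.sub h1).integral_eq fun x => by simp [planarFrank]; ring).trans ?_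
  rw [shearIncompatibility, dd_comm hψ.test.1 (1, 0) (0, 1)]
  ring

theorem integral_frank_z {p : Plane} {R : ℝ} {ψ : Plane → ℝ} (hψ : IsCutoff P.W p R ψ) :
    ∫ x, (planarFrank P.e 1 2 x * dx ψ x - planarFrank P.e 0 2 x * dy ψ x) =
      -planeIncompatibility P.e ψ := by
  have hW := P.isOpen_compl
  have h1 := hasInt_dd_mul hW (P.smooth 1 1) (hψ.grad (1, 0)) (1, 0)
  have h2 := hasInt_dd_mul hW (P.smooth 0 1) (hψ.grad (1, 0)) (0, 1)
  have h3 := hasInt_dd_mul hW (P.smooth 1 0) (hψ.grad (0, 1)) (1, 0)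
  have h4 := hasInt_dd_mul hW (P.smooth 0 0) (hψ.grad (0, 1)) (0, 1)
  refine (((h1.sub h2).sub (h3.sub h4)).integral_eq fun x => by
    simp [planarFrank]; ring).trans ?_
  rw [planeIncompatibility]
  ring

/-- Second derivatives of the product of a cutoff with a coordinate. -/
theorem dd_dd_coord_mul {q ψ : Plane → ℝ} (hq : ContDiff ℝ ∞ q) (hψ : ContDiff ℝ ∞ ψ)
    {v w : Plane} {a b : ℝ} (ha : dd v q = fun _ => a) (hb : dd w q = fun _ => b) (x : Plane) :
    dd v (dd w (fun x => q x * ψ x)) x =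
      q x * dd v (dd w ψ) x + a * dd w ψ x + b * dd v ψ x := by
  rw [dd_mul hq hψ, hb, show (fun x => q x * dd w ψ x + b * ψ x) =
    (fun x => q x * dd w ψ x) + fun x => b * ψ x from rfl,
    dd_add (hq.mul (dd_smooth hψ w)) (contDiff_const.mul hψ), dd_mul hq (dd_smooth hψ w), ha,
    dd_const_mul b hψ]
  rfl

/-- After integration by parts the coordinate weights stand inside one derivative only. Moving them
inside both produces `v.1 ∂_x ψ + v.2 ∂_y ψ = ∂_v ψ`, which is exactly the contribution of the
strain term of the Burgers tensor. -/
theorem integral_burgers_z {p : Plane} {R : ℝ} {ψ : Plane → ℝ} (hψ : IsCutoff P.W p R ψ) :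
    ∫ x, (planarBurgers P.e c h 1 2 x * dx ψ x - planarBurgers P.e c h 0 2 x * dy ψ x) =
      shearIncompatibility P.e (1, 0) (fun x => (x.1 - c.1) * ψ x) +
        shearIncompatibility P.e (0, 1) (fun x => (x.2 - c.2) * ψ x) := by
  have hW := P.isOpen_compl
  have hX := contDiff_fst_sub c.1
  have hY := contDiff_snd_sub c.2
  have hs := hψ.test.1
  have key : ∀ (l : Fin 3) (v : Plane),
      HasInt (fun x => (P.e 2 l x + ((x.1 - c.1) * -dx (P.e 2 l) x - (x.2 - c.2) * dy (P.e 2 l) x)) *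
        dd v ψ x) ((∫ x, P.e 2 l x * dd v (dx (fun x => (x.1 - c.1) * ψ x)) x) +
          ∫ x, P.e 2 l x * dd v (dy (fun x => (x.2 - c.2) * ψ x)) x) := by
    intro l v
    have t := hψ.grad v
    have h1 := hasInt_mul hW (P.smooth 2 l) t
    have h2 := hasInt_dd_mul hW (P.smooth 2 l) (t.mul_left hX) (1, 0)
    have h3 := hasInt_dd_mul hW (P.smooth 2 l) (t.mul_left hY) (0, 1)
    have k2 := hasInt_mul hW (P.smooth 2 l) ((t.mul_left hX).dd (1, 0))
    have k3 := hasInt_mul hW (P.smooth 2 l) ((t.mul_left hY).dd (0, 1))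
    have eX : ∀ x, dd v (dx (fun x => (x.1 - c.1) * ψ x)) x =
        dx (fun x => (x.1 - c.1) * dd v ψ x) x + v.1 * dx ψ x := by
      intro x
      rw [dx, dd_dd_coord_mul hX hs (dd_fst_sub _ _) (dd_fst_sub _ _), dd_mul hX (dd_smooth hs v),
        dd_fst_sub, dd_comm hs v]
      ring
    have eY : ∀ x, dd v (dy (fun x => (x.2 - c.2) * ψ x)) x =
        dy (fun x => (x.2 - c.2) * dd v ψ x) x + v.2 * dy ψ x := by
      intro x
      rw [dy, dd_dd_coord_mul hY hs (dd_snd_sub _ _) (dd_snd_sub _ _), dd_mul hY (dd_smooth hs v),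
        dd_snd_sub, dd_comm hs v]
      ring
    have m1 := (hasInt_mul hW (P.smooth 2 l) (hψ.grad (1, 0))).const_mul v.1
    have m2 := (hasInt_mul hW (P.smooth 2 l) (hψ.grad (0, 1))).const_mul v.2
    have hv : ∀ x, dd v ψ x = v.1 * dx ψ x + v.2 * dy ψ x := by
      intro x
      have : v = v.1 • ((1, 0) : Plane) + v.2 • ((0, 1) : Plane) := by ext <;> simp
      simp only [dd]
      conv_lhs => rw [this, map_add, map_smul, map_smul]
      rfl
    refine ⟨?_, ?_⟩
    · refine ((h1.sub h2).sub h3).1.congr (Eventually.of_forall fun x => ?_)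
      simp only
      ring
    · have i1 : ∫ x, P.e 2 l x * dd v (dx (fun x => (x.1 - c.1) * ψ x)) x = _ :=
        (k2.add m1).integral_eq fun x => by rw [eX]; ring
      have i2 : ∫ x, P.e 2 l x * dd v (dy (fun x => (x.2 - c.2) * ψ x)) x = _ :=
        (k3.add m2).integral_eq fun x => by rw [eY]; ring
      have i3 : ∫ x, P.e 2 l x * dd v ψ x = _ :=
        (m1.add m2).integral_eq fun x => by rw [hv]; ring
      rw [i1, i2]
      refine (((h1.sub h2).sub h3).integral_eq fun x => by ring).trans ?_
      rw [i3]
      ring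
  refine (((key 1 (1, 0)).sub (key 0 (0, 1))).integral_eq fun x => rfl).trans ?_
  rw [shearIncompatibility, shearIncompatibility]
  ring

/-- The strain term again compensates the commutator of the weight with the second derivatives, here
by means of `e 0 1 = e 1 0` on the support of `∂_y ψ`. The depth `h` multiplies the pairing of the
horizontal rotation `ω_x`, a shear incompatibility. -/
theorem integral_burgers_y {p : Plane} {R : ℝ} {ψ : Plane → ℝ} (hψ : IsCutoff P.W p R ψ) :
    ∫ x, (planarBurgers P.e c h 1 1 x * dx ψ x - planarBurgers P.e c h 0 1 x * dy ψ x) =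
      planeIncompatibility P.e (fun x => (x.1 - c.1) * ψ x) -
        h * shearIncompatibility P.e (0, 1) ψ := by
  have hW := P.isOpen_compl
  have hX := contDiff_fst_sub c.1
  have hs := hψ.test.1
  have tx := hψ.grad (1, 0)
  have ty := hψ.grad (0, 1)
  have h1 := hasInt_mul hW (P.smooth 1 1) tx
  have h2 := hasInt_mul hW (P.smooth 1 0) ty
  have a1 := hasInt_dd_mul hW (P.smooth 1 1) (tx.mul_left hX) (1, 0)
  have a2 := hasInt_dd_mul hW (P.smooth 0 1) (tx.mul_left hX) (0, 1)
  have a3 := hasInt_dd_mul hW (P.smooth 1 0) (ty.mul_left hX) (1, 0)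
  have a4 := hasInt_dd_mul hW (P.smooth 0 0) (ty.mul_left hX) (0, 1)
  have f1 := (hasInt_dd_mul hW (P.smooth 2 1) tx (0, 1)).const_mul h
  have f2 := (hasInt_dd_mul hW (P.smooth 2 0) ty (0, 1)).const_mul h
  refine ((((h1.sub (a1.sub a2)).add f1).sub ((h2.sub (a3.sub a4)).add f2)).integral_eq
    fun x => by simp [planarBurgers, planarFrank]; ring).trans ?_
  have b1 := hasInt_mul hW (P.smooth 1 1) ((tx.mul_left hX).dd (1, 0))
  have b2 := hasInt_mul hW (P.smooth 0 1) ((tx.mul_left hX).dd (0, 1))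
  have hsym : ∀ x, P.e 0 1 x * dd (0, 1) ψ x = P.e 1 0 x * dd (0, 1) ψ x := by
    intro x
    by_cases hx : x ∈ tsupport (dd (0, 1) ψ)
    · rw [P.symm 0 1 (ty.3 hx)]
    · rw [image_eq_zero_of_notMem_tsupport hx, mul_zero, mul_zero]
  have e : ∀ v w : Plane, ∀ x, dd v (dd w fun x => (x.1 - c.1) * ψ x) x =
      dd v (fun x => (x.1 - c.1) * dd w ψ x) x + w.1 * dd v ψ x := by
    intro v w x
    rw [dd_dd_coord_mul hX hs (dd_fst_sub _ _) (dd_fst_sub _ _), dd_mul hX (dd_smooth hs _),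
      dd_fst_sub]
  have i1 : ∫ x, P.e 1 1 x * dd (1, 0) (dd (1, 0) fun x => (x.1 - c.1) * ψ x) x = _ :=
    (b1.add h1).integral_eq fun x => by rw [e]; ring
  have i2 : ∫ x, P.e 0 1 x * dd (0, 1) (dd (1, 0) fun x => (x.1 - c.1) * ψ x) x = _ :=
    (b2.add h2).integral_eq fun x => by rw [e, ← hsym]; ring
  simp only [planeIncompatibility, shearIncompatibility, dx, dy]
  rw [i1, i2, dd_comm hs (0, 1) (1, 0)]
  simp only [e, zero_mul, add_zero]
  ring

theorem integral_burgers_x {p : Plane} {R : ℝ} {ψ : Plane → ℝ} (hψ : IsCutoff P.W p R ψ) :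
    ∫ x, (planarBurgers P.e c h 1 0 x * dx ψ x - planarBurgers P.e c h 0 0 x * dy ψ x) =
      -planeIncompatibility P.e (fun x => (x.2 - c.2) * ψ x) -
        h * shearIncompatibility P.e (1, 0) ψ := by
  have hW := P.isOpen_compl
  have hY := contDiff_snd_sub c.2
  have hs := hψ.test.1
  have tx := hψ.grad (1, 0)
  have ty := hψ.grad (0, 1)
  have h1 := hasInt_mul hW (P.smooth 0 1) tx
  have h2 := hasInt_mul hW (P.smooth 0 0) ty
  have a1 := hasInt_dd_mul hW (P.smooth 1 1) (tx.mul_left hY) (1, 0)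
  have a2 := hasInt_dd_mul hW (P.smooth 0 1) (tx.mul_left hY) (0, 1)
  have a3 := hasInt_dd_mul hW (P.smooth 1 0) (ty.mul_left hY) (1, 0)
  have a4 := hasInt_dd_mul hW (P.smooth 0 0) (ty.mul_left hY) (0, 1)
  have f1 := (hasInt_dd_mul hW (P.smooth 2 1) tx (1, 0)).const_mul h
  have f2 := (hasInt_dd_mul hW (P.smooth 2 0) ty (1, 0)).const_mul h
  refine ((((h1.add (a1.sub a2)).add f1).sub ((h2.add (a3.sub a4)).add f2)).integral_eq
    fun x => by simp [planarBurgers, planarFrank]; ring).trans ?_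
  have b3 := hasInt_mul hW (P.smooth 1 0) ((ty.mul_left hY).dd (1, 0))
  have b4 := hasInt_mul hW (P.smooth 0 0) ((ty.mul_left hY).dd (0, 1))
  have hsym : ∀ x, P.e 1 0 x * dd (1, 0) ψ x = P.e 0 1 x * dd (1, 0) ψ x := by
    intro x
    by_cases hx : x ∈ tsupport (dd (1, 0) ψ)
    · rw [P.symm 1 0 (tx.3 hx)]
    · rw [image_eq_zero_of_notMem_tsupport hx, mul_zero, mul_zero]
  have e : ∀ v w : Plane, ∀ x, dd v (dd w fun x => (x.2 - c.2) * ψ x) x =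
      dd v (fun x => (x.2 - c.2) * dd w ψ x) x + w.2 * dd v ψ x := by
    intro v w x
    rw [dd_dd_coord_mul hY hs (dd_snd_sub _ _) (dd_snd_sub _ _), dd_mul hY (dd_smooth hs _),
      dd_snd_sub]
  have i3 : ∫ x, P.e 1 0 x * dd (1, 0) (dd (0, 1) fun x => (x.2 - c.2) * ψ x) x = _ :=
    (b3.add h1).integral_eq fun x => by rw [e, ← hsym]; ring
  have i4 : ∫ x, P.e 0 0 x * dd (0, 1) (dd (0, 1) fun x => (x.2 - c.2) * ψ x) x = _ :=
    (b4.add h2).integral_eq fun x => by rw [e]; ring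
  simp only [planeIncompatibility, shearIncompatibility, dx, dy]
  rw [i3, i4, dd_comm hs (1, 0) (0, 1)]
  simp only [e, zero_mul, add_zero]
  ring

end PlanarCrystal

end PlanarDefects

/-! ### The incompatibility of a planar crystal is its point sources -/

section PlanarIncompatibility

namespace PlanarCrystal

variable {U : Set Plane} {c : Plane} {h : ℝ} (P : PlanarCrystal U c h)

theorem cutoff_test_mono {p : Plane} {R : ℝ} (hR : 0 < R) {ψ : ℕ → Plane → ℝ}
    (hψ : ∀ i : ℕ, IsCutoff P.W p (R / (i + 1)) (ψ i)) (i : ℕ) : IsTest (Metric.ball p R) (ψ i) :=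
  (hψ i).test.mono (Metric.ball_subset_ball (div_le_self hR.le (by
    linarith [(Nat.cast_nonneg i : (0 : ℝ) ≤ i)])))

/-- The shear incompatibility with its point sources removed. -/
def shearDefect (w : Plane) (u : Plane → ℝ) : ℝ :=
  shearIncompatibility P.e w u + pointSum P.pos (fun n => P.burgers n 2) fun x => 1 / 2 * dd w u x

theorem isTame_shearDefect (w : Plane) : IsTame U (P.shearDefect w) :=
  (P.isTame_shearIncompatibility w).fun_add
    (isTame_pointSum_dd (P.burgers_summable 2) contDiff_const w)

theorem shearDefect_of_vanishing {w : Plane} {u : Plane → ℝ} (hu : ∀ n, dd w u (P.pos n) = 0) :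
    P.shearDefect w u = shearIncompatibility P.e w u := by
  rw [shearDefect, P.pointSum_congr (g := 0) fun n => by simp [hu]]
  simp

theorem shearDefect_comm {u : Plane → ℝ} (hu : ContDiff ℝ ∞ u) :
    P.shearDefect (1, 0) (dy u) = P.shearDefect (0, 1) (dx u) := by
  simp only [shearDefect, shearIncompatibility, dx, dy]
  rw [dd_comm hu (0, 1) (1, 0)]

/-- First moments centred at different points differ by a multiple of the zeroth moment. This passes
from the reference point `c` of the Burgers tensor to the defect. -/
theorem shift_moment {B : Set Plane} {T : (Plane → ℝ) → ℝ} (hT : IsLin B T) {ψ q : Plane → ℝ}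
    (hψ : IsTest B ψ) (hq : ContDiff ℝ ∞ q) (a b : ℝ) (h0 : T ψ = 0) :
    T (fun x => (q x - a) * ψ x) = T (fun x => (q x - b) * ψ x) := by
  have h1 := hT.add (hψ.mul_left (hq.sub contDiff_const) (w := fun x => q x - b))
    (hψ.const_mul (b - a))
  rw [hT.smul _ hψ, h0, mul_zero, add_zero] at h1
  rw [← h1]
  congr 1
  ext x
  simp
  ring

/-- The shear incompatibility is produced by the screw components of the Burgers vectors. -/
theorem shear_strain {u : Plane → ℝ} (hu : IsTest U u) :
    P.shearDefect (1, 0) u = 0 ∧ P.shearDefect (0, 1) u = 0 := by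
  let T : Fin 2 → (Plane → ℝ) → ℝ := ![P.shearDefect (1, 0), P.shearDefect (0, 1)]
  have hT : ∀ i, IsTame U (T i) := by
    intro i
    fin_cases i <;> exact P.isTame_shearDefect _
  have hoff : ∀ {w : Plane} {u : Plane → ℝ}, IsTest P.W u → ∀ n, dd w u (P.pos n) = 0 :=
    fun {w u} hu n => image_eq_zero_of_notMem_tsupport fun h' => ((hu.dd w).3 h').2 ⟨n, rfl⟩
  have key := vanishes_of_removable P.isOpen P.countable_range P.isOpen_compl
    (fun i => (hT i).toIsLin) (T := T)
    (by
      intro i u hu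
      fin_cases i
      · exact (P.shearDefect_of_vanishing (hoff hu)).trans (P.compatible_xz u hu)
      · exact (P.shearDefect_of_vanishing (hoff hu)).trans (P.compatible_yz u hu))
    (by
      rintro - ⟨n, rfl⟩ R hR hRU hv
      obtain ⟨ψ, hψ, -, hb⟩ := P.exists_cutoffs n hR
      have ht := P.cutoff_test_mono hR hψ
      have hB := fun i => (hT i).mono hRU
      have mom := fun i => moments_of_curl_free (hB 0).toIsLin (hB 1).toIsLin (hv 0) (hv 1)
        (fun u hu => P.shearDefect_comm hu.1) (ht i) (hψ i).one
      have hX := contDiff_fst_sub c.1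
      have hY := contDiff_snd_sub c.2
      -- Mixed derivatives leave one unknown, the common value of the `x`-moment of the first
      -- functional and the `y`-moment of the second. Their sum is the pairing of the Burgers field
      -- `b_z` plus its sources, `½` from each functional.
      have hsum : ∀ i, P.shearDefect (1, 0) (fun x => (x.1 - (P.pos n).1) * ψ i x) +
          P.shearDefect (0, 1) (fun x => (x.2 - (P.pos n).2) * ψ i x) =
          (∫ x, (planarBurgers P.e c h 1 2 x * dx (ψ i) x -
            planarBurgers P.e c h 0 2 x * dy (ψ i) x)) +
          pointSum P.pos (fun n => P.burgers n 2) (ψ i) := by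
        intro i
        rw [shift_moment (T := P.shearDefect (1, 0)) (hB 0).toIsLin (ht i) contDiff_fst _ c.1 (mom i).1,
          shift_moment (T := P.shearDefect (0, 1)) (hB 1).toIsLin (ht i) contDiff_snd _ c.2 (mom i).2.1,
          integral_burgers_z (hψ i)]
        have e1 : pointSum P.pos (fun n => P.burgers n 2)
            (fun x => 1 / 2 * dd (1, 0) (fun x => (x.1 - c.1) * ψ i x) x) =
            1 / 2 * pointSum P.pos (fun n => P.burgers n 2) (ψ i) := by
          rw [← pointSum_const_mul]
          refine P.pointSum_congr fun k => ?_
          rw [dd_mul_cutoff_pos (hψ i) hX, dd_fst_sub]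
          simp
        have e2 : pointSum P.pos (fun n => P.burgers n 2)
            (fun x => 1 / 2 * dd (0, 1) (fun x => (x.2 - c.2) * ψ i x) x) =
            1 / 2 * pointSum P.pos (fun n => P.burgers n 2) (ψ i) := by
          rw [← pointSum_const_mul]
          refine P.pointSum_congr fun k => ?_
          rw [dd_mul_cutoff_pos (hψ i) hY, dd_snd_sub]
          simp
        change (_ + _) + (_ + _) = _
        rw [e1, e2]
        ring
      have hlim := (hb 2).add (tendsto_pointSum_cutoff (P.burgers_summable 2) hR hRU hψ)
      simp only [neg_add_cancel] at hlim
      -- The moments depend only on the germ of the cutoff at the defect, so this sequence, which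
      -- tends to zero, is constant.
      have hconst : ∀ i, (∫ x, (planarBurgers P.e c h 1 2 x * dx (ψ i) x -
            planarBurgers P.e c h 0 2 x * dy (ψ i) x)) +
          pointSum P.pos (fun n => P.burgers n 2) (ψ i) =
          2 * T 0 (fun x => (x.1 - (P.pos n).1) * ψ 0 x) := by
        intro i
        have g : T 0 (fun x => (x.1 - (P.pos n).1) * ψ 0 x) =
            T 0 (fun x => (x.1 - (P.pos n).1) * ψ i x) := by
          refine (hB 0).toIsLin.congr_germ (hv 0) ((ht 0).mul_left (contDiff_fst_sub _))
            ((ht i).mul_left (contDiff_fst_sub _)) ?_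
          filter_upwards [(hψ 0).one, (hψ i).one] with x h0 hi
          rw [h0, hi]
        have m := (mom i).2.2.2.2
        rw [← hsum i, g, two_mul]
        exact congrArg₂ (· + ·) rfl m.symm
      simp_rw [hconst] at hlim
      have hz : T 0 (fun x => (x.1 - (P.pos n).1) * ψ 0 x) = 0 := by
        have := tendsto_nhds_unique tendsto_const_nhds hlim
        linarith
      obtain ⟨a1, a2, a3, a4, a5⟩ := mom 0
      intro i
      fin_cases i
      · exact (hB 0).vanishes_of_affine (hv 0) (ht 0) (hψ 0).one a1 hz a3
      · exact (hB 1).vanishes_of_affine (hv 1) (ht 0) (hψ 0).one a2 a4 (a5.symm.trans hz))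
  exact ⟨key 0 u hu, key 1 u hu⟩

/-- The Frank vectors are vertical. -/
theorem frank_horizontal (n : P.N) : P.frank n 0 = 0 ∧ P.frank n 1 = 0 := by
  obtain ⟨R, hR, hRU⟩ := Metric.isOpen_iff.1 P.isOpen _ (P.pos_mem n)
  obtain ⟨ψ, hψ, hf, -⟩ := P.exists_cutoffs n hR
  have ht := fun i => (P.cutoff_test_mono hR hψ i).mono hRU
  have h0 := hf 0
  have h1 := hf 1
  -- On a cutoff the point sources of the shear vanish, so the pairing with the Frank tensor is the
  -- shear defect, which is zero for every cutoff; so is its limit, minus the Frank component.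
  simp_rw [integral_frank_x (hψ _), ← P.shearDefect_of_vanishing (cutoff_dd_pos (hψ _) _),
    (P.shear_strain (ht _)).2] at h0
  simp_rw [integral_frank_y (hψ _), ← P.shearDefect_of_vanishing (cutoff_dd_pos (hψ _) _),
    (P.shear_strain (ht _)).1] at h1
  have z0 := tendsto_nhds_unique tendsto_const_nhds h0
  have z1 := tendsto_nhds_unique tendsto_const_nhds h1
  constructor <;> linarith

/-- The planar incompatibility with its point sources removed. -/
def planeDefect (u : Plane → ℝ) : ℝ :=
  (planeIncompatibility P.e u - pointSum P.pos (fun n => P.frank n 2) u) +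
    ((pointSum P.pos (fun n => P.burgers n 1) (fun x => 1 * dx u x) +
      pointSum P.pos (fun n => P.frank n 2) (fun x => (x.1 - c.1) * dx u x)) -
    (pointSum P.pos (fun n => P.burgers n 0) (fun x => 1 * dy u x) -
      pointSum P.pos (fun n => P.frank n 2) (fun x => (x.2 - c.2) * dy u x)))

theorem isTame_planeDefect : IsTame U P.planeDefect :=
  (P.isTame_planeIncompatibility.fun_sub (isTame_pointSum (P.frank_summable 2))).fun_add
    (((isTame_pointSum_dd (P.burgers_summable 1) contDiff_const _).fun_add
      (isTame_pointSum_dd (P.frank_summable 2) (contDiff_fst_sub c.1) _)).fun_sub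
    ((isTame_pointSum_dd (P.burgers_summable 0) contDiff_const _).fun_sub
      (isTame_pointSum_dd (P.frank_summable 2) (contDiff_snd_sub c.2) _)))

/-- The planar incompatibility is produced by the wedge components of the Frank vectors and the
edge components of the Burgers vectors. -/
theorem plane_strain {u : Plane → ℝ} (hu : IsTest U u) : P.planeDefect u = 0 := by
  have hT := P.isTame_planeDefect
  have key := vanishes_of_removable P.isOpen P.countable_range P.isOpen_compl
    (fun _ : Unit => hT.toIsLin)
    (by
      intro _ u hu
      have h0 : ∀ n, u (P.pos n) = 0 := fun n =>
        image_eq_zero_of_notMem_tsupport fun h' => (hu.3 h').2 ⟨n, rfl⟩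
      have hd : ∀ w n, dd w u (P.pos n) = 0 := fun w n =>
        image_eq_zero_of_notMem_tsupport fun h' => ((hu.dd w).3 h').2 ⟨n, rfl⟩
      have := P.compatible_zz u hu
      simp [planeDefect, pointSum, h0, hd, this])
    (by
      rintro - ⟨n, rfl⟩ R hR hRU hv -
      replace hv := hv ()
      obtain ⟨ψ, hψ, hf, hb⟩ := P.exists_cutoffs n hR
      have ht := P.cutoff_test_mono hR hψ
      have hB := hT.mono hRU
      have hX := contDiff_fst_sub c.1
      have hY := contDiff_snd_sub c.2
      -- This disposes of the depth terms in the pairings with the Burgers tensor.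
      have hshear : ∀ i, shearIncompatibility P.e (1, 0) (ψ i) = 0 ∧
          shearIncompatibility P.e (0, 1) (ψ i) = 0 := by
        intro i
        have := P.shear_strain ((ht i).mono hRU)
        rwa [P.shearDefect_of_vanishing (cutoff_dd_pos (hψ i) _),
          P.shearDefect_of_vanishing (cutoff_dd_pos (hψ i) _)] at this
      have hconst : ∀ q : Plane → ℝ, ContDiff ℝ ∞ q → ∀ i,
          P.planeDefect (fun x => q x * ψ i x) = P.planeDefect (fun x => q x * ψ 0 x) := by
        intro q hq i
        refine hB.toIsLin.congr_germ hv ((ht i).mul_left hq) ((ht 0).mul_left hq) ?_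
        filter_upwards [(hψ 0).one, (hψ i).one] with x h0 hi
        rw [h0, hi]
      -- The jumps of `ω_z`, `b_y` and `b_x` give the moments against `1`, `x` and `y` respectively:
      -- each pairing plus its sources tends to zero, and up to sign equals a moment independent of
      -- the cutoff.
      have c1 : P.planeDefect (ψ 0) = 0 := by
        have hlim := (hf 2).add (tendsto_pointSum_cutoff (P.frank_summable 2) hR hRU hψ)
        simp only [neg_add_cancel] at hlim
        have e : ∀ i, (∫ x, (planarFrank P.e 1 2 x * dx (ψ i) x -
            planarFrank P.e 0 2 x * dy (ψ i) x)) + pointSum P.pos (fun n => P.frank n 2) (ψ i) =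
            -P.planeDefect (ψ 0) := by
          intro i
          have hc := hconst (fun _ => 1) contDiff_const i
          simp only [one_mul] at hc
          rw [← hc, integral_frank_z (hψ i), planeDefect]
          simp only [pointSum, dx, dy, cutoff_dd_pos (hψ i), mul_zero, tsum_zero]
          ring
        simp_rw [e] at hlim
        have := tendsto_nhds_unique tendsto_const_nhds hlim
        linarith
      have c2 : P.planeDefect (fun x => (x.1 - c.1) * ψ 0 x) = 0 := by
        have hlim := (hb 1).add (tendsto_pointSum_cutoff (P.burgers_summable 1) hR hRU hψ)
        simp only [neg_add_cancel] at hlim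
        have e : ∀ i, (∫ x, (planarBurgers P.e c h 1 1 x * dx (ψ i) x -
            planarBurgers P.e c h 0 1 x * dy (ψ i) x)) +
            pointSum P.pos (fun n => P.burgers n 1) (ψ i) =
            P.planeDefect (fun x => (x.1 - c.1) * ψ 0 x) := by
          intro i
          rw [← hconst _ hX i, integral_burgers_y (hψ i), planeDefect, (hshear i).2]
          simp only [pointSum, dx, dy, dd_mul_cutoff_pos (hψ i) hX, dd_fst_sub, one_mul, zero_mul,
            mul_zero, tsum_zero]
          ring
        simp_rw [e] at hlim
        exact tendsto_nhds_unique tendsto_const_nhds hlim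
      have c3 : P.planeDefect (fun x => (x.2 - c.2) * ψ 0 x) = 0 := by
        have hlim := (hb 0).add (tendsto_pointSum_cutoff (P.burgers_summable 0) hR hRU hψ)
        simp only [neg_add_cancel] at hlim
        have e : ∀ i, (∫ x, (planarBurgers P.e c h 1 0 x * dx (ψ i) x -
            planarBurgers P.e c h 0 0 x * dy (ψ i) x)) +
            pointSum P.pos (fun n => P.burgers n 0) (ψ i) =
            -P.planeDefect (fun x => (x.2 - c.2) * ψ 0 x) := by
          intro i
          rw [← hconst _ hY i, integral_burgers_x (hψ i), planeDefect, (hshear i).1]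
          simp only [pointSum, dx, dy, dd_mul_cutoff_pos (hψ i) hY, dd_snd_sub, one_mul, zero_mul,
            mul_zero, tsum_zero]
          ring
        simp_rw [e] at hlim
        have := tendsto_nhds_unique tendsto_const_nhds hlim
        linarith
      refine hB.vanishes_of_affine hv (ht 0) (hψ 0).one c1 ?_ ?_
      · rw [shift_moment hB.toIsLin (ht 0) contDiff_fst _ c.1 c1, c2]
      · rw [shift_moment hB.toIsLin (ht 0) contDiff_snd _ c.2 c1, c3])
  exact key () u hu

end PlanarCrystal

end PlanarIncompatibility

/-! ### Product test functions in space -/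

section SpaceTools

/-- The point of horizontal position `p` and height `z`. -/
def mkPt (p : Plane) (z : ℝ) : Space := !₂[p.1, p.2, z]

/-- The horizontal position of a point. -/
def proj (x : Space) : Plane := (x 0, x 1)

/-- The product function `u(x, y) χ(z)`. -/
def tens (u : Plane → ℝ) (χ : ℝ → ℝ) (x : Space) : ℝ := u (proj x) * χ (x 2)

@[simp] theorem mkPt_zero (p : Plane) (z : ℝ) : mkPt p z 0 = p.1 := rfl
@[simp] theorem mkPt_one (p : Plane) (z : ℝ) : mkPt p z 1 = p.2 := rfl
@[simp] theorem mkPt_two (p : Plane) (z : ℝ) : mkPt p z 2 = z := rfl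
@[simp] theorem proj_mkPt (p : Plane) (z : ℝ) : proj (mkPt p z) = p := rfl

theorem space_ext {x y : Space} (h0 : x 0 = y 0) (h1 : x 1 = y 1) (h2 : x 2 = y 2) : x = y := by
  ext i
  fin_cases i <;> assumption

@[simp] theorem mkPt_proj (x : Space) : mkPt (proj x) (x 2) = x := space_ext rfl rfl rfl

theorem contDiff_coord (i : Fin 3) : ContDiff ℝ ∞ fun x : Space => x i :=
  (EuclideanSpace.proj (𝕜 := ℝ) i).contDiff

theorem continuous_proj : Continuous proj := by
  unfold proj
  fun_prop

theorem contDiff_mkPt : ContDiff ℝ ∞ fun q : Plane × ℝ => mkPt q.1 q.2 := by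
  rw [contDiff_euclidean]
  intro i
  fin_cases i
  · exact contDiff_fst.comp contDiff_fst
  · exact contDiff_snd.comp contDiff_fst
  · exact contDiff_snd

theorem continuous_mkPt : Continuous fun q : Plane × ℝ => mkPt q.1 q.2 := contDiff_mkPt.continuous

theorem isometry_mkPt (p : Plane) : Isometry (mkPt p) := by
  refine Isometry.of_dist_eq fun a b => ?_
  rw [EuclideanSpace.dist_eq, Fin.sum_univ_three]
  simp [Real.dist_eq, Real.sqrt_sq_eq_abs]

/-- Space as the product of the horizontal plane and the vertical axis. -/
def spaceHomeo : Space ≃ₜ Plane × ℝ where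
  toFun x := (proj x, x 2)
  invFun q := mkPt q.1 q.2
  left_inv x := mkPt_proj x
  right_inv _ := rfl
  continuous_toFun := by
    have := continuous_proj
    fun_prop
  continuous_invFun := continuous_mkPt

theorem measurePreserving_spaceHomeo :
    MeasurePreserving spaceHomeo (volume : Measure Space) (volume : Measure (Plane × ℝ)) := by
  have h1 := PiLp.volume_preserving_ofLp (Fin 3)
  have h2 := volume_preserving_piFinSuccAbove (fun _ : Fin 3 => ℝ) 2
  have h3 := (MeasurePreserving.id (volume : Measure ℝ)).prod (volume_preserving_finTwoArrow ℝ)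
  have h4 : MeasurePreserving (Prod.swap : ℝ × Plane → Plane × ℝ) volume volume :=
    Measure.measurePreserving_swap
  exact ((h4.comp h3).comp h2).comp h1

theorem integral_spaceHomeo (f : Plane × ℝ → ℝ) : ∫ x, f (spaceHomeo x) = ∫ q, f q :=
  measurePreserving_spaceHomeo.integral_comp spaceHomeo.measurableEmbedding f

theorem integral_tens (f : Plane → ℝ) (χ : ℝ → ℝ) :
    ∫ x, tens f χ x = (∫ p, f p) * ∫ z, χ z := by
  rw [← integral_prod_mul f χ]
  exact integral_spaceHomeo fun q => f q.1 * χ q.2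

theorem ae_proj_notMem {S : Set Plane} (hS : S.Countable) : ∀ᵐ x : Space, proj x ∉ S := by
  have h : (volume : Measure (Plane × ℝ)) (S ×ˢ Set.univ) = 0 := by
    rw [Measure.volume_eq_prod, Measure.prod_prod, hS.measure_zero, zero_mul]
  have h2 := measurePreserving_spaceHomeo.quasiMeasurePreserving.preimage_null h
  rw [ae_iff]
  convert h2 using 2
  ext x
  simp only [not_not, Set.mem_ofPred_eq, Set.mem_preimage, Set.mem_prod, Set.mem_univ, and_true]
  rfl

/-- The projection to the plane as a continuous linear map. -/
def projL : Space →L[ℝ] Plane :=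
  (EuclideanSpace.proj (𝕜 := ℝ) (0 : Fin 3)).prod (EuclideanSpace.proj (𝕜 := ℝ) (1 : Fin 3))

theorem contDiff_tens {u : Plane → ℝ} {χ : ℝ → ℝ} (hu : ContDiff ℝ ∞ u) (hχ : ContDiff ℝ ∞ χ) :
    ContDiff ℝ ∞ (tens u χ) :=
  (hu.comp projL.contDiff).mul (hχ.comp (contDiff_coord 2))

theorem pd_tens {u : Plane → ℝ} {χ : ℝ → ℝ} (hu : ContDiff ℝ ∞ u) (hχ : ContDiff ℝ ∞ χ)
    (l : Fin 3) (x : Space) :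
    pd l (tens u χ) x = fderiv ℝ u (proj x) (proj (EuclideanSpace.single l 1)) * χ (x 2) +
      u (proj x) * (deriv χ (x 2) * (EuclideanSpace.single l (1 : ℝ) : Space) 2) := by
  have h1 : HasFDerivAt (fun x : Space => u (proj x)) _ x :=
    ((hu.differentiable (by simp) (proj x)).hasFDerivAt).comp x (projL.hasFDerivAt (x := x))
  have h2 : HasFDerivAt (fun x : Space => χ (x 2)) _ x :=
    ((hχ.differentiable (by simp) (x 2)).hasDerivAt).comp_hasFDerivAt x
      ((EuclideanSpace.proj (𝕜 := ℝ) (2 : Fin 3)).hasFDerivAt (x := x))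
  have h3 : fderiv ℝ (tens u χ) x = _ := (h1.mul h2).fderiv
  rw [pd, h3]
  simp only [add_apply, smul_apply,
    ContinuousLinearMap.comp_apply, smul_eq_mul]
  have e : projL (EuclideanSpace.single l 1) = proj (EuclideanSpace.single l 1) := rfl
  rw [e]
  simp
  ring

theorem pd_zero_tens {u : Plane → ℝ} {χ : ℝ → ℝ} (hu : ContDiff ℝ ∞ u) (hχ : ContDiff ℝ ∞ χ) :
    pd 0 (tens u χ) = tens (dx u) χ := by
  ext x
  rw [pd_tens hu hχ]
  simp [tens, dd, proj]

theorem pd_one_tens {u : Plane → ℝ} {χ : ℝ → ℝ} (hu : ContDiff ℝ ∞ u) (hχ : ContDiff ℝ ∞ χ) :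
    pd 1 (tens u χ) = tens (dy u) χ := by
  ext x
  rw [pd_tens hu hχ]
  simp [tens, dd, proj]

theorem pd_two_tens {u : Plane → ℝ} {χ : ℝ → ℝ} (hu : ContDiff ℝ ∞ u) (hχ : ContDiff ℝ ∞ χ) :
    pd 2 (tens u χ) = tens u (deriv χ) := by
  ext x
  rw [pd_tens hu hχ]
  have : ((0 : ℝ), (0 : ℝ)) = (0 : Plane) := rfl
  simp [tens, proj, this]

/-- The box `U × J` is contained in `A`. -/
def BoxIn (U : Set Plane) (J : Set ℝ) (A : Set Space) : Prop := ∀ p ∈ U, ∀ z ∈ J, mkPt p z ∈ A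

theorem IsTest.tens {U : Set Plane} {J : Set ℝ} {A : Set Space} (hA : BoxIn U J A)
    {u : Plane → ℝ} {χ : ℝ → ℝ} (hu : IsTest U u) (hχ : IsTest J χ) : IsTest A (tens u χ) := by
  have hK : IsCompact ((fun q : Plane × ℝ => mkPt q.1 q.2) '' (tsupport u ×ˢ tsupport χ)) :=
    (hu.2.isCompact.prod hχ.2.isCompact).image continuous_mkPt
  have hs : Function.support (Crystal.tens u χ) ⊆
      (fun q : Plane × ℝ => mkPt q.1 q.2) '' (tsupport u ×ˢ tsupport χ) := by
    intro x hx
    refine ⟨(proj x, x 2), ⟨subset_tsupport _ fun h => hx ?_, subset_tsupport _ fun h => hx ?_⟩,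
      mkPt_proj x⟩
    · simp [Crystal.tens, h]
    · simp [Crystal.tens, h]
  refine ⟨contDiff_tens hu.1 hχ.1, HasCompactSupport.of_support_subset_isCompact hK hs,
    (closure_minimal hs hK.isClosed).trans ?_⟩
  rintro _ ⟨q, hq, rfl⟩
  exact hA _ (hu.3 hq.1) _ (hχ.3 hq.2)

theorem IsTest.deriv {J : Set ℝ} {χ : ℝ → ℝ} (hχ : IsTest J χ) : IsTest J (deriv χ) := hχ.dd 1

theorem IsTest.integral_deriv {J : Set ℝ} {χ : ℝ → ℝ} (hχ : IsTest J χ) :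
    ∫ z, _root_.deriv χ z = 0 := by
  have := hχ.mono (Set.subset_univ J) |>.integral_mul_dd isOpen_univ (μ := volume)
    (contDiffOn_const (c := (1 : ℝ))) (1 : ℝ)
  have e : Crystal.dd (1 : ℝ) (fun _ : ℝ => (1 : ℝ)) = 0 := by ext; simp [Crystal.dd]
  rw [e] at this
  simpa [Crystal.dd] using this

theorem exists_box {A : Set Space} (hA : IsOpen A) {x : Space} (hx : x ∈ A) :
    ∃ r > 0, BoxIn (Metric.ball (proj x) r) (Metric.ball (x 2) r) A := by
  have hA' : IsOpen ((fun q : Plane × ℝ => mkPt q.1 q.2) ⁻¹' A) := hA.preimage continuous_mkPt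
  obtain ⟨r, hr, hb⟩ := Metric.isOpen_iff.1 hA' (proj x, x 2) (by simpa using hx)
  refine ⟨r, hr, fun p hp z hz => ?_⟩
  have : (p, z) ∈ Metric.ball (proj x, x 2) r := by
    rw [← ball_prod_same]
    exact ⟨hp, hz⟩
  exact hb this

/-- A continuous function that is orthogonal to all product test functions vanishes. -/
theorem eq_zero_of_integral_tens {U : Set Space} {f : Space → ℝ} (hU : IsOpen U)
    (hf : ContinuousOn f U) {x : Space} (hx : x ∈ U) {r : ℝ} (hr : 0 < r)
    (h : ∀ u χ, IsTest (Metric.ball (proj x) r) u → IsTest (Metric.ball (x 2) r) χ →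
      ∫ y, f y * tens u χ y = 0) : f x = 0 := by
  wlog hpos : 0 < f x generalizing f
  · rcases (not_lt.1 hpos).lt_or_eq with hlt | heq
    · have := this (f := fun y => -f y) hf.neg (fun u χ hu hχ => by
        simp only [neg_mul]
        rw [integral_neg, h u χ hu hχ, neg_zero]) (by simpa using hlt)
      simpa using this
    · exact heq
  exfalso
  have hV : IsOpen (U ∩ f ⁻¹' Set.Ioi 0) := hf.isOpen_inter_preimage hU isOpen_Ioi
  obtain ⟨s, hs, hsb⟩ := exists_box hV (x := x) ⟨hx, hpos⟩
  set t := min r s with ht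
  have ht0 : 0 < t := lt_min hr hs
  let u : ContDiffBump (proj x) := ⟨t / 4, t / 2, by linarith, by linarith⟩
  let χ : ContDiffBump (x 2) := ⟨t / 4, t / 2, by linarith, by linarith⟩
  have hu : ∀ q, t ≤ q → IsTest (Metric.ball (proj x) q) (u : Plane → ℝ) := fun q hq =>
    ⟨u.contDiff, u.hasCompactSupport, by
      rw [u.tsupport_eq]
      exact Metric.closedBall_subset_ball (by change t / 2 < q; linarith)⟩
  have hχ : ∀ q, t ≤ q → IsTest (Metric.ball (x 2) q) (χ : ℝ → ℝ) := fun q hq =>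
    ⟨χ.contDiff, χ.hasCompactSupport, by
      rw [χ.tsupport_eq]
      exact Metric.closedBall_subset_ball (by change t / 2 < q; linarith)⟩
  -- A product bump supported in a box where `f` is positive has positive integral against `f`,
  -- contradicting orthogonality.
  have hT := (hu s (min_le_right _ _)).tens hsb (hχ s (min_le_right _ _))
  have hcont : Continuous fun y => f y * tens u χ y := by
    rw [continuous_iff_continuousAt]
    intro y
    by_cases hy : y ∈ tsupport (tens u χ)
    · exact (hf.continuousAt (hU.mem_nhds (hT.3 hy).1)).mul hT.continuous.continuousAt
    · have h' : (fun y => f y * tens u χ y) =ᶠ[𝓝 y] fun _ => 0 := by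
        filter_upwards [notMem_tsupport_iff_eventuallyEq.1 hy] with z hz
        simp [hz]
      exact continuousAt_const.congr h'.symm
  have hpos' : 0 < ∫ y, f y * tens u χ y := by
    refine hcont.integral_pos_of_hasCompactSupport_nonneg_nonzero hT.2.mul_left (fun y => ?_)
      (x := x) ?_
    · by_cases hy : y ∈ tsupport (tens u χ)
      · exact mul_nonneg (le_of_lt (hT.3 hy).2) (mul_nonneg u.nonneg χ.nonneg)
      · simp [image_eq_zero_of_notMem_tsupport hy]
    · have h1 : u (proj x) = 1 := u.one_of_mem_closedBall (Metric.mem_closedBall_self u.rIn_pos.le)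
      have h2 : χ (x 2) = 1 := χ.one_of_mem_closedBall (Metric.mem_closedBall_self χ.rIn_pos.le)
      simp [tens, h1, h2, hpos.ne']
  exact hpos'.ne' (h _ _ (hu r (min_le_left _ _)) (hχ r (min_le_left _ _)))

end SpaceTools

/-! ### Defect lines and strain in a box -/

section Section

variable {Ω : Set Space} {x₀ : Space}

theorem isTest_iff {A : Set Space} {φ : Space → ℝ} : IsTest A φ ↔ IsTestFunction A φ :=
  ⟨fun h => ⟨h.1, h.2, h.3⟩, fun h => ⟨h.1, h.2.1, h.2.2⟩⟩

namespace Mesoscopic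

variable (M : Mesoscopic Ω x₀)

/-- The union of the defect lines. -/
def defects : Set Space := ⋃ n, M.line n

theorem isOpen_compl_defects (hΩ : IsOpen Ω) : IsOpen (Ω \ M.defects) := by
  obtain ⟨F, hF, h⟩ := M.closed
  rw [defects, h, show Ω \ (F ∩ Ω) = Ω ∩ Fᶜ by ext; simp]
  exact hΩ.inter hF.isOpen_compl

theorem proj_eq_of_mem_line {n : M.I} {y y' : Space} (hy : y ∈ M.line n) (hy' : y' ∈ M.line n) :
    proj y = proj y' := by
  obtain ⟨x, -, hL⟩ := M.isVerticalLine n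
  rw [hL] at hy hy'
  have h := connectedComponentIn_subset _ _ hy
  have h' := connectedComponentIn_subset _ _ hy'
  exact Prod.ext (h.2.1.trans h'.2.1.symm) (h.2.2.trans h'.2.2.symm)

/-- A line is the component of the vertical section through any of its points. -/
theorem line_eq {n : M.I} {y : Space} (hy : y ∈ M.line n) :
    M.line n = connectedComponentIn {w | w ∈ Ω ∧ w 0 = y 0 ∧ w 1 = y 1} y := by
  obtain ⟨x, -, hL⟩ := M.isVerticalLine n
  rw [hL] at hy ⊢
  have h := connectedComponentIn_subset _ _ hy
  rw [connectedComponentIn_eq hy]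
  have e0 : y 0 = x 0 := h.2.1
  have e1 : y 1 = x 1 := h.2.2
  simp only [e0, e1]

variable {U : Set Plane} {J : Set ℝ}

/-- The segment `{p} × J` is connected and inside `Ω`, so it lies in a single component of the
vertical section: a line meeting it contains it. -/
theorem mkPt_mem_line (hbox : BoxIn U J Ω) (hJ : IsPreconnected J) {n : M.I} {p : Plane}
    (hp : p ∈ U) {z z' : ℝ} (hz : z ∈ J) (hz' : z' ∈ J) (h : mkPt p z ∈ M.line n) :
    mkPt p z' ∈ M.line n := by
  rw [M.line_eq h]
  have hpre : IsPreconnected (mkPt p '' J) := hJ.image _ (isometry_mkPt p).continuous.continuousOn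
  refine hpre.subset_connectedComponentIn ⟨z, hz, rfl⟩ ?_ ⟨z', hz', rfl⟩
  rintro _ ⟨w, hw, rfl⟩
  exact ⟨hbox p hp w hw, rfl, rfl⟩

/-- The index set of the lines that meet the box with central section `U × {z₀}`. -/
def boxIndex (U : Set Plane) (z₀ : ℝ) : Set M.I := {n | ∃ p ∈ U, mkPt p z₀ ∈ M.line n}

/-- The horizontal position of a line that meets the box. -/
def boxPos (U : Set Plane) (z₀ : ℝ) (n : M.boxIndex U z₀) : Plane := n.2.choose

variable {z₀ : ℝ}

theorem boxPos_mem (n : M.boxIndex U z₀) : M.boxPos U z₀ n ∈ U := n.2.choose_spec.1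

theorem mkPt_boxPos_mem (n : M.boxIndex U z₀) : mkPt (M.boxPos U z₀ n) z₀ ∈ M.line n :=
  n.2.choose_spec.2

/-- Distinct lines may lie above one another in `Ω`, but at height `z₀` two lines over the same
position share a point and so are the same component. -/
theorem boxPos_injective : Function.Injective (M.boxPos U z₀) := by
  intro n m h
  have h1 := M.line_eq (M.mkPt_boxPos_mem n)
  have h2 := M.line_eq (M.mkPt_boxPos_mem m)
  rw [h] at h1
  exact Subtype.ext (M.line_injective (h1.trans h2.symm))

theorem mem_boxIndex (hbox : BoxIn U J Ω) (hJ : IsPreconnected J) (hz₀ : z₀ ∈ J) {n : M.I}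
    {p : Plane} (hp : p ∈ U) {z : ℝ} (hz : z ∈ J) (h : mkPt p z ∈ M.line n) :
    n ∈ M.boxIndex U z₀ :=
  ⟨p, hp, M.mkPt_mem_line hbox hJ hp hz hz₀ h⟩

theorem boxPos_eq {n : M.boxIndex U z₀} {p : Plane} {z : ℝ} (h : mkPt p z ∈ M.line n) :
    M.boxPos U z₀ n = p :=
  M.proj_eq_of_mem_line (M.mkPt_boxPos_mem n) h

theorem notMem_defects (hbox : BoxIn U J Ω) (hJ : IsPreconnected J) (hz₀ : z₀ ∈ J) {p : Plane}
    (hp : p ∈ U \ Set.range (M.boxPos U z₀)) {z : ℝ} (hz : z ∈ J) : mkPt p z ∉ M.defects := by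
  intro h
  obtain ⟨n, hn⟩ := Set.mem_iUnion.1 h
  exact hp.2 ⟨⟨n, M.mem_boxIndex hbox hJ hz₀ hp.1 hz hn⟩, M.boxPos_eq hn⟩

theorem boxIn_compl (hbox : BoxIn U J Ω) (hJ : IsPreconnected J) (hz₀ : z₀ ∈ J) :
    BoxIn (U \ Set.range (M.boxPos U z₀)) J (Ω \ M.defects) :=
  fun p hp z hz => ⟨hbox p hp.1 z hz, M.notMem_defects hbox hJ hz₀ hp hz⟩

theorem isOpen_boxCompl (hΩ : IsOpen Ω) (hU : IsOpen U) (hbox : BoxIn U J Ω)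
    (hJ : IsPreconnected J) (hz₀ : z₀ ∈ J) : IsOpen (U \ Set.range (M.boxPos U z₀)) := by
  have hc : Continuous fun p : Plane => mkPt p z₀ :=
    continuous_mkPt.comp (continuous_id.prodMk continuous_const)
  have : U \ Set.range (M.boxPos U z₀) = U ∩ (fun p => mkPt p z₀) ⁻¹' (Ω \ M.defects) := by
    ext p
    constructor
    · exact fun hp => ⟨hp.1, M.boxIn_compl hbox hJ hz₀ p hp z₀ hz₀⟩
    · rintro ⟨hp, h⟩
      refine ⟨hp, ?_⟩
      rintro ⟨n, rfl⟩
      exact h.2 (Set.mem_iUnion.2 ⟨n, M.mkPt_boxPos_mem n⟩)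
  rw [this]
  exact hU.inter ((M.isOpen_compl_defects hΩ).preimage hc)

theorem countable_boxPos : (Set.range (M.boxPos U z₀)).Countable := Set.countable_range _

/-- The strain does not depend on `z`, pointwise off the defects. -/
theorem pd_two_strain (hΩ : IsOpen Ω) (i j : Fin 3) {x : Space} (hx : x ∈ Ω \ M.defects) :
    pd 2 (M.strain i j) x = 0 := by
  have hV := M.isOpen_compl_defects hΩ
  have hs : ContDiffOn ℝ ∞ (M.strain i j) (Ω \ M.defects) := M.strain_smooth i j
  obtain ⟨r, hr, hb⟩ := exists_box hV hx
  refine eq_zero_of_integral_tens hV (dd_smoothOn hV hs _).continuousOn hx hr fun u χ hu hχ => ?_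
  have hT := hu.tens hb hχ
  have h := hT.integral_mul_dd (μ := volume) hV hs (EuclideanSpace.single 2 1)
  have h0 := M.strain_z i j _ (isTest_iff.1 (hT.mono Set.sdiff_subset))
  change ∫ x, M.strain i j x * pd 2 (tens u χ) x = _ at h
  rw [h0] at h
  linarith

/-- The strain in the section at height `z₀`. -/
def boxStrain (z₀ : ℝ) (i j : Fin 3) (p : Plane) : ℝ := M.strain i j (mkPt p z₀)

/-- Over a point off the defects the whole segment avoids them, and the vertical derivative vanishes
along it. -/
theorem strain_mkPt (hΩ : IsOpen Ω) (hbox : BoxIn U J Ω) (hJo : IsOpen J) (hJ : IsPreconnected J)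
    (hz₀ : z₀ ∈ J) (i j : Fin 3) {p : Plane} (hp : p ∈ U \ Set.range (M.boxPos U z₀)) {z : ℝ}
    (hz : z ∈ J) : M.strain i j (mkPt p z) = M.boxStrain z₀ i j p := by
  have hV := M.isOpen_compl_defects hΩ
  have hs : ContDiffOn ℝ ∞ (M.strain i j) (Ω \ M.defects) := M.strain_smooth i j
  have hd : ∀ w ∈ J, HasDerivAt (fun z => M.strain i j (mkPt p z)) 0 w := by
    intro w hw
    have hmem := M.boxIn_compl hbox hJ hz₀ p hp w hw
    have h1 := ((hs.contDiffAt (hV.mem_nhds hmem)).differentiableAt (by simp)).hasFDerivAt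
    have h2 : HasDerivAt (mkPt p) (EuclideanSpace.single 2 1 : Space) w := by
      have e : mkPt p = fun z => mkPt p 0 + z • (EuclideanSpace.single 2 1 : Space) := by
        ext z i
        fin_cases i <;> simp [mkPt]
      rw [e]
      simpa using ((hasDerivAt_id w).smul_const (EuclideanSpace.single 2 1 : Space)).const_add
        (mkPt p 0)
    have h3 := h1.comp_hasDerivAt w h2
    have h4 := M.pd_two_strain hΩ i j hmem
    rw [pd] at h4
    rwa [h4] at h3
  exact hJo.is_const_of_deriv_eq_zero hJ
    (fun w hw => (hd w hw).differentiableAt.differentiableWithinAt)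
    (fun w hw => (hd w hw).deriv) hz hz₀

theorem ae_strain_eq (hΩ : IsOpen Ω) (hbox : BoxIn U J Ω) (hJo : IsOpen J) (hJ : IsPreconnected J)
    (hz₀ : z₀ ∈ J) (i j : Fin 3) :
    ∀ᵐ x : Space, proj x ∈ U → x 2 ∈ J → M.strain i j x = M.boxStrain z₀ i j (proj x) := by
  filter_upwards [ae_proj_notMem (M.countable_boxPos (U := U) (z₀ := z₀))] with x hx hU hz
  rw [← M.strain_mkPt hΩ hbox hJo hJ hz₀ i j ⟨hU, hx⟩ hz, mkPt_proj]

/-- Pairing of the strain with product functions. -/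
theorem integral_strain_tens (hΩ : IsOpen Ω) (hbox : BoxIn U J Ω) (hJo : IsOpen J)
    (hJ : IsPreconnected J) (hz₀ : z₀ ∈ J) (i j : Fin 3) {v : Plane → ℝ} {χ : ℝ → ℝ}
    (hv : IsTest U v) (hχ : IsTest J χ) :
    ∫ x, M.strain i j x * tens v χ x = (∫ p, M.boxStrain z₀ i j p * v p) * ∫ z, χ z := by
  rw [← integral_tens]
  refine integral_congr_ae ?_
  filter_upwards [M.ae_strain_eq hΩ hbox hJo hJ hz₀ i j] with x hx
  by_cases h1 : proj x ∈ U
  · by_cases h2 : x 2 ∈ J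
    · rw [hx h1 h2]
      simp [tens, mul_assoc]
    · have : χ (x 2) = 0 := image_eq_zero_of_notMem_tsupport fun h' => h2 (hχ.3 h')
      simp [tens, this]
  · have : v (proj x) = 0 := image_eq_zero_of_notMem_tsupport fun h' => h1 (hv.3 h')
    simp [tens, this]

theorem exists_Icc_subset (hJo : IsOpen J) (hz₀ : z₀ ∈ J) :
    ∃ a b : ℝ, a < b ∧ Set.Icc a b ⊆ J := by
  obtain ⟨δ, hδ, hb⟩ := Metric.isOpen_iff.1 hJo z₀ hz₀
  refine ⟨z₀ - δ / 2, z₀ + δ / 2, by linarith, fun w hw => hb ?_⟩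
  rw [Metric.mem_ball, Real.dist_eq, abs_lt]
  constructor <;> linarith [hw.1, hw.2]

/-- The box `K × [a, b]`. -/
def closedBox (K : Set Plane) (a b : ℝ) : Set Space :=
  (fun q : Plane × ℝ => mkPt q.1 q.2) '' (K ×ˢ Set.Icc a b)

theorem isCompact_closedBox {K : Set Plane} (hK : IsCompact K) (a b : ℝ) :
    IsCompact (closedBox K a b) := (hK.prod isCompact_Icc).image continuous_mkPt

theorem closedBox_subset (hbox : BoxIn U J Ω) {K : Set Plane} (hK : K ⊆ U) {a b : ℝ}
    (hab : Set.Icc a b ⊆ J) : closedBox K a b ⊆ Ω := by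
  rintro _ ⟨q, hq, rfl⟩
  exact hbox _ (hK hq.1) _ (hab hq.2)

/-- On `K × [a, b]` the strain is almost everywhere a function of the horizontal position, so by
Fubini its integral in `z` is integrable on `K`; this is `b - a` times the section. -/
theorem boxStrain_locallyIntegrable (hΩ : IsOpen Ω) (hU : IsOpen U) (hbox : BoxIn U J Ω)
    (hJo : IsOpen J) (hJ : IsPreconnected J) (hz₀ : z₀ ∈ J) (i j : Fin 3) :
    LocallyIntegrableOn (M.boxStrain z₀ i j) U := by
  rw [locallyIntegrableOn_iff hU.isLocallyClosed]
  intro K hKU hK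
  obtain ⟨a, b, hab, hJab⟩ := exists_Icc_subset hJo hz₀
  have h1 : IntegrableOn (M.strain i j) (closedBox K a b) :=
    (M.strain_locallyIntegrable i j).integrableOn_compact_subset (closedBox_subset hbox hKU hJab)
      (isCompact_closedBox hK a b)
  have hpre : closedBox K a b = spaceHomeo ⁻¹' (K ×ˢ Set.Icc a b) := by
    ext x
    constructor
    · rintro ⟨q, hq, rfl⟩
      exact hq
    · intro hx
      exact ⟨spaceHomeo x, hx, mkPt_proj x⟩
  have h2 : IntegrableOn (fun x => M.boxStrain z₀ i j (proj x)) (closedBox K a b) := by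
    refine h1.congr ?_
    filter_upwards [ae_restrict_of_ae (M.ae_strain_eq hΩ hbox hJo hJ hz₀ i j),
      ae_restrict_mem (isCompact_closedBox hK a b).measurableSet] with x hx hm
    rw [hpre] at hm
    exact hx (hKU hm.1) (hJab hm.2)
  have h3 : IntegrableOn (fun q : Plane × ℝ => M.boxStrain z₀ i j q.1) (K ×ˢ Set.Icc a b) := by
    rw [hpre] at h2
    exact (measurePreserving_spaceHomeo.integrableOn_comp_preimage
      spaceHomeo.measurableEmbedding).1 h2
  rw [IntegrableOn, Measure.volume_eq_prod, ← Measure.prod_restrict] at h3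
  have h4 := h3.integral_prod_left
  simp only [integral_const, smul_eq_mul] at h4
  have hne : (volume.restrict (Set.Icc a b)).real Set.univ ≠ 0 := by
    have : 0 < b - a := by linarith
    simp [Measure.real, ENNReal.toReal_ofReal this.le, this.ne']
  have h5 := h4.const_mul ((volume.restrict (Set.Icc a b)).real Set.univ)⁻¹
  refine h5.congr (Eventually.of_forall fun p => ?_)
  simp only
  rw [← mul_assoc, inv_mul_cancel₀ hne, one_mul]

theorem hausdorff_line_inter (hbox : BoxIn U J Ω) (hJ : IsPreconnected J) (hz₀ : z₀ ∈ J)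
    {K : Set Plane} {a b : ℝ} (hab : a < b) (hJab : Set.Icc a b ⊆ J)
    (n : M.boxIndex U z₀) (hn : M.boxPos U z₀ n ∈ K) :
    (μH[1] (M.line n ∩ closedBox K a b)).toReal = b - a := by
  have : M.line n ∩ closedBox K a b = mkPt (M.boxPos U z₀ n) '' Set.Icc a b := by
    ext y
    constructor
    · rintro ⟨hy, q, hq, rfl⟩
      exact ⟨q.2, hq.2, by rw [M.boxPos_eq hy]⟩
    · rintro ⟨z, hz, rfl⟩
      exact ⟨M.mkPt_mem_line hbox hJ (M.boxPos_mem n) hz₀ (hJab hz) (M.mkPt_boxPos_mem n),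
        ⟨(_, z), ⟨hn, hz⟩, rfl⟩⟩
  rw [this, (isometry_mkPt _).hausdorffMeasure_image (Or.inl zero_le_one), hausdorffMeasure_real,
    Real.volume_Icc, ENNReal.toReal_ofReal (by linarith)]

/-- Every line over `K` has the same length `b - a` in the box `K × [a, b]`, which can be divided
out of the Radon bound. -/
theorem locSummable_of_radon (hbox : BoxIn U J Ω) (hJo : IsOpen J) (hJ : IsPreconnected J)
    (hz₀ : z₀ ∈ J) {m : M.I → ℝ}
    (hm : ∀ K ⊆ Ω, IsCompact K → Summable fun n => |m n| * (μH[1] (M.line n ∩ K)).toReal) :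
    LocSummable U (M.boxPos U z₀) fun n => m n := by
  intro K hKU hK
  obtain ⟨a, b, hab, hJab⟩ := exists_Icc_subset hJo hz₀
  have h1 := ((hm _ (closedBox_subset hbox hKU hJab) (isCompact_closedBox hK a b)).comp_injective
    (Subtype.val_injective (p := (· ∈ M.boxIndex U z₀)))).mul_right (b - a)⁻¹
  have hba : 0 < b - a := by linarith
  refine Summable.of_nonneg_of_le (fun n => Set.indicator_nonneg (fun _ _ => abs_nonneg _) _)
    (fun n => ?_) h1
  by_cases hn : M.boxPos U z₀ n ∈ K
  · rw [Set.indicator_of_mem hn]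
    simp only [Function.comp]
    rw [M.hausdorff_line_inter hbox hJ hz₀ hab hJab n hn, mul_assoc, mul_inv_cancel₀ hba.ne',
      mul_one]
  · rw [Set.indicator_of_notMem hn]
    simp only [Function.comp]
    positivity

/-- Integrals of product functions along the lines. -/
theorem integral_line_tens (hbox : BoxIn U J Ω) (hJ : IsPreconnected J)
    (hz₀ : z₀ ∈ J) {v : Plane → ℝ} {χ : ℝ → ℝ} (hχ : IsTest J χ)
    (n : M.boxIndex U z₀) :
    ∫ x in M.line n, tens v χ x ∂μH[1] = v (M.boxPos U z₀ n) * ∫ z, χ z := by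
  set p := M.boxPos U z₀ n with hp
  have hsub : M.line n ⊆ Set.range (mkPt p) := by
    intro y hy
    refine ⟨y 2, ?_⟩
    have : p = proj y := M.proj_eq_of_mem_line (M.mkPt_boxPos_mem n) hy
    rw [this, mkPt_proj]
  have hm : MeasurableSet (Set.range (mkPt p)) :=
    (isometry_mkPt p).isClosedEmbedding.isClosed_range.measurableSet
  -- The integral may be taken over the full vertical line: the points outside `M.line n` have
  -- height outside `J`, where `χ` vanishes.
  rw [← setIntegral_eq_of_subset_of_forall_sdiff_eq_zero hm hsub]
  · rw [← (isometry_mkPt p).map_hausdorffMeasure (Or.inl zero_le_one),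
      (isometry_mkPt p).isClosedEmbedding.measurableEmbedding.integral_map, hausdorffMeasure_real,
      ← integral_const_mul]
    rfl
  · rintro _ ⟨⟨z, rfl⟩, hz⟩
    have hzJ : z ∉ J := fun h' => hz (M.mkPt_mem_line hbox hJ (M.boxPos_mem n) hz₀ h'
      (M.mkPt_boxPos_mem n))
    have : χ z = 0 := image_eq_zero_of_notMem_tsupport fun h' => hzJ (hχ.3 h')
    simp [tens, this]

theorem integral_line_tens_of_notMem (hbox : BoxIn U J Ω) (hJ : IsPreconnected J)
    (hz₀ : z₀ ∈ J) {v : Plane → ℝ} {χ : ℝ → ℝ} (hv : IsTest U v) (hχ : IsTest J χ)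
    {n : M.I} (hn : n ∉ M.boxIndex U z₀) : ∫ x in M.line n, tens v χ x ∂μH[1] = 0 := by
  have hz : ∀ x ∈ M.line n, tens v χ x = 0 := by
    intro x hx
    by_contra hne
    have h1 : proj x ∈ U := hv.3 (subset_tsupport _ fun h' => hne (by simp [tens, h']))
    have h2 : x 2 ∈ J := hχ.3 (subset_tsupport _ fun h' => hne (by simp [tens, h']))
    refine hn (M.mem_boxIndex hbox hJ hz₀ h1 h2 ?_)
    rwa [mkPt_proj]
  exact setIntegral_eq_zero_of_forall_eq_zero hz

theorem tsum_line_tens (hbox : BoxIn U J Ω) (hJ : IsPreconnected J)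
    (hz₀ : z₀ ∈ J) {v : Plane → ℝ} {χ : ℝ → ℝ} (hv : IsTest U v) (hχ : IsTest J χ)
    (m : M.I → ℝ) (t : ℝ) :
    ∑' n, m n * t * ∫ x in M.line n, tens v χ x ∂μH[1] =
      t * pointSum (M.boxPos U z₀) (fun n => m n) v * ∫ z, χ z := by
  have hs : Function.support (fun n => m n * t * ∫ x in M.line n, tens v χ x ∂μH[1]) ⊆
      M.boxIndex U z₀ := by
    intro n hn
    by_contra h'
    exact hn (by simp only [M.integral_line_tens_of_notMem hbox hJ hz₀ hv hχ h', mul_zero])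
  rw [← tsum_subtype_eq_of_support_subset hs, pointSum, ← tsum_mul_left, ← tsum_mul_right]
  congr 1
  ext n
  rw [M.integral_line_tens hbox hJ hz₀ hχ n]
  ring

end Mesoscopic

end Section

/-! ### The horizontal section as a planar crystal -/

section BoxCrystal

theorem exists_unit_test {J : Set ℝ} (hJo : IsOpen J) {z₀ : ℝ} (hz₀ : z₀ ∈ J) :
    ∃ χ, IsTest J χ ∧ ∫ z, χ z = 1 := by
  obtain ⟨δ, hδ, hb⟩ := Metric.isOpen_iff.1 hJo z₀ hz₀
  let β : ContDiffBump z₀ := ⟨δ / 4, δ / 2, by linarith, by linarith⟩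
  refine ⟨β.normed volume, ⟨β.contDiff_normed, β.hasCompactSupport_normed, ?_⟩, β.integral_normed⟩
  rw [β.tsupport_normed_eq]
  exact (Metric.closedBall_subset_ball (by change δ / 2 < δ; linarith)).trans hb

/-- The horizontal embedding of the plane. -/
def horizL : Plane →L[ℝ] Space :=
  (ContinuousLinearMap.fst ℝ ℝ ℝ).smulRight (EuclideanSpace.single 0 1) +
    (ContinuousLinearMap.snd ℝ ℝ ℝ).smulRight (EuclideanSpace.single 1 1)

theorem hasFDerivAt_mkPt (z : ℝ) (q : Plane) :
    HasFDerivAt (fun p : Plane => mkPt p z) horizL q := by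
  have e : (fun p : Plane => mkPt p z) = fun p => mkPt 0 z + horizL p := by
    ext p i
    fin_cases i <;> simp [mkPt, horizL]
  rw [e]
  exact horizL.hasFDerivAt.const_add _

theorem circlePoint_mkPt (p : Plane) (z r θ : ℝ) :
    circlePoint (mkPt p z) r θ = mkPt (circlePt p r θ) z := by
  refine space_ext ?_ ?_ ?_ <;> simp [circlePoint, circlePt]

theorem circulation_mkPt (T : TensorField) (p : Plane) (z r : ℝ) (k : Fin 3) :
    circulation T (mkPt p z) r k =
      circ (fun q => T 0 k (mkPt q z)) (fun q => T 1 k (mkPt q z)) p r := by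
  simp only [circulation, circ, circlePoint_mkPt]

variable {Ω : Set Space} {x₀ : Space}

namespace Mesoscopic

variable (M : Mesoscopic Ω x₀) {U : Set Plane} {J : Set ℝ} {z₀ : ℝ}

theorem boxStrain_smooth (hbox : BoxIn U J Ω) (hJ : IsPreconnected J)
    (hz₀ : z₀ ∈ J) (i j : Fin 3) :
    ContDiffOn ℝ ∞ (M.boxStrain z₀ i j) (U \ Set.range (M.boxPos U z₀)) := by
  have hm : ContDiff ℝ ∞ fun p : Plane => mkPt p z₀ :=
    contDiff_mkPt.comp (contDiff_id.prodMk contDiff_const)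
  exact (M.strain_smooth i j).comp hm.contDiffOn
    fun p hp => M.boxIn_compl hbox hJ hz₀ p hp z₀ hz₀

theorem pd_strain_mkPt (hΩ : IsOpen Ω) (hbox : BoxIn U J Ω)
    (hJ : IsPreconnected J) (hz₀ : z₀ ∈ J) (i j : Fin 3) {p : Plane}
    (hp : p ∈ U \ Set.range (M.boxPos U z₀)) :
    pd 0 (M.strain i j) (mkPt p z₀) = dx (M.boxStrain z₀ i j) p ∧
      pd 1 (M.strain i j) (mkPt p z₀) = dy (M.boxStrain z₀ i j) p ∧
      pd 2 (M.strain i j) (mkPt p z₀) = 0 := by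
  have hV := M.isOpen_compl_defects hΩ
  have hs : ContDiffOn ℝ ∞ (M.strain i j) (Ω \ M.defects) := M.strain_smooth i j
  have hmem := M.boxIn_compl hbox hJ hz₀ p hp z₀ hz₀
  have h1 := ((hs.contDiffAt (hV.mem_nhds hmem)).differentiableAt (by simp)).hasFDerivAt
  have h2 : fderiv ℝ (M.boxStrain z₀ i j) p = _ := (h1.comp p (hasFDerivAt_mkPt z₀ p)).fderiv
  refine ⟨?_, ?_, M.pd_two_strain hΩ i j hmem⟩
  · simp [pd, dd, h2, horizL]
  · simp [pd, dd, h2, horizL]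

theorem frankTensor_mkPt (hΩ : IsOpen Ω) (hbox : BoxIn U J Ω)
    (hJ : IsPreconnected J) (hz₀ : z₀ ∈ J) (m k : Fin 3) {p : Plane}
    (hp : p ∈ U \ Set.range (M.boxPos U z₀)) :
    frankTensor M.strain m k (mkPt p z₀) = planarFrank (M.boxStrain z₀) m k p := by
  have h := fun i => M.pd_strain_mkPt hΩ hbox hJ hz₀ i m hp
  simp only [frankTensor, Fin.sum_univ_three, (h _).1, (h _).2.1, (h _).2.2, planarFrank, eps]
  fin_cases k <;> simp <;> ring

theorem burgersTensor_mkPt (hΩ : IsOpen Ω) (hbox : BoxIn U J Ω)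
    (hJ : IsPreconnected J) (hz₀ : z₀ ∈ J) (l k : Fin 3) {p : Plane}
    (hp : p ∈ U \ Set.range (M.boxPos U z₀)) :
    burgersTensor M.strain x₀ l k (mkPt p z₀) =
      planarBurgers (M.boxStrain z₀) (proj x₀) (z₀ - x₀ 2) l k p := by
  have h := fun q => M.frankTensor_mkPt hΩ hbox hJ hz₀ l q hp
  simp only [burgersTensor, Fin.sum_univ_three, h, planarBurgers, eps]
  fin_cases k <;> simp [boxStrain, proj] <;> ring

/-- Circles that are good in the plane lift at height `z₀` to circles avoiding the defects in space,
so the limit over planar radii runs along a finer filter. -/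
theorem hasJump_of_isJump (hbox : BoxIn U J Ω) (hJ : IsPreconnected J) (hz₀ : z₀ ∈ J)
    {T : TensorField} {V : Fin 3 → ℝ} (n : M.boxIndex U z₀)
    (h : IsJump (Ω \ ⋃ m, M.line m) (M.line n) T V) (k : Fin 3) :
    HasJump (U \ Set.range (M.boxPos U z₀)) (fun q => T 0 k (mkPt q z₀))
      (fun q => T 1 k (mkPt q z₀)) (M.boxPos U z₀ n) (V k) := by
  have h1 := h _ (M.mkPt_boxPos_mem n) k
  simp only [circulation_mkPt] at h1
  refine h1.mono_left (nhdsWithin_mono _ fun r hr => ⟨hr.1, fun θ => ?_⟩)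
  rw [circlePoint_mkPt]
  exact M.boxIn_compl hbox hJ hz₀ _ (hr.2 θ) z₀ hz₀

theorem integral_strain_pd_two (hbox : BoxIn U J Ω) {u : Plane → ℝ} {χ : ℝ → ℝ}
    (hu : IsTest U u) (hχ : IsTest J χ) (i j q : Fin 3) :
    ∫ x, M.strain i j x * pd 2 (pd q (tens u χ)) x = 0 ∧
      ∫ x, M.strain i j x * pd q (pd 2 (tens u χ)) x = 0 := by
  have hT := hu.tens hbox hχ
  have h1 := M.strain_z i j _ (isTest_iff.1 (hT.dd (EuclideanSpace.single q 1)))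
  refine ⟨h1, ?_⟩
  have e : pd q (pd 2 (tens u χ)) = pd 2 (pd q (tens u χ)) := dd_comm hT.1 _ _
  rw [e]
  exact h1

/-- All entries with a derivative in `z` vanish. The table `A` keeps the integrals opaque while the
permutation symbols are contracted. -/
theorem incompatibility_tens (hbox : BoxIn U J Ω) {u : Plane → ℝ} {χ : ℝ → ℝ}
    (hu : IsTest U u) (hχ : IsTest J χ)
    {A : Fin 3 → Fin 3 → Fin 3 → Fin 3 → ℝ}
    (hA : ∀ p q m n, ∫ x, M.strain m n x * pd p (pd q (tens u χ)) x = A p q m n) :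
    incompatibility M.strain 0 0 (tens u χ) = A 1 1 2 2 ∧
    incompatibility M.strain 1 1 (tens u χ) = A 0 0 2 2 ∧
    incompatibility M.strain 1 0 (tens u χ) = -A 0 1 2 2 ∧
    incompatibility M.strain 1 2 (tens u χ) = -(A 0 0 2 1 - A 0 1 2 0) ∧
    incompatibility M.strain 0 2 (tens u χ) = A 1 0 2 1 - A 1 1 2 0 ∧
    incompatibility M.strain 2 2 (tens u χ) =
      (A 0 0 1 1 - A 0 1 1 0) - (A 1 0 0 1 - A 1 1 0 0) := by
  have h1 : ∀ q m n, A 2 q m n = 0 := fun q m n => by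
    rw [← hA, (M.integral_strain_pd_two hbox hu hχ m n q).1]
  have h2 : ∀ q m n, A q 2 m n = 0 := fun q m n => by
    rw [← hA, (M.integral_strain_pd_two hbox hu hχ m n q).2]
  simp only [incompatibility, Fin.sum_univ_three, hA, h1, h2, eps]
  refine ⟨?_, ?_, ?_, ?_, ?_, ?_⟩ <;> simp <;> ring

theorem integral_strain_pd_pd (hΩ : IsOpen Ω) (hbox : BoxIn U J Ω) (hJo : IsOpen J)
    (hJ : IsPreconnected J) (hz₀ : z₀ ∈ J) {u : Plane → ℝ} {χ : ℝ → ℝ}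
    (hu : IsTest U u) (hχ : IsTest J χ) (i j : Fin 3) :
    ∫ x, M.strain i j x * pd 0 (pd 0 (tens u χ)) x =
      (∫ p, M.boxStrain z₀ i j p * dx (dx u) p) * ∫ z, χ z ∧
    ∫ x, M.strain i j x * pd 0 (pd 1 (tens u χ)) x =
      (∫ p, M.boxStrain z₀ i j p * dx (dy u) p) * ∫ z, χ z ∧
    ∫ x, M.strain i j x * pd 1 (pd 0 (tens u χ)) x =
      (∫ p, M.boxStrain z₀ i j p * dy (dx u) p) * ∫ z, χ z ∧
    ∫ x, M.strain i j x * pd 1 (pd 1 (tens u χ)) x =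
      (∫ p, M.boxStrain z₀ i j p * dy (dy u) p) * ∫ z, χ z := by
  rw [pd_zero_tens hu.1 hχ.1, pd_one_tens hu.1 hχ.1, pd_zero_tens (dd_smooth hu.1 _) hχ.1,
    pd_one_tens (dd_smooth hu.1 _) hχ.1, pd_zero_tens (dd_smooth hu.1 _) hχ.1,
    pd_one_tens (dd_smooth hu.1 _) hχ.1]
  exact ⟨M.integral_strain_tens hΩ hbox hJo hJ hz₀ i j ((hu.dd _).dd _) hχ,
    M.integral_strain_tens hΩ hbox hJo hJ hz₀ i j ((hu.dd _).dd _) hχ,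
    M.integral_strain_tens hΩ hbox hJo hJ hz₀ i j ((hu.dd _).dd _) hχ,
    M.integral_strain_tens hΩ hbox hJo hJ hz₀ i j ((hu.dd _).dd _) hχ⟩

/-- Tested on `u χ` with `∫ χ = 1`, the components `yy`, `xx`, `xy`, `yz`, `xz`, `zz` of the spatial
compatibility become the planar conditions. -/
theorem box_compatible (hΩ : IsOpen Ω) (hbox : BoxIn U J Ω) (hJo : IsOpen J)
    (hJ : IsPreconnected J) (hz₀ : z₀ ∈ J) {u : Plane → ℝ}
    (hu : IsTest (U \ Set.range (M.boxPos U z₀)) u) :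
    ∫ p, M.boxStrain z₀ 2 2 p * dx (dx u) p = 0 ∧ ∫ p, M.boxStrain z₀ 2 2 p * dx (dy u) p = 0 ∧
    ∫ p, M.boxStrain z₀ 2 2 p * dy (dy u) p = 0 ∧
    shearIncompatibility (M.boxStrain z₀) (1, 0) u = 0 ∧
    shearIncompatibility (M.boxStrain z₀) (0, 1) u = 0 ∧
    planeIncompatibility (M.boxStrain z₀) u = 0 := by
  obtain ⟨χ, hχ, h1⟩ := exists_unit_test hJo hz₀
  have hu' := hu.mono Set.sdiff_subset
  have hT := isTest_iff.1 (hu.tens (M.boxIn_compl hbox hJ hz₀) hχ)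
  have hc := fun k l => M.compatible k l _ hT
  obtain ⟨e1, e2, e3, e4, e5, e6⟩ := M.incompatibility_tens hbox hu' hχ fun p q m n => rfl
  have hi := fun i j => M.integral_strain_pd_pd hΩ hbox hJo hJ hz₀ hu' hχ i j
  rw [hc] at e1 e2 e3 e4 e5 e6
  simp only [(hi _ _).1, (hi _ _).2.1, (hi _ _).2.2.1, (hi _ _).2.2.2, h1, mul_one] at e1 e2 e3 e4 e5 e6
  have hxy : dy (dx u) = dx (dy u) := dd_comm hu.1 _ _
  refine ⟨e2.symm, ?_, e1.symm, ?_, ?_, ?_⟩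
  · linarith
  · rw [shearIncompatibility]
    change _ - ∫ x, M.boxStrain z₀ 2 0 x * dy (dx u) x = 0
    rw [hxy]
    linarith
  · rw [shearIncompatibility]
    change (∫ x, M.boxStrain z₀ 2 1 x * dx (dy u) x) - _ = 0
    rw [← hxy]
    linarith
  · rw [planeIncompatibility]
    linarith

/-- The section of a mesoscopic crystal by a horizontal plane, in a box. -/
def boxCrystal (hΩ : IsOpen Ω) (hU : IsOpen U) (hbox : BoxIn U J Ω) (hJo : IsOpen J)
    (hJ : IsPreconnected J) (hz₀ : z₀ ∈ J) : PlanarCrystal U (proj x₀) (z₀ - x₀ 2) where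
  N := M.boxIndex U z₀
  countable := inferInstance
  pos := M.boxPos U z₀
  pos_injective := M.boxPos_injective
  pos_mem := M.boxPos_mem
  isOpen := hU
  isOpen_compl := M.isOpen_boxCompl hΩ hU hbox hJ hz₀
  e := M.boxStrain z₀
  locallyIntegrable := M.boxStrain_locallyIntegrable hΩ hU hbox hJo hJ hz₀
  smooth := M.boxStrain_smooth hbox hJ hz₀
  symm i j p hp := M.strain_symm i j _ (M.boxIn_compl hbox hJ hz₀ p hp z₀ hz₀)
  compatible_xx _ hu := (M.box_compatible hΩ hbox hJo hJ hz₀ hu).1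
  compatible_xy _ hu := (M.box_compatible hΩ hbox hJo hJ hz₀ hu).2.1
  compatible_yy _ hu := (M.box_compatible hΩ hbox hJo hJ hz₀ hu).2.2.1
  compatible_xz _ hu := (M.box_compatible hΩ hbox hJo hJ hz₀ hu).2.2.2.1
  compatible_yz _ hu := (M.box_compatible hΩ hbox hJo hJ hz₀ hu).2.2.2.2.1
  compatible_zz _ hu := (M.box_compatible hΩ hbox hJo hJ hz₀ hu).2.2.2.2.2
  frank n := M.frank n
  burgers n := M.burgers n
  frank_summable j := M.locSummable_of_radon (m := fun n => M.frank n j) hbox hJo hJ hz₀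
    fun K hK hc => M.frank_radon K hK hc j
  burgers_summable j := M.locSummable_of_radon (m := fun n => M.burgers n j) hbox hJo hJ hz₀
    fun K hK hc => M.burgers_radon K hK hc j
  frank_jump n k := (M.hasJump_of_isJump hbox hJ hz₀ n (M.frank_isJump n) k).congr
    (fun _ hp => M.frankTensor_mkPt hΩ hbox hJ hz₀ 0 k hp)
    (fun _ hp => M.frankTensor_mkPt hΩ hbox hJ hz₀ 1 k hp)
  burgers_jump n k := (M.hasJump_of_isJump hbox hJ hz₀ n (M.burgers_isJump n) k).congr
    (fun _ hp => M.burgersTensor_mkPt hΩ hbox hJ hz₀ 0 k hp)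
    (fun _ hp => M.burgersTensor_mkPt hΩ hbox hJ hz₀ 1 k hp)

end Mesoscopic

end BoxCrystal

/-! ### Linear laws of a crystal against product test functions -/

section BoxLaws

variable {Ω : Set Space} {x₀ : Space}

namespace Mesoscopic

variable (M : Mesoscopic Ω x₀) {U : Set Plane} {J : Set ℝ} {z₀ : ℝ}

theorem disclination_tens (hbox : BoxIn U J Ω) (hJ : IsPreconnected J) (hz₀ : z₀ ∈ J)
    {v : Plane → ℝ} {χ : ℝ → ℝ} (hv : IsTest U v) (hχ : IsTest J χ) (i j : Fin 3) :
    M.disclination i j (tens v χ) =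
      tangent i * pointSum (M.boxPos U z₀) (fun n => M.frank n j) v * ∫ z, χ z :=
  M.tsum_line_tens hbox hJ hz₀ hv hχ (fun n => M.frank n j) (tangent i)

theorem dislocation_tens (hbox : BoxIn U J Ω) (hJ : IsPreconnected J) (hz₀ : z₀ ∈ J)
    {v : Plane → ℝ} {χ : ℝ → ℝ} (hv : IsTest U v) (hχ : IsTest J χ) (i j : Fin 3) :
    M.dislocation i j (tens v χ) =
      tangent i * pointSum (M.boxPos U z₀) (fun n => M.burgers n j) v * ∫ z, χ z :=
  M.tsum_line_tens hbox hJ hz₀ hv hχ (fun n => M.burgers n j) (tangent i)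

theorem disclination_of_ne {i : Fin 3} (hi : i ≠ 2) (j : Fin 3) (φ : Space → ℝ) :
    M.disclination i j φ = 0 := by
  simp [disclination, tangent, kron, hi]

theorem dislocation_of_ne {i : Fin 3} (hi : i ≠ 2) (j : Fin 3) (φ : Space → ℝ) :
    M.dislocation i j φ = 0 := by
  simp [dislocation, tangent, kron, hi]

/-- Each line crosses the box with constant weight, and `∫ χ' = 0`. In the limit this makes `Θ` and
`Λ` independent of `z`. -/
theorem density_pd_two (hbox : BoxIn U J Ω) (hJ : IsPreconnected J) (hz₀ : z₀ ∈ J)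
    {u : Plane → ℝ} {χ : ℝ → ℝ} (hu : IsTest U u) (hχ : IsTest J χ) (i j : Fin 3) :
    M.disclination i j (pd 2 (tens u χ)) = 0 ∧ M.dislocation i j (pd 2 (tens u χ)) = 0 := by
  rw [pd_two_tens hu.1 hχ.1, M.disclination_tens hbox hJ hz₀ hu hχ.deriv,
    M.dislocation_tens hbox hJ hz₀ hu hχ.deriv, hχ.integral_deriv]
  simp

theorem strainMeasure_symm (hΩ : IsOpen Ω) (hbox : BoxIn U J Ω) (hJo : IsOpen J)
    (hJ : IsPreconnected J) (hz₀ : z₀ ∈ J) {u : Plane → ℝ} {χ : ℝ → ℝ} (hu : IsTest U u)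
    (hχ : IsTest J χ) (i j : Fin 3) :
    M.strainMeasure i j (tens u χ) = M.strainMeasure j i (tens u χ) := by
  rw [strainMeasure, strainMeasure, M.integral_strain_tens hΩ hbox hJo hJ hz₀ i j hu hχ,
    M.integral_strain_tens hΩ hbox hJo hJ hz₀ j i hu hχ]
  congr 1
  refine integral_congr_ae ?_
  have hS := M.countable_boxPos (U := U) (z₀ := z₀)
  filter_upwards [compl_mem_ae_iff.2 (hS.measure_zero volume)] with p hp
  by_cases hpU : p ∈ U
  · have := M.strain_symm i j _ (M.boxIn_compl hbox hJ hz₀ p ⟨hpU, hp⟩ z₀ hz₀)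
    simp only [boxStrain, this]
  · have : u p = 0 := image_eq_zero_of_notMem_tsupport fun h => hpU (hu.3 h)
    simp [this]

theorem disclination_horizontal (hΩ : IsOpen Ω) (hU : IsOpen U) (hbox : BoxIn U J Ω)
    (hJo : IsOpen J) (hJ : IsPreconnected J) (hz₀ : z₀ ∈ J) {u : Plane → ℝ} {χ : ℝ → ℝ}
    (hu : IsTest U u) (hχ : IsTest J χ) :
    M.disclination 2 0 (tens u χ) = 0 ∧ M.disclination 2 1 (tens u χ) = 0 := by
  have h := (M.boxCrystal hΩ hU hbox hJo hJ hz₀).frank_horizontal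
  have h0 : ∀ n : M.boxIndex U z₀, M.frank n 0 = 0 := fun n => (h n).1
  have h1 : ∀ n : M.boxIndex U z₀, M.frank n 1 = 0 := fun n => (h n).2
  rw [M.disclination_tens hbox hJ hz₀ hu hχ, M.disclination_tens hbox hJ hz₀ hu hχ]
  simp [pointSum, h0, h1]

theorem vertical_strain (hΩ : IsOpen Ω) (hU : IsOpen U) (hbox : BoxIn U J Ω)
    (hJo : IsOpen J) (hJ : IsPreconnected J) (hz₀ : z₀ ∈ J) {u : Plane → ℝ} {χ : ℝ → ℝ}
    (hu : IsTest U u) (hχ : IsTest J χ) :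
    M.strainMeasure 2 2 (pd 0 (pd 0 (tens u χ))) = 0 ∧
    M.strainMeasure 2 2 (pd 0 (pd 1 (tens u χ))) = 0 ∧
    M.strainMeasure 2 2 (pd 1 (pd 1 (tens u χ))) = 0 := by
  obtain ⟨h1, h2, h3⟩ := (M.boxCrystal hΩ hU hbox hJo hJ hz₀).vertical_strain hu
  obtain ⟨e1, e2, -, e4⟩ := M.integral_strain_pd_pd hΩ hbox hJo hJ hz₀ hu hχ 2 2
  exact ⟨e1.trans (mul_eq_zero_of_left h1 _), e2.trans (mul_eq_zero_of_left h2 _),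
    e4.trans (mul_eq_zero_of_left h3 _)⟩

/-- The planar law rewritten through the strain and dislocation measures alone: in this form it
mentions no individual line and passes to weak limits. -/
theorem shear_strain (hΩ : IsOpen Ω) (hU : IsOpen U) (hbox : BoxIn U J Ω)
    (hJo : IsOpen J) (hJ : IsPreconnected J) (hz₀ : z₀ ∈ J) {u : Plane → ℝ} {χ : ℝ → ℝ}
    (hu : IsTest U u) (hχ : IsTest J χ) {w : Fin 3} (hw : w ≠ 2) :
    M.strainMeasure 2 1 (pd 0 (pd w (tens u χ))) - M.strainMeasure 2 0 (pd 1 (pd w (tens u χ))) +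
      1 / 2 * M.dislocation 2 2 (pd w (tens u χ)) = 0 := by
  obtain ⟨h1, h2⟩ := (M.boxCrystal hΩ hU hbox hJo hJ hz₀).shear_strain hu
  have hi := fun i j => M.integral_strain_pd_pd hΩ hbox hJo hJ hz₀ hu hχ i j
  rw [PlanarCrystal.shearDefect, shearIncompatibility, pointSum_const_mul] at h1 h2
  simp only [strainMeasure]
  fin_cases w
  · simp only [Fin.zero_eta, (hi _ _).1, (hi _ _).2.2.1]
    rw [pd_zero_tens hu.1 hχ.1, M.dislocation_tens hbox hJ hz₀ (hu.dd _) hχ]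
    refine Eq.trans ?_ (mul_eq_zero_of_left h1 (∫ z, χ z))
    simp only [tangent, kron, boxCrystal, if_true]
    ring
  · simp only [Fin.mk_one, (hi _ _).2.1, (hi _ _).2.2.2]
    rw [pd_one_tens hu.1 hχ.1, M.dislocation_tens hbox hJ hz₀ (hu.dd _) hχ]
    refine Eq.trans ?_ (mul_eq_zero_of_left h2 (∫ z, χ z))
    simp only [tangent, kron, boxCrystal, if_true]
    ring
  · exact absurd rfl hw

theorem plane_strain (hΩ : IsOpen Ω) (hU : IsOpen U) (hbox : BoxIn U J Ω)
    (hJo : IsOpen J) (hJ : IsPreconnected J) (hz₀ : z₀ ∈ J) {u : Plane → ℝ} {χ : ℝ → ℝ}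
    (hu : IsTest U u) (hχ : IsTest J χ) :
    M.strainMeasure 1 1 (pd 0 (pd 0 (tens u χ))) - M.strainMeasure 1 0 (pd 0 (pd 1 (tens u χ))) -
      M.strainMeasure 0 1 (pd 1 (pd 0 (tens u χ))) + M.strainMeasure 0 0 (pd 1 (pd 1 (tens u χ))) -
      M.disclination 2 2 (tens u χ) + M.dislocation 2 1 (pd 0 (tens u χ)) +
      M.disclination 2 2 (fun x => (x 0 - x₀ 0) * pd 0 (tens u χ) x) -
      M.dislocation 2 0 (pd 1 (tens u χ)) +
      M.disclination 2 2 (fun x => (x 1 - x₀ 1) * pd 1 (tens u χ) x) = 0 := by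
  have h := (M.boxCrystal hΩ hU hbox hJo hJ hz₀).plane_strain hu
  have hi := fun i j => M.integral_strain_pd_pd hΩ hbox hJo hJ hz₀ hu hχ i j
  rw [PlanarCrystal.planeDefect, planeIncompatibility] at h
  have e0 : (fun x : Space => (x 0 - x₀ 0) * pd 0 (tens u χ) x) =
      tens (fun p => (p.1 - (proj x₀).1) * dx u p) χ := by
    rw [pd_zero_tens hu.1 hχ.1]
    ext x
    simp only [tens, proj, mul_assoc]
  have e1 : (fun x : Space => (x 1 - x₀ 1) * pd 1 (tens u χ) x) =
      tens (fun p => (p.2 - (proj x₀).2) * dy u p) χ := by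
    rw [pd_one_tens hu.1 hχ.1]
    ext x
    simp only [tens, proj, mul_assoc]
  rw [e0, e1]
  simp only [strainMeasure, (hi _ _).1, (hi _ _).2.1, (hi _ _).2.2.1, (hi _ _).2.2.2]
  rw [pd_zero_tens hu.1 hχ.1, pd_one_tens hu.1 hχ.1,
    M.disclination_tens hbox hJ hz₀ hu hχ, M.dislocation_tens hbox hJ hz₀ (hu.dd _) hχ,
    M.dislocation_tens hbox hJ hz₀ (hu.dd _) hχ,
    M.disclination_tens hbox hJ hz₀ ((hu.dd _).mul_left (contDiff_fst_sub _)) hχ,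
    M.disclination_tens hbox hJ hz₀ ((hu.dd _).mul_left (contDiff_snd_sub _)) hχ]
  refine Eq.trans ?_ (mul_eq_zero_of_left h (∫ z, χ z))
  simp only [tangent, kron, boxCrystal, if_true, one_mul]
  ring

end Mesoscopic

end BoxLaws

/-! ### Pointwise laws of the macroscopic fields -/

/-- The laws satisfied by the macroscopic fields which are limits of mesoscopic crystals. -/
structure Macroscopic (Ω : Set Space) (x₀ : Space) (E Θ Λ : TensorField) : Prop where
  isOpen : IsOpen Ω
  smooth_strain : ∀ i j, ContDiffOn ℝ ∞ (E i j) Ω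
  smooth_disclination : ∀ i j, ContDiffOn ℝ ∞ (Θ i j) Ω
  smooth_dislocation : ∀ i j, ContDiffOn ℝ ∞ (Λ i j) Ω
  strain_symm : ∀ i j, Set.EqOn (E i j) (E j i) Ω
  strain_z : ∀ i j, ∀ x ∈ Ω, pd 2 (E i j) x = 0
  disclination_of_ne : ∀ i j, i ≠ 2 → ∀ x ∈ Ω, Θ i j x = 0
  dislocation_of_ne : ∀ i j, i ≠ 2 → ∀ x ∈ Ω, Λ i j x = 0
  disclination_horizontal : ∀ x ∈ Ω, Θ 2 0 x = 0 ∧ Θ 2 1 x = 0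
  disclination_z : ∀ i j, ∀ x ∈ Ω, pd 2 (Θ i j) x = 0
  dislocation_z : ∀ i j, ∀ x ∈ Ω, pd 2 (Λ i j) x = 0
  vertical : ∀ x ∈ Ω, pd 0 (pd 0 (E 2 2)) x = 0 ∧ pd 1 (pd 0 (E 2 2)) x = 0 ∧
    pd 1 (pd 1 (E 2 2)) x = 0
  shear : ∀ w, w ≠ 2 → ∀ x ∈ Ω,
    pd w (pd 0 (E 2 1)) x - pd w (pd 1 (E 2 0)) x - 1 / 2 * pd w (Λ 2 2) x = 0
  plane : ∀ x ∈ Ω,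
    pd 0 (pd 0 (E 1 1)) x - pd 1 (pd 0 (E 1 0)) x - pd 0 (pd 1 (E 0 1)) x + pd 1 (pd 1 (E 0 0)) x -
      Θ 2 2 x - pd 0 (Λ 2 1) x - pd 0 (fun y => (y 0 - x₀ 0) * Θ 2 2 y) x + pd 1 (Λ 2 0) x -
      pd 1 (fun y => (y 1 - x₀ 1) * Θ 2 2 y) x = 0

theorem pd_smoothOn {f : Space → ℝ} {Ω : Set Space} (hΩ : IsOpen Ω) (hf : ContDiffOn ℝ ∞ f Ω)
    (l : Fin 3) : ContDiffOn ℝ ∞ (pd l f) Ω :=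
  dd_smoothOn hΩ hf _

theorem hasFDerivAt_of_smoothOn {f : Space → ℝ} {Ω : Set Space} (hΩ : IsOpen Ω)
    (hf : ContDiffOn ℝ ∞ f Ω) {x : Space} (hx : x ∈ Ω) : HasFDerivAt f (fderiv ℝ f x) x :=
  ((hf.contDiffAt (hΩ.mem_nhds hx)).differentiableAt (by simp)).hasFDerivAt

theorem hasFDerivAt_coord_sub (x₀ x : Space) (b : Fin 3) :
    HasFDerivAt (fun y : Space => y b - x₀ b) (EuclideanSpace.proj (𝕜 := ℝ) b) x :=
  ((EuclideanSpace.proj (𝕜 := ℝ) b).hasFDerivAt (x := x)).sub_const _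

theorem proj_single_eq_kron (b l : Fin 3) :
    EuclideanSpace.proj (𝕜 := ℝ) b (EuclideanSpace.single l (1 : ℝ)) = kron b l := by
  simp [kron]

theorem pd_coord_sub_mul {f : Space → ℝ} {Ω : Set Space} (hΩ : IsOpen Ω)
    (hf : ContDiffOn ℝ ∞ f Ω) {x : Space} (hx : x ∈ Ω) (x₀ : Space) (b l : Fin 3) :
    pd l (fun y => (y b - x₀ b) * f y) x = (x b - x₀ b) * pd l f x + kron b l * f x := by
  rw [pd, ((hasFDerivAt_coord_sub x₀ x b).fun_mul (hasFDerivAt_of_smoothOn hΩ hf hx)).fderiv,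
    ← proj_single_eq_kron]
  simp [pd, mul_comm]

/-! ### Curls of the completed Frank and Burgers tensors -/

section Algebra

variable {Ω : Set Space} {x₀ : Space} {E Θ Λ : TensorField}

theorem smoothOn_frankTensor (hΩ : IsOpen Ω) (hE : ∀ i j, ContDiffOn ℝ ∞ (E i j) Ω)
    (j k : Fin 3) : ContDiffOn ℝ ∞ (frankTensor E j k) Ω :=
  ContDiffOn.sum fun p _ => ContDiffOn.sum fun q _ =>
    contDiffOn_const.mul (pd_smoothOn hΩ (hE q j) p)

theorem smoothOn_contortion (hΘ : ∀ i j, ContDiffOn ℝ ∞ (Θ i j) Ω)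
    (hΛ : ∀ i j, ContDiffOn ℝ ∞ (Λ i j) Ω) (i j : Fin 3) :
    ContDiffOn ℝ ∞ (contortion Θ Λ x₀ i j) Ω :=
  (contDiffOn_const.mul ((hΛ 2 j).sub (ContDiffOn.sum fun b _ =>
    (contDiffOn_const.mul (hΘ 2 2)).mul ((contDiff_coord b).contDiffOn.sub contDiffOn_const)))).sub
    ((contDiffOn_const.mul (hΛ 2 2)).mul contDiffOn_const)

theorem smoothOn_completedFrank (hΩ : IsOpen Ω) (hE : ∀ i j, ContDiffOn ℝ ∞ (E i j) Ω)
    (hΘ : ∀ i j, ContDiffOn ℝ ∞ (Θ i j) Ω) (hΛ : ∀ i j, ContDiffOn ℝ ∞ (Λ i j) Ω) (j k : Fin 3) :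
    ContDiffOn ℝ ∞ (completedFrank E Θ Λ x₀ j k) Ω :=
  (smoothOn_frankTensor hΩ hE j k).sub (smoothOn_contortion hΘ hΛ k j)

theorem pd_frankTensor (hΩ : IsOpen Ω) (hE : ∀ i j, ContDiffOn ℝ ∞ (E i j) Ω) {x : Space}
    (hx : x ∈ Ω) (l j k : Fin 3) :
    pd l (frankTensor E j k) x = ∑ p, ∑ q, eps k p q * pd l (pd p (E q j)) x := by
  have h : HasFDerivAt (frankTensor E j k)
      (∑ p, ∑ q, eps k p q • fderiv ℝ (pd p (E q j)) x) x :=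
    HasFDerivAt.fun_sum fun p _ => HasFDerivAt.fun_sum fun q _ =>
      (hasFDerivAt_of_smoothOn hΩ (pd_smoothOn hΩ (hE q j) p) hx).const_mul _
  rw [pd, h.fderiv]
  simp [pd]

theorem pd_contortion (hΩ : IsOpen Ω) (hΘ : ∀ i j, ContDiffOn ℝ ∞ (Θ i j) Ω)
    (hΛ : ∀ i j, ContDiffOn ℝ ∞ (Λ i j) Ω) {x : Space} (hx : x ∈ Ω) (l i j : Fin 3) :
    pd l (contortion Θ Λ x₀ i j) x =
      kron i 2 * (pd l (Λ 2 j) x -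
        ∑ b, eps 2 j b * (pd l (Θ 2 2) x * (x b - x₀ b) + Θ 2 2 x * kron b l)) -
      1 / 2 * pd l (Λ 2 2) x * kron i j := by
  have h1 := hasFDerivAt_of_smoothOn hΩ (hΘ 2 2) hx
  have h2 := fun j => hasFDerivAt_of_smoothOn hΩ (hΛ 2 j) hx
  have h := (((h2 j).sub (HasFDerivAt.fun_sum (u := Finset.univ) fun b _ =>
    (h1.const_mul (eps 2 j b)).mul (hasFDerivAt_coord_sub x₀ x b))).const_mul (kron i 2)).sub
    (((h2 2).const_mul (1 / 2)).mul_const (kron i j))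
  have e : pd l (contortion Θ Λ x₀ i j) x = _ := congrArg
    (fun L : Space →L[ℝ] ℝ => L (EuclideanSpace.single l 1)) h.fderiv
  rw [e]
  simp only [sub_apply, smul_apply,
    sum_apply, add_apply, smul_eq_mul,
    proj_single_eq_kron, pd]
  congr 1
  · congr 2
    refine Finset.sum_congr rfl fun b _ => ?_
    ring
  · ring

theorem pd_completedFrank (hΩ : IsOpen Ω) (hE : ∀ i j, ContDiffOn ℝ ∞ (E i j) Ω)
    (hΘ : ∀ i j, ContDiffOn ℝ ∞ (Θ i j) Ω) (hΛ : ∀ i j, ContDiffOn ℝ ∞ (Λ i j) Ω) {x : Space}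
    (hx : x ∈ Ω) (l j k : Fin 3) :
    pd l (completedFrank E Θ Λ x₀ j k) x =
      pd l (frankTensor E j k) x - pd l (contortion Θ Λ x₀ k j) x := by
  have h := (hasFDerivAt_of_smoothOn hΩ (smoothOn_frankTensor hΩ hE j k) hx).sub
    (hasFDerivAt_of_smoothOn hΩ (smoothOn_contortion (x₀ := x₀) hΘ hΛ k j) hx)
  exact congrArg (fun L : Space →L[ℝ] ℝ => L (EuclideanSpace.single l 1)) h.fderiv

theorem pd_completedBurgers (hΩ : IsOpen Ω) (hE : ∀ i j, ContDiffOn ℝ ∞ (E i j) Ω)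
    (hΘ : ∀ i j, ContDiffOn ℝ ∞ (Θ i j) Ω) (hΛ : ∀ i j, ContDiffOn ℝ ∞ (Λ i j) Ω) {x : Space}
    (hx : x ∈ Ω) (l j k : Fin 3) :
    pd l (completedBurgers E Θ Λ x₀ j k) x = pd l (E k j) x +
      ∑ p, ∑ q, eps k p q * (kron p l * completedFrank E Θ Λ x₀ j q x +
        (x p - x₀ p) * pd l (completedFrank E Θ Λ x₀ j q) x) := by
  have h1 := fun q =>
    hasFDerivAt_of_smoothOn hΩ (smoothOn_completedFrank (x₀ := x₀) hΩ hE hΘ hΛ j q) hx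
  have h := (hasFDerivAt_of_smoothOn hΩ (hE k j) hx).add
    (HasFDerivAt.fun_sum (u := Finset.univ) fun p _ =>
      HasFDerivAt.fun_sum (u := Finset.univ) fun q _ =>
      ((hasFDerivAt_coord_sub x₀ x p).const_mul (eps k p q)).mul (h1 q))
  have e : pd l (completedBurgers E Θ Λ x₀ j k) x = _ := congrArg
    (fun L : Space →L[ℝ] ℝ => L (EuclideanSpace.single l 1)) h.fderiv
  rw [e]
  simp only [smul_apply,
    sum_apply, add_apply, smul_eq_mul,
    proj_single_eq_kron, pd]
  congr 1
  refine Finset.sum_congr rfl fun p _ => Finset.sum_congr rfl fun q _ => ?_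
  ring

/-- The curl of the completed Burgers tensor, in terms of that of the completed Frank tensor. -/
theorem curl_completedBurgers (hΩ : IsOpen Ω) (hE : ∀ i j, ContDiffOn ℝ ∞ (E i j) Ω)
    (hΘ : ∀ i j, ContDiffOn ℝ ∞ (Θ i j) Ω) (hΛ : ∀ i j, ContDiffOn ℝ ∞ (Λ i j) Ω) {x : Space}
    (hx : x ∈ Ω) (i k : Fin 3) :
    curl (completedBurgers E Θ Λ x₀) i k x =
      (∑ l, ∑ j, eps i l j * (pd l (E k j) x +
        ∑ p, ∑ q, eps k p q * (kron p l * completedFrank E Θ Λ x₀ j q x))) +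
      ∑ p, ∑ q, eps k p q * ((x p - x₀ p) * curl (completedFrank E Θ Λ x₀) i q x) := by
  simp only [curl, pd_completedBurgers hΩ hE hΘ hΛ hx, Fin.sum_univ_three]
  ring

namespace Macroscopic

/-- Nothing depends on `z`, so only the row `i = z` is not immediate from the independence of `z`
and `vertical`. For horizontal `k` the term `-½ Λ_zz δ` of the contortion cancels the shear
incompatibility, in accordance with `Θ_zk = 0`; for `k = z` the curl is `η_zz - ∂_x κ_zy + ∂_y
κ_zx`, which is `Θ_zz` by the law `plane`. -/
theorem curl_completedFrank (h : Macroscopic Ω x₀ E Θ Λ) {x : Space} (hx : x ∈ Ω)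
    (i k : Fin 3) : Θ i k x = curl (completedFrank E Θ Λ x₀) i k x := by
  have hcomm : ∀ l p q j, pd l (pd p (E q j)) x = pd p (pd l (E q j)) x := fun l p q j =>
    dd_comm_at ((h.smooth_strain q j).contDiffAt (h.isOpen.mem_nhds hx)) _ _
  have hsymm : ∀ l p q j, pd l (pd p (E q j)) x = pd l (pd p (E j q)) x := fun l p q j =>
    dd_congr (dd_eventuallyEq ((h.strain_symm q j).eventuallyEq_of_mem (h.isOpen.mem_nhds hx)) _) _
  have hz : ∀ p q j, pd 2 (pd p (E q j)) x = 0 := fun p q j => by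
    rw [hcomm]
    have : pd 2 (E q j) =ᶠ[𝓝 x] fun _ => 0 :=
      Set.EqOn.eventuallyEq_of_mem (fun y hy => h.strain_z q j y hy) (h.isOpen.mem_nhds hx)
    rw [show pd p (pd 2 (E q j)) x = pd p (fun _ => 0) x from dd_congr this _]
    simp [pd]
  have hz' : ∀ p q j, pd p (pd 2 (E q j)) x = 0 := fun p q j => by rw [hcomm, hz]
  have hp := h.plane x hx
  rw [pd_coord_sub_mul h.isOpen (h.smooth_disclination 2 2) hx,
    pd_coord_sub_mul h.isOpen (h.smooth_disclination 2 2) hx] at hp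
  obtain ⟨hv0, hv1, hv2⟩ := h.vertical x hx
  have hs0 := h.shear 0 (by decide) x hx
  have hs1 := h.shear 1 (by decide) x hx
  obtain ⟨hT0, hT1⟩ := h.disclination_horizontal x hx
  have hT := fun i j hi => h.disclination_of_ne i j hi x hx
  have hΘz := h.disclination_z 2 2 x hx
  have hΛz := fun j => h.dislocation_z 2 j x hx
  simp only [curl, pd_completedFrank h.isOpen h.smooth_strain h.smooth_disclination
    h.smooth_dislocation hx, pd_frankTensor h.isOpen h.smooth_strain hx,
    pd_contortion h.isOpen h.smooth_disclination h.smooth_dislocation hx]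
  -- The second derivatives of the strain become opaque coefficients, so that each of the nine
  -- components is a linear identity.
  generalize hD : (fun l p q j => pd l (pd p (E q j)) x) = D at *
  have hD' : ∀ l p q j, pd l (pd p (E q j)) x = D l p q j := fun l p q j => by rw [← hD]
  simp only [hD'] at *
  have c1 := hcomm 1 0
  have s1 := fun l p => hsymm l p 1 0
  have s2 := fun l p => hsymm l p 2 0
  have s3 := fun l p => hsymm l p 2 1
  fin_cases i <;> fin_cases k <;>
    simp [Fin.sum_univ_three, eps, kron, hz, hz', hΘz, hΛz, hT, hT0, hT1, s1, s2, s3, c1] at * <;>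
    norm_num <;>
    linarith

/-- The strain and Frank terms cancel by symmetry of `E`. Contracting the permutation symbols leaves
`κ_ik - δ_ik tr κ + ε_kpq (x_p - x_0p) Θ_iq`. Since `tr κ = -½ Λ_zz`, the diagonal part of `κ`
disappears, and the moment of `Θ_zz` built into `κ` cancels the last term, which leaves `δ_iz Λ_zk`.
-/
theorem curl_completedBurgers (h : Macroscopic Ω x₀ E Θ Λ) {x : Space} (hx : x ∈ Ω)
    (i k : Fin 3) : Λ i k x = curl (completedBurgers E Θ Λ x₀) i k x := by
  rw [Crystal.curl_completedBurgers h.isOpen h.smooth_strain h.smooth_disclination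
    h.smooth_dislocation hx]
  simp only [← h.curl_completedFrank hx, completedFrank, frankTensor, contortion]
  have hsymm : ∀ l q j, pd l (E q j) x = pd l (E j q) x := fun l q j =>
    dd_congr ((h.strain_symm q j).eventuallyEq_of_mem (h.isOpen.mem_nhds hx)) _
  have hz : ∀ q j, pd 2 (E q j) x = 0 := fun q j => h.strain_z q j x hx
  obtain ⟨hT0, hT1⟩ := h.disclination_horizontal x hx
  have hT := fun i j hi => h.disclination_of_ne i j hi x hx
  have hL := fun i j hi => h.dislocation_of_ne i j hi x hx
  have s1 := fun l => hsymm l 1 0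
  have s2 := fun l => hsymm l 2 0
  have s3 := fun l => hsymm l 2 1
  fin_cases i <;> fin_cases k <;>
    simp [Fin.sum_univ_three, eps, kron, hz, hT, hL, hT0, hT1, s1, s2, s3] <;>
    norm_num <;>
    ring

end Macroscopic

end Algebra

/-! ### Passage to the limit -/

section Limit

theorem integral_mul_pd {Ω : Set Space} (hΩ : IsOpen Ω) {f φ : Space → ℝ}
    (hf : ContDiffOn ℝ ∞ f Ω) (hφ : IsTest Ω φ) (a : Fin 3) :
    ∫ x, f x * pd a φ x = -∫ x, pd a f x * φ x :=
  hφ.integral_mul_dd hΩ hf _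

theorem integral_mul_pd_pd {Ω : Set Space} (hΩ : IsOpen Ω) {f φ : Space → ℝ}
    (hf : ContDiffOn ℝ ∞ f Ω) (hφ : IsTest Ω φ) (a b : Fin 3) :
    ∫ x, f x * pd a (pd b φ) x = ∫ x, pd b (pd a f) x * φ x := by
  have h : IsTest Ω (pd b φ) := hφ.dd _
  rw [integral_mul_pd hΩ hf h,
    integral_mul_pd hΩ (pd_smoothOn hΩ hf a) hφ, neg_neg]

theorem integral_add_mul {Ω : Set Space} (hΩ : IsOpen Ω) {f g φ : Space → ℝ}
    (hf : ContDiffOn ℝ ∞ f Ω) (hg : ContDiffOn ℝ ∞ g Ω) (hφ : IsTest Ω φ) :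
    ∫ x, (f x + g x) * φ x = (∫ x, f x * φ x) + ∫ x, g x * φ x := by
  simp only [add_mul]
  exact integral_add
    (hφ.integrable_mul (hf.continuousOn.locallyIntegrableOn hΩ.measurableSet))
    (hφ.integrable_mul (hg.continuousOn.locallyIntegrableOn hΩ.measurableSet))

theorem integral_sub_mul {Ω : Set Space} (hΩ : IsOpen Ω) {f g φ : Space → ℝ}
    (hf : ContDiffOn ℝ ∞ f Ω) (hg : ContDiffOn ℝ ∞ g Ω) (hφ : IsTest Ω φ) :
    ∫ x, (f x - g x) * φ x = (∫ x, f x * φ x) - ∫ x, g x * φ x := by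
  simp only [sub_mul]
  exact integral_sub
    (hφ.integrable_mul (hf.continuousOn.locallyIntegrableOn hΩ.measurableSet))
    (hφ.integrable_mul (hg.continuousOn.locallyIntegrableOn hΩ.measurableSet))

theorem HomogenizesTo.tendsto {ι : Type*} {Ω : Set Space} {l : Filter ι}
    {μ : ι → Fin 3 → Fin 3 → (Space → ℝ) → ℝ} {T : TensorField} (h : HomogenizesTo Ω l μ T)
    {φ : Space → ℝ} (hφ : IsTest Ω φ) (i j : Fin 3) :
    Tendsto (fun n => μ n i j φ) l (𝓝 (∫ x, T i j x * φ x)) :=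
  h i j φ hφ.continuous hφ.2 hφ.3

theorem eq_zero_of_tendsto {ι : Type*} {l : Filter ι} [l.NeBot] {f : ι → ℝ} {a : ℝ}
    (h : Tendsto f l (𝓝 a)) (h0 : ∀ n, f n = 0) : a = 0 :=
  tendsto_nhds_unique h (tendsto_const_nhds.congr fun n => (h0 n).symm)

theorem contDiff_coord_sub (x₀ : Space) (b : Fin 3) : ContDiff ℝ ∞ fun x : Space => x b - x₀ b :=
  (contDiff_coord b).sub contDiff_const

/-- A smooth field vanishes if it does so against the products of test functions of the horizontal
and vertical variables, supported in small boxes. -/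
theorem eq_zero_of_box {Ω : Set Space} (hΩ : IsOpen Ω) {f : Space → ℝ} (hf : ContDiffOn ℝ ∞ f Ω)
    (h : ∀ (U : Set Plane) (J : Set ℝ) (z₀ : ℝ) (u : Plane → ℝ) (χ : ℝ → ℝ), IsOpen U →
      BoxIn U J Ω → IsOpen J → IsPreconnected J → z₀ ∈ J → IsTest U u → IsTest J χ →
      ∫ y, f y * tens u χ y = 0) {x : Space} (hx : x ∈ Ω) : f x = 0 := by
  obtain ⟨r, hr, hbox⟩ := exists_box hΩ hx
  exact eq_zero_of_integral_tens hΩ hf.continuousOn hx hr fun u χ hu hχ =>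
    h _ _ (x 2) u χ Metric.isOpen_ball hbox Metric.isOpen_ball
      (convex_ball _ _).isPreconnected (Metric.mem_ball_self hr) hu hχ

/-- Each law is a linear relation that every crystal satisfies against product test functions. It
survives the limit, the derivatives are moved onto the smooth limit fields, and orthogonality to all
product functions in small boxes gives the pointwise law. -/
theorem macroscopic_of_homogenizesTo {Ω : Set Space} (hΩ : IsOpen Ω) {x₀ : Space}
    {ι : Type*} {l : Filter ι} [l.NeBot] {M : ι → Mesoscopic Ω x₀} {E Θ Λ : TensorField}
    (hE : ∀ i j, ContDiffOn ℝ ∞ (E i j) Ω)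
    (hΘ : ∀ i j, ContDiffOn ℝ ∞ (Θ i j) Ω)
    (hΛ : ∀ i j, ContDiffOn ℝ ∞ (Λ i j) Ω)
    (hlimE : HomogenizesTo Ω l (fun n => (M n).strainMeasure) E)
    (hlimΘ : HomogenizesTo Ω l (fun n => (M n).disclination) Θ)
    (hlimΛ : HomogenizesTo Ω l (fun n => (M n).dislocation) Λ) : Macroscopic Ω x₀ E Θ Λ where
  isOpen := hΩ
  smooth_strain := hE
  smooth_disclination := hΘ
  smooth_dislocation := hΛ
  strain_symm i j x hx := by
    refine sub_eq_zero.1 (eq_zero_of_box hΩ (f := fun y => E i j y - E j i y)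
      ((hE i j).sub (hE j i)) (fun U J z₀ u χ hU hbox hJo hJ hz₀ hu hχ => ?_) hx)
    have hφ := hu.tens hbox hχ
    rw [integral_sub_mul hΩ (hE i j) (hE j i) hφ]
    exact eq_zero_of_tendsto ((hlimE.tendsto hφ i j).sub (hlimE.tendsto hφ j i)) fun n =>
      sub_eq_zero.2 ((M n).strainMeasure_symm hΩ hbox hJo hJ hz₀ hu hχ i j)
  strain_z i j x hx := by
    refine eq_zero_of_box hΩ (pd_smoothOn hΩ (hE i j) 2)
      (fun U J z₀ u χ hU hbox hJo hJ hz₀ hu hχ => ?_) hx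
    have hφ := hu.tens hbox hχ
    rw [← neg_eq_zero, ← integral_mul_pd hΩ (hE i j) hφ]
    exact eq_zero_of_tendsto (hlimE.tendsto (φ := pd 2 (tens u χ)) (hφ.dd _) i j) fun n =>
      (M n).strain_z i j _ (isTest_iff.1 hφ)
  disclination_of_ne i j hi x hx := by
    refine eq_zero_of_box hΩ (hΘ i j) (fun U J z₀ u χ hU hbox hJo hJ hz₀ hu hχ => ?_) hx
    exact eq_zero_of_tendsto (hlimΘ.tendsto (hu.tens hbox hχ) i j) fun n =>
      (M n).disclination_of_ne hi j _
  dislocation_of_ne i j hi x hx := by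
    refine eq_zero_of_box hΩ (hΛ i j) (fun U J z₀ u χ hU hbox hJo hJ hz₀ hu hχ => ?_) hx
    exact eq_zero_of_tendsto (hlimΛ.tendsto (hu.tens hbox hχ) i j) fun n =>
      (M n).dislocation_of_ne hi j _
  disclination_horizontal x hx := by
    refine ⟨eq_zero_of_box hΩ (hΘ 2 0) (fun U J z₀ u χ hU hbox hJo hJ hz₀ hu hχ => ?_) hx,
      eq_zero_of_box hΩ (hΘ 2 1) (fun U J z₀ u χ hU hbox hJo hJ hz₀ hu hχ => ?_) hx⟩
    · exact eq_zero_of_tendsto (hlimΘ.tendsto (hu.tens hbox hχ) 2 0) fun n =>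
        ((M n).disclination_horizontal hΩ hU hbox hJo hJ hz₀ hu hχ).1
    · exact eq_zero_of_tendsto (hlimΘ.tendsto (hu.tens hbox hχ) 2 1) fun n =>
        ((M n).disclination_horizontal hΩ hU hbox hJo hJ hz₀ hu hχ).2
  disclination_z i j x hx := by
    refine eq_zero_of_box hΩ (pd_smoothOn hΩ (hΘ i j) 2)
      (fun U J z₀ u χ hU hbox hJo hJ hz₀ hu hχ => ?_) hx
    have hφ := hu.tens hbox hχ
    rw [← neg_eq_zero, ← integral_mul_pd hΩ (hΘ i j) hφ]
    exact eq_zero_of_tendsto (hlimΘ.tendsto (φ := pd 2 (tens u χ)) (hφ.dd _) i j) fun n =>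
      ((M n).density_pd_two hbox hJ hz₀ hu hχ i j).1
  dislocation_z i j x hx := by
    refine eq_zero_of_box hΩ (pd_smoothOn hΩ (hΛ i j) 2)
      (fun U J z₀ u χ hU hbox hJo hJ hz₀ hu hχ => ?_) hx
    have hφ := hu.tens hbox hχ
    rw [← neg_eq_zero, ← integral_mul_pd hΩ (hΛ i j) hφ]
    exact eq_zero_of_tendsto (hlimΛ.tendsto (φ := pd 2 (tens u χ)) (hφ.dd _) i j) fun n =>
      ((M n).density_pd_two hbox hJ hz₀ hu hχ i j).2
  vertical x hx := by
    have hs := fun a b => pd_smoothOn hΩ (pd_smoothOn hΩ (hE 2 2) a) b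
    have ht : ∀ {U J u χ}, BoxIn U J Ω → IsTest U u → IsTest J χ → ∀ a b,
        IsTest Ω (pd a (pd b (tens u χ))) := fun hbox hu hχ a b => ((hu.tens hbox hχ).dd _).dd _
    refine ⟨eq_zero_of_box hΩ (hs 0 0) (fun U J z₀ u χ hU hbox hJo hJ hz₀ hu hχ => ?_) hx,
      eq_zero_of_box hΩ (hs 0 1) (fun U J z₀ u χ hU hbox hJo hJ hz₀ hu hχ => ?_) hx,
      eq_zero_of_box hΩ (hs 1 1) (fun U J z₀ u χ hU hbox hJo hJ hz₀ hu hχ => ?_) hx⟩ <;>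
    rw [← integral_mul_pd_pd hΩ (hE 2 2) (hu.tens hbox hχ)]
    · exact eq_zero_of_tendsto (hlimE.tendsto (ht hbox hu hχ 0 0) 2 2) fun n =>
        ((M n).vertical_strain hΩ hU hbox hJo hJ hz₀ hu hχ).1
    · exact eq_zero_of_tendsto (hlimE.tendsto (ht hbox hu hχ 0 1) 2 2) fun n =>
        ((M n).vertical_strain hΩ hU hbox hJo hJ hz₀ hu hχ).2.1
    · exact eq_zero_of_tendsto (hlimE.tendsto (ht hbox hu hχ 1 1) 2 2) fun n =>
        ((M n).vertical_strain hΩ hU hbox hJo hJ hz₀ hu hχ).2.2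
  shear w hw x hx := by
    have h1 := pd_smoothOn hΩ (pd_smoothOn hΩ (hE 2 1) 0) w
    have h2 := pd_smoothOn hΩ (pd_smoothOn hΩ (hE 2 0) 1) w
    have h3 := pd_smoothOn hΩ (hΛ 2 2) w
    have h4 : ContDiffOn ℝ ∞ (fun y => 1 / 2 * pd w (Λ 2 2) y) Ω := contDiffOn_const.mul h3
    refine eq_zero_of_box hΩ
      (f := fun y => pd w (pd 0 (E 2 1)) y - pd w (pd 1 (E 2 0)) y - 1 / 2 * pd w (Λ 2 2) y)
      ((h1.sub h2).sub h4) (fun U J z₀ u χ hU hbox hJo hJ hz₀ hu hχ => ?_) hx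
    have hφ := hu.tens hbox hχ
    have hd : IsTest Ω (pd w (tens u χ)) := hφ.dd _
    have hdd : ∀ a, IsTest Ω (pd a (pd w (tens u χ))) := fun a => hd.dd _
    rw [integral_sub_mul hΩ (h1.sub h2) h4 hφ, integral_sub_mul hΩ h1 h2 hφ,
      ← integral_mul_pd_pd hΩ (hE 2 1) hφ, ← integral_mul_pd_pd hΩ (hE 2 0) hφ]
    simp only [mul_assoc]
    rw [integral_const_mul, sub_eq_add_neg _ (1 / 2 * _), ← mul_neg,
      ← integral_mul_pd hΩ (hΛ 2 2) hφ]
    exact eq_zero_of_tendsto (((hlimE.tendsto (hdd 0) 2 1).sub (hlimE.tendsto (hdd 1) 2 0)).add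
      ((hlimΛ.tendsto hd 2 2).const_mul (1 / 2))) fun n =>
        (M n).shear_strain hΩ hU hbox hJo hJ hz₀ hu hχ hw
  plane x hx := by
    have a1 := pd_smoothOn hΩ (pd_smoothOn hΩ (hE 1 1) 0) 0
    have a2 := pd_smoothOn hΩ (pd_smoothOn hΩ (hE 1 0) 0) 1
    have a3 := pd_smoothOn hΩ (pd_smoothOn hΩ (hE 0 1) 1) 0
    have a4 := pd_smoothOn hΩ (pd_smoothOn hΩ (hE 0 0) 1) 1
    have hm : ∀ b, ContDiffOn ℝ ∞ (fun y => (y b - x₀ b) * Θ 2 2 y) Ω := fun b =>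
      (contDiff_coord_sub x₀ b).contDiffOn.mul (hΘ 2 2)
    have a6 := pd_smoothOn hΩ (hΛ 2 1) 0
    have a7 := pd_smoothOn hΩ (hm 0) 0
    have a8 := pd_smoothOn hΩ (hΛ 2 0) 1
    have a9 := pd_smoothOn hΩ (hm 1) 1
    have b2 := a1.sub a2
    have b3 := b2.sub a3
    have b4 := b3.add a4
    have b5 := b4.sub (hΘ 2 2)
    have b6 := b5.sub a6
    have b7 := b6.sub a7
    have b8 := b7.add a8
    refine eq_zero_of_box hΩ (f := fun x => pd 0 (pd 0 (E 1 1)) x - pd 1 (pd 0 (E 1 0)) x -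
      pd 0 (pd 1 (E 0 1)) x + pd 1 (pd 1 (E 0 0)) x -
      Θ 2 2 x - pd 0 (Λ 2 1) x - pd 0 (fun y => (y 0 - x₀ 0) * Θ 2 2 y) x + pd 1 (Λ 2 0) x -
      pd 1 (fun y => (y 1 - x₀ 1) * Θ 2 2 y) x)
      (b8.sub a9) (fun U J z₀ u χ hU hbox hJo hJ hz₀ hu hχ => ?_) hx
    have hφ := hu.tens hbox hχ
    have hd : ∀ a, IsTest Ω (pd a (tens u χ)) := fun a => hφ.dd _
    have hdd : ∀ a b, IsTest Ω (pd a (pd b (tens u χ))) := fun a b => (hd b).dd _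
    have hmd : ∀ b, IsTest Ω fun y => (y b - x₀ b) * pd b (tens u χ) y := fun b =>
      (hd b).mul_left (contDiff_coord_sub x₀ b)
    have key := eq_zero_of_tendsto
      (((((((((hlimE.tendsto (hdd 0 0) 1 1).sub (hlimE.tendsto (hdd 0 1) 1 0)).sub
        (hlimE.tendsto (hdd 1 0) 0 1)).add (hlimE.tendsto (hdd 1 1) 0 0)).sub
        (hlimΘ.tendsto hφ 2 2)).add (hlimΛ.tendsto (hd 0) 2 1)).add
        (hlimΘ.tendsto (hmd 0) 2 2)).sub (hlimΛ.tendsto (hd 1) 2 0)).add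
        (hlimΘ.tendsto (hmd 1) 2 2)) fun n =>
        (M n).plane_strain hΩ hU hbox hJo hJ hz₀ hu hχ
    -- The coordinate weight is moved from the test function to `Θ` before integrating by parts, so
    -- that it stands inside the derivative as in the law `plane`.
    have hmul : ∀ b, ∫ y, Θ 2 2 y * ((y b - x₀ b) * pd b (tens u χ) y) =
        -∫ y, pd b (fun y => (y b - x₀ b) * Θ 2 2 y) y * tens u χ y := fun b => by
      rw [← integral_mul_pd hΩ (hm b) hφ]
      congr with y
      ring
    rw [integral_mul_pd_pd hΩ (hE 1 1) hφ, integral_mul_pd_pd hΩ (hE 1 0) hφ,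
      integral_mul_pd_pd hΩ (hE 0 1) hφ, integral_mul_pd_pd hΩ (hE 0 0) hφ,
      integral_mul_pd hΩ (hΛ 2 1) hφ, integral_mul_pd hΩ (hΛ 2 0) hφ, hmul 0, hmul 1] at key
    rw [integral_sub_mul hΩ b8 a9 hφ, integral_add_mul hΩ b7 a8 hφ, integral_sub_mul hΩ b6 a7 hφ,
      integral_sub_mul hΩ b5 a6 hφ, integral_sub_mul hΩ b4 (hΘ 2 2) hφ,
      integral_add_mul hΩ b3 a4 hφ, integral_sub_mul hΩ b2 a3 hφ, integral_sub_mul hΩ a1 a2 hφ]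
    linarith

end Limit

end Crystal

end

open Crystal in
theorem theorem4p1 {Ω : Set Space} (hΩ : IsOpen Ω) (x₀ : Space)
    {ι : Type*} (l : Filter ι) [l.NeBot] (M : ι → Mesoscopic Ω x₀)
    (E Θ Λ : TensorField)
    (hE : ∀ i j, ContDiffOn ℝ ∞ (E i j) Ω)
    (hΘ : ∀ i j, ContDiffOn ℝ ∞ (Θ i j) Ω)
    (hΛ : ∀ i j, ContDiffOn ℝ ∞ (Λ i j) Ω)
    (hlimE : HomogenizesTo Ω l (fun n => (M n).strainMeasure) E)
    (hlimΘ : HomogenizesTo Ω l (fun n => (M n).disclination) Θ)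
    (hlimΛ : HomogenizesTo Ω l (fun n => (M n).dislocation) Λ) :
    (∀ x ∈ Ω, ∀ i k, Θ i k x = curl (completedFrank E Θ Λ x₀) i k x) ∧
      (∀ x ∈ Ω, ∀ i k, Λ i k x = curl (completedBurgers E Θ Λ x₀) i k x) := by
  have h := macroscopic_of_homogenizesTo hΩ hE hΘ hΛ hlimE hlimΘ hlimΛ
  exact ⟨fun _ hx i k => h.curl_completedFrank hx i k,
    fun _ hx i k => h.curl_completedBurgers hx i k⟩
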